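/- Conventions. Quantum circuits are finite sequences of gates from $\{X,H,T,\mathrm{CNOT},\mathrm{Toffoli}\}$, described by bit strings (with numbers written in unary). A promise problem is a pair of disjoint sets of bit strings (\emph{yes} and \emph{no} instances). $\mathsf{BQP}$ is the class of promise problems for which there is a polynomial-time uniform family $(C_x)$ of quantum circuits with one output qubit such that $C_x$ accepts with probability at least $2/3$ if $x$ is a \emph{yes} instance and at most $1/3$ if $x$ is a \emph{no} instance. A promise problem is $\mathsf{BQP}$-hard if every problem in $\mathsf{BQP}$ reduces to it by a deterministic polynomial-time (Karp) reduction. For a density matrix $\rho$ with eigenvalues $\lambda_i$, put $S_\alpha(\rho)=\frac{1}{1-\alpha}\ln\mathrm{Tr}(\rho^\alpha)=\frac{1}{1-\alpha}\ln\sum_i\lambda_i^\alpha$ for real $\alpha>0$, $\alpha\neq1$; $S_1(\rho)=-\mathrm{Tr}(\rho\ln\rho)$; and $S_\infty(\rho)=-\ln\lambda_{\max}(\rho)$. The problem. Let $m$ be a polynomial, $\alpha\in(0,\infty]$, $t,g:\mathbb N\to\mathbb R$ and $N\in\mathbb N$. An instance of $\textsc{Rank2RényiQEA}_\alpha[t(n),g(n)]$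 on $n\ge N$ output qubits is a quantum circuit $Q$ acting on $m(n)$ qubits with $n$ specified output qubits, for some $n\ge N$, such that the state $\rho$, obtained by running $Q$ on $|0\rangle^{\otimes m(n)}$ and tracing out the non-output qubits, has rank at most two. It is a \emph{yes} instance if $S_\alpha(\rho)\ge t(n)+g(n)$ and a \emph{no} instance if $S_\alpha(\rho)\le t(n)-g(n)$. Thresholds and gaps. For $0<\alpha<2$, $$t(n;\alpha)=\tfrac{\ln2}{2}-2^{-n}+2^{-2n-1}+\tfrac{\ln2}{2}\bigl(-\log_2(1-2^{-2n-1})\bigr)^{\alpha/2},$$ $$g(n;\alpha)=\tfrac{\ln2}{2}-2^{-n}+2^{-2n-1}-\tfrac{\ln2}{2}\bigl(-\log_2(1-2^{-2n-1})\bigr)^{\alpha/2};$$ for $\alpha=2$, $$t(n;2)=\tfrac12\bigl(\ln2-\ln(1-2^{-2n-1})\bigr)-2^{-n}+2^{-2n-1},\qquad g(n;2)=\tfrac12\ln(2-2^{-2n})-2^{-n}+2^{-2n-1};$$ for $2<\alpha\le\infty$, where $\frac{\alpha}{4(\alpha-1)}$ is read as $\frac14$ if $\alpha=\infty$, $$t(n;\alpha)=\tfrac{\alpha}{4(\alpha-1)}\bigl(\ln2-2^{-n+1}+2^{-2n}\bigr)-\tfrac12\ln(1-2^{-2n-1}),$$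 $$g(n;\alpha)=\tfrac{\alpha}{4(\alpha-1)}\bigl(\ln2-2^{-n+1}+2^{-2n}\bigr)+\tfrac12\ln(1-2^{-2n-1}).$$ Let $n_0(\alpha)=\lfloor2/\alpha\rfloor$ if $0<\alpha<1$, and $n_0(\alpha)=2$ if $1\le\alpha\le\infty$. Theorem. There is a universal constant $c>0$ such that $t(n;\alpha)>0$ and $g(n;\alpha)\ge c$ for all $\alpha\in(0,\infty]$ and all integers $n\ge n_0(\alpha)$. Moreover, there is a polynomial $m$ such that, for every order $\alpha\in(0,\infty]$ and every integer $N\ge n_0(\alpha)$, the promise problem $\textsc{Rank2RényiQEA}_\alpha[t(n;\alpha),g(n;\alpha)]$ on $n\ge N$ output qubits is well defined (no string is both a \emph{yes} and a \emph{no} instance) and $\mathsf{BQP}$-hard under Karp reductions. -/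

import Mathlib

open scoped ENNReal

namespace QEA

noncomputable section

/-! ### Quantum circuits

The computational basis of `m` qubits is `Fin m → Bool`. -/

/-- Elementary gates on `m` qubits: the universal gate set `X`, `H`, `T`, `CNOT`, `Toffoli`. -/
inductive Gate (m : ℕ) : Type
  | X (i : Fin m) : Gate m
  | H (i : Fin m) : Gate m
  | T (i : Fin m) : Gate m
  | CNOT (c t : Fin m) (h : c ≠ t) : Gate m
  | Toffoli (a b t : Fin m) (hab : a ≠ b) (hat : a ≠ t) (hbt : b ≠ t) : Gate m

/-- The one-qubit operator `U` acting on qubit `i`, and the identity on all other qubits. -/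
def oneQubit {m : ℕ} (U : Matrix Bool Bool ℂ) (i : Fin m) :
    Matrix (Fin m → Bool) (Fin m → Bool) ℂ :=
  Matrix.of fun x y => if ∀ j, j ≠ i → x j = y j then U (x i) (y i) else 0

/-- The linear operator that sends the basis vector `|y⟩` to `|f y⟩`. -/
def classicalOp {m : ℕ} (f : (Fin m → Bool) → (Fin m → Bool)) :
    Matrix (Fin m → Bool) (Fin m → Bool) ℂ :=
  Matrix.of fun x y => if x = f y then 1 else 0

/-- The Hadamard matrix. -/
def hadamard : Matrix Bool Bool ℂ :=
  Matrix.of fun a b => if a = true ∧ b = true then -(1 / (Real.sqrt 2 : ℂ)) else 1 / (Real.sqrt 2 : ℂ)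

/-- The `π/8` gate `diag(1, e^{iπ/4})`. -/
def tMatrix : Matrix Bool Bool ℂ :=
  Matrix.diagonal fun a => if a = true then Complex.exp (Complex.I * (Real.pi / 4 : ℝ)) else 1

/-- The unitary operator of a gate. -/
def Gate.op {m : ℕ} : Gate m → Matrix (Fin m → Bool) (Fin m → Bool) ℂ
  | .X i => classicalOp fun y => Function.update y i (!y i)
  | .H i => oneQubit hadamard i
  | .T i => oneQubit tMatrix i
  | .CNOT c t _ => classicalOp fun y => Function.update y t (xor (y t) (y c))
  | .Toffoli a b t _ _ _ => classicalOp fun y => Function.update y t (xor (y t) (y a && y b))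

/-- A quantum circuit acting on `m` qubits with `n` specified output qubits.
The head of the list of gates is applied first. -/
structure Circuit (m n : ℕ) where
  gates : List (Gate m)
  out : Fin n ↪ Fin m

/-- The unitary operator of a sequence of gates, the head being applied first. -/
def gatesOp {m : ℕ} : List (Gate m) → Matrix (Fin m → Bool) (Fin m → Bool) ℂ
  | [] => 1
  | g :: gs => gatesOp gs * g.op

namespace Circuit

variable {m n : ℕ}

/-- The pure state obtained by running the circuit on `|0⟩^{⊗m}`. -/
def state (C : Circuit m n) : (Fin m → Bool) → ℂ :=
  Matrix.mulVec (gatesOp C.gates) (Pi.single (fun _ => false) 1)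

/-- The state of the output qubits: the partial trace of `|ψ⟩⟨ψ|`, `ψ = C.state`, over all qubits
that are not output qubits. -/
def outputState (C : Circuit m n) : Matrix (Fin n → Bool) (Fin n → Bool) ℂ :=
  Matrix.of fun a b => ∑ x : Fin m → Bool, ∑ y : Fin m → Bool,
    if (∀ i, x (C.out i) = a i) ∧ (∀ i, y (C.out i) = b i) ∧
        (∀ j, (∀ i, C.out i ≠ j) → x j = y j)
    then C.state x * star (C.state y) else 0

theorem outputState_isHermitian (C : Circuit m n) : C.outputState.IsHermitian := by
  ext a b
  simp only [outputState, Matrix.conjTranspose_apply, Matrix.of_apply, star_sum]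
  rw [Finset.sum_comm]
  refine Finset.sum_congr rfl fun x _ => Finset.sum_congr rfl fun y _ => ?_
  have hiff : ((∀ i, y (C.out i) = b i) ∧ (∀ i, x (C.out i) = a i) ∧
      (∀ j, (∀ i, C.out i ≠ j) → y j = x j)) ↔ ((∀ i, x (C.out i) = a i) ∧
      (∀ i, y (C.out i) = b i) ∧ (∀ j, (∀ i, C.out i ≠ j) → x j = y j)) := by
    constructor
    · rintro ⟨h1, h2, h3⟩
      exact ⟨h2, h1, fun j hj => (h3 j hj).symm⟩
    · rintro ⟨h1, h2, h3⟩
      exact ⟨h2, h1, fun j hj => (h3 j hj).symm⟩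
  by_cases h : (∀ i, x (C.out i) = a i) ∧ (∀ i, y (C.out i) = b i) ∧
      (∀ j, (∀ i, C.out i ≠ j) → x j = y j)
  · rw [if_pos h, if_pos (hiff.2 h)]
    simp [mul_comm]
  · rw [if_neg h, if_neg (fun h' => h (hiff.1 h'))]
    simp

/-- The probability that a circuit with one output qubit accepts, i.e. that the measurement of
the output qubit in the computational basis yields `1`. -/
def acceptProb (C : Circuit m 1) : ℝ :=
  ∑ x : Fin m → Bool, if x (C.out 0) = true then ‖C.state x‖ ^ 2 else 0

end Circuit

/-! ### Descriptions of circuits as bit strings -/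

/-- Self-delimiting unary code of a natural number. -/
def encodeNat (k : ℕ) : List Bool := List.replicate k true ++ [false]

/-- The code of a gate: the kind of gate, then the qubits that it acts on. -/
def Gate.encode {m : ℕ} : Gate m → List Bool
  | .X i => encodeNat 0 ++ encodeNat i
  | .H i => encodeNat 1 ++ encodeNat i
  | .T i => encodeNat 2 ++ encodeNat i
  | .CNOT c t _ => encodeNat 3 ++ encodeNat c ++ encodeNat t
  | .Toffoli a b t _ _ _ => encodeNat 4 ++ encodeNat a ++ encodeNat b ++ encodeNat t

/-- The description of a circuit: the number of qubits, the number of output qubits, the list of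
output qubits, the list of gates. -/
def Circuit.encode {m n : ℕ} (C : Circuit m n) : List Bool :=
  encodeNat m ++ encodeNat n ++ (List.ofFn fun i => encodeNat (C.out i)).flatten ++
    C.gates.flatMap Gate.encode

/-! ### Promise problems, `BQP`, Karp reductions -/

/-- A promise problem: a set of *yes* instances and a set of *no* instances, which are meant to be
disjoint. -/
structure PromiseProblem where
  yes : Set (List Bool)
  no : Set (List Bool)

/-- No string is both a *yes* and a *no* instance. -/
def PromiseProblem.Consistent (P : PromiseProblem) : Prop := Disjoint P.yes P.no

/-- A function on bit strings that a deterministic Turing machine computes in polynomial time. -/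
def PolyTime (f : List Bool → List Bool) : Prop :=
  Nonempty (Turing.TM2ComputableInPolyTime (id : List Bool → List Bool)
    (id : List Bool → List Bool) f)

/-- `BQP`: there is a polynomial-time uniform family of quantum circuits `C x`, one for each
input `x`, that accepts *yes* instances with probability at least `2/3` and *no* instances with
probability at most `1/3`. -/
def BQP : Set PromiseProblem :=
  {L | ∃ (k : List Bool → ℕ) (C : (x : List Bool) → Circuit (k x) 1),
    PolyTime (fun x => (C x).encode) ∧
    (∀ x ∈ L.yes, 2 / 3 ≤ (C x).acceptProb) ∧
    (∀ x ∈ L.no, (C x).acceptProb ≤ 1 / 3)}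

/-- Karp (polynomial-time many-one) reducibility of promise problems. -/
def KarpReducible (L P : PromiseProblem) : Prop :=
  ∃ f : List Bool → List Bool, PolyTime f ∧
    (∀ x ∈ L.yes, f x ∈ P.yes) ∧ (∀ x ∈ L.no, f x ∈ P.no)

/-- `BQP`-hardness under Karp reductions. -/
def BQPHard (P : PromiseProblem) : Prop := ∀ L ∈ BQP, KarpReducible L P

/-! ### Quantum Rényi entropy and the promise problem -/

/-- The quantum `α`-Rényi entropy of a density matrix, for `α ∈ (0, ∞]`, in terms of the
eigenvalues `λ i`: `ln (∑ i, λ i ^ α) / (1 - α)` for `α ≠ 1, ∞`, and for the limiting orders the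
von Neumann entropy `-∑ i, λ i * ln (λ i)` (`α = 1`) and the min-entropy `-ln λ_max` (`α = ∞`). -/
def renyiEntropy {ι : Type*} [Fintype ι] [DecidableEq ι] (α : ℝ≥0∞) {ρ : Matrix ι ι ℂ}
    (hρ : ρ.IsHermitian) : ℝ :=
  if α = 1 then -∑ i, hρ.eigenvalues i * Real.log (hρ.eigenvalues i)
  else if α = ⊤ then -Real.log (⨆ i, hρ.eigenvalues i)
  else Real.log (∑ i, hρ.eigenvalues i ^ α.toReal) / (1 - α.toReal)

/-- The quantum `α`-Rényi entropy of the output state of a circuit. -/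
def Circuit.entropy {m n : ℕ} (C : Circuit m n) (α : ℝ≥0∞) : ℝ :=
  renyiEntropy α C.outputState_isHermitian

/-- Rank-two quantum `α`-Rényi entropy approximation with threshold `t` and gap `g`, for circuits
with `n` output qubits acting on `m n` qubits, on the instances with `n ≥ N`. -/
def rank2RenyiQEA (m : ℕ → ℕ) (α : ℝ≥0∞) (t g : ℕ → ℝ) (N : ℕ) : PromiseProblem where
  yes := {s | ∃ n, N ≤ n ∧ ∃ C : Circuit (m n) n, s = C.encode ∧
    C.outputState.rank ≤ 2 ∧ t n + g n ≤ C.entropy α}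
  no := {s | ∃ n, N ≤ n ∧ ∃ C : Circuit (m n) n, s = C.encode ∧
    C.outputState.rank ≤ 2 ∧ C.entropy α ≤ t n - g n}

/-- The factor `α / (4 (α - 1))`, for `α ∈ (2, ∞]`; at `α = ∞` its limit `1 / 4`. -/
def orderFactor (α : ℝ≥0∞) : ℝ :=
  if α = ⊤ then 1 / 4 else α.toReal / (4 * (α.toReal - 1))

/-- The threshold `t(n; α)`. Here `(1 / 2) ^ n` is `2^{-n}`, and so on. -/
def threshold (α : ℝ≥0∞) (n : ℕ) : ℝ :=
  if α < 2 then
    Real.log 2 / 2 - (1 / 2) ^ n + (1 / 2) ^ (2 * n + 1) +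
      Real.log 2 / 2 * (-Real.logb 2 (1 - (1 / 2) ^ (2 * n + 1))) ^ (α.toReal / 2)
  else if α = 2 then
    1 / 2 * (Real.log 2 - Real.log (1 - (1 / 2) ^ (2 * n + 1))) - (1 / 2) ^ n +
      (1 / 2) ^ (2 * n + 1)
  else
    orderFactor α * (Real.log 2 - 2 * (1 / 2) ^ n + (1 / 2) ^ (2 * n)) -
      1 / 2 * Real.log (1 - (1 / 2) ^ (2 * n + 1))

/-- The gap `g(n; α)`. -/
def gap (α : ℝ≥0∞) (n : ℕ) : ℝ :=
  if α < 2 then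
    Real.log 2 / 2 - (1 / 2) ^ n + (1 / 2) ^ (2 * n + 1) -
      Real.log 2 / 2 * (-Real.logb 2 (1 - (1 / 2) ^ (2 * n + 1))) ^ (α.toReal / 2)
  else if α = 2 then
    1 / 2 * Real.log (2 - (1 / 2) ^ (2 * n)) - (1 / 2) ^ n + (1 / 2) ^ (2 * n + 1)
  else
    orderFactor α * (Real.log 2 - 2 * (1 / 2) ^ n + (1 / 2) ^ (2 * n)) +
      1 / 2 * Real.log (1 - (1 / 2) ^ (2 * n + 1))

/-- The least admissible number of output qubits: `⌊2/α⌋` for `α < 1`, and `2` for `α ≥ 1`. -/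
def minOutputs (α : ℝ≥0∞) : ℕ :=
  if α < 1 then ⌊2 / α.toReal⌋₊ else 2

end

end QEA

/-! Let `C` be a circuit on `k` qubits that accepts with probability `p`, where `p ≥ 2/3` or `p ≤
1/3`. The reduction chooses a power of two `n = 2 ^ l ≥ k`. The new circuit runs `n ^ 4` copies of
`C` on fresh blocks of `n` wires and copies each answer to a leaf by a CNOT. A complete binary NAND
tree of depth `4 * l` is evaluated on the leaves. The AND of its root with a Hadamard coin is then
written to the first of `n` fresh output wires, all others staying `0`.

The root and the coin are traced out and determine the output, so the output state is diagonal with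
weights `x` and `1 - x`, where `x` is half the probability that the root is `true`
(`outputState_generated`). Its rank is at most two, and its entropy is that of one biased bit.

One NAND level maps `p` to `1 - p ^ 2`. Two levels act near `0` and near `1` like squaring the
error, and the fixed point 0.618… lies between 1/3 and 2/3. Hence depth `4 * l` brings the error
down to about `c ^ (n ^ 2)` with `c < 1`, below `16 ^ (-n)` (`nandProb_le`, `le_nandProb`). The tree
needs no counting, only X and Toffoli gates in a regular layout.

With `q = 2 ^ (-n)`: for a *yes* instance `x` is within `q ^ 4 / 2` of `1/2`. Every Rényi entropy is
at least the min-entropy, which is at least `ln 2 - q ^ 4`, whereas `t + g ≤ ln 2 - 2 * q + q ^ 2`.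
For a *no* instance `x ≤ q ^ 4 / 2`, and the entropy is of smaller order than `t - g` as `n` grows,
for each fixed `α` (`eventually_bitEntropy_le`). How large `n` must be depends on `α`, but the
instance size is the reduction's choice, so this bound and `N` become a constant factor of `n`.

Polynomial time is proved on the machine model itself. The generator of the new description is a
while program on stacks of bits, compiled to a multi-stack machine and appended to the machine that
computes the description of `C` (`PolyTime.of_prog`, `polyTime_generate`). The amplitudes are
analysed through expectations of functions of the measured wires (`measured`), where classical gates
act by substitution and each copy of `C` acts as one biased bit (`measured_block`). -/

open scoped ENNReal

/-! ### While programs on stacks of bits -/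

namespace StackProg

open Turing Function

/-- While programs on a family of stacks of bits; tests inspect the top of a stack. -/
inductive Prog (S : Type) : Type
  | push (k : S) (b : Bool) : Prog S
  | pop (k : S) : Prog S
  | seq (p q : Prog S) : Prog S
  | ite (k : S) (c : Option Bool → Bool) (p q : Prog S) : Prog S
  | whl (k : S) (c : Option Bool → Bool) (p : Prog S) : Prog S

infixr:60 " ;; " => Prog.seq

variable {S : Type} [DecidableEq S]

/-- `Exec p s s' t`: the program `p` leads from the store `s` to the store `s'` in time `t`,
where only the tests of loops are counted. -/
inductive Exec : Prog S → (S → List Bool) → (S → List Bool) → ℕ → Prop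
  | push (k b s) : Exec (.push k b) s (update s k (b :: s k)) 0
  | pop (k s) : Exec (.pop k) s (update s k (s k).tail) 0
  | seq {p q s s' s'' t t'} : Exec p s s' t → Exec q s' s'' t' → Exec (p ;; q) s s'' (t + t')
  | ite_true {k c p q s s' t} : c (s k).head? = true → Exec p s s' t → Exec (.ite k c p q) s s' t
  | ite_false {k c p q s s' t} : c (s k).head? = false → Exec q s s' t →
      Exec (.ite k c p q) s s' t
  | whl_done {k c p s} : c (s k).head? = false → Exec (.whl k c p) s s 1
  | whl_step {k c p s s' s'' t t'} : c (s k).head? = true → Exec p s s' t →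
      Exec (.whl k c p) s' s'' t' → Exec (.whl k c p) s s'' (t + t' + 1)

/-- The number of push instructions of a program. -/
def Prog.pushes : Prog S → ℕ
  | .push _ _ => 1
  | .pop _ => 0
  | .seq p q => p.pushes + q.pushes
  | .ite _ _ p q => p.pushes + q.pushes
  | .whl _ _ p => p.pushes

theorem Exec.length_le {p : Prog S} {s s' : S → List Bool} {t : ℕ} (h : Exec p s s' t) (k : S) :
    (s' k).length ≤ (s k).length + p.pushes * (t + 1) := by
  -- A loop needs the sharper bound with `t` in place of `t + 1`. The test counted in each pass then
  -- pays for the extra unit of the body, and the induction over the passes closes.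
  have aux : ∀ {p : Prog S} {s s' : S → List Bool} {t : ℕ}, Exec p s s' t →
      (s' k).length ≤ (s k).length + p.pushes * (t + 1) ∧
      ∀ k' c q, p = .whl k' c q → (s' k).length ≤ (s k).length + p.pushes * t := by
    intro p s s' t h
    induction h with
    | push k' b s =>
      refine ⟨?_, by simp⟩
      by_cases e : k = k'
      · subst e; simp [Prog.pushes]
      · simp [e]
    | pop k' s =>
      refine ⟨?_, by simp⟩
      by_cases e : k = k'
      · subst e; simp [Prog.pushes]
      · simp [e]
    | seq _ _ ih1 ih2 =>
      refine ⟨?_, by simp⟩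
      simp only [Prog.pushes]
      nlinarith [ih1.1, ih2.1]
    | ite_true _ _ ih =>
      refine ⟨?_, by simp⟩
      simp only [Prog.pushes]
      nlinarith [ih.1]
    | ite_false _ _ ih =>
      refine ⟨?_, by simp⟩
      simp only [Prog.pushes]
      nlinarith [ih.1]
    | whl_done _ => exact ⟨by simp, by simp⟩
    | whl_step _ _ _ ih1 ih2 =>
      have h2 := ih2.2 _ _ _ rfl
      simp only [Prog.pushes] at h2 ih1 ⊢
      exact ⟨by nlinarith [ih1.1], fun _ _ _ _ => by nlinarith [ih1.1]⟩
  exact (aux h).1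

/-! ### Compilation to stack machines -/

/-- The labels of the compiled program: one for each loop. -/
def Prog.Label : Prog S → Type
  | .push _ _ => Empty
  | .pop _ => Empty
  | .seq p q => p.Label ⊕ q.Label
  | .ite _ _ p q => p.Label ⊕ q.Label
  | .whl _ _ p => Option p.Label

instance Prog.fintypeLabel : (p : Prog S) → Fintype p.Label
  | .push _ _ => inferInstanceAs (Fintype Empty)
  | .pop _ => inferInstanceAs (Fintype Empty)
  | .seq p q =>
    letI := p.fintypeLabel
    letI := q.fintypeLabel
    inferInstanceAs (Fintype (p.Label ⊕ q.Label))
  | .ite _ _ p q =>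
    letI := p.fintypeLabel
    letI := q.fintypeLabel
    inferInstanceAs (Fintype (p.Label ⊕ q.Label))
  | .whl _ _ p =>
    letI := p.fintypeLabel
    inferInstanceAs (Fintype (Option p.Label))

variable {K₁ : Type} [DecidableEq K₁] {Γ₁ : K₁ → Type} {Λ σ₁ : Type}

/-- The stack alphabets of a machine, extended by stacks of bits. -/
abbrev Alph (Γ₁ : K₁ → Type) (S : Type) : K₁ ⊕ S → Type := Sum.elim Γ₁ fun _ => Bool

/-- The statement that starts the program `p` and continues with `e`. -/
def Prog.entry : (p : Prog S) → (p.Label → Λ) → TM2.Stmt (Alph Γ₁ S) Λ (σ₁ × Option Bool) →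
    TM2.Stmt (Alph Γ₁ S) Λ (σ₁ × Option Bool)
  | .push k b, _, e => .push (.inr k) (fun _ => b) e
  | .pop k, _, e => .pop (.inr k) (fun v _ => v) e
  | .seq p q, ι, e => p.entry (fun l => ι (.inl l)) (q.entry (fun l => ι (.inr l)) e)
  | .ite k c p q, ι, e => .peek (.inr k) (fun v o => (v.1, o)) (.branch (fun v => c v.2)
      (p.entry (fun l => ι (.inl l)) e) (q.entry (fun l => ι (.inr l)) e))
  | .whl _ _ _, ι, _ => .goto fun _ => ι none

/-- The statements at the labels of the program `p` that continues with `e`. -/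
def Prog.code : (p : Prog S) → (p.Label → Λ) → TM2.Stmt (Alph Γ₁ S) Λ (σ₁ × Option Bool) →
    p.Label → TM2.Stmt (Alph Γ₁ S) Λ (σ₁ × Option Bool)
  | .seq p q, ι, e, .inl l =>
    p.code (fun l => ι (.inl l)) (q.entry (fun l => ι (.inr l)) e) l
  | .seq _ q, ι, e, .inr l => q.code (fun l => ι (.inr l)) e l
  | .ite _ _ p _, ι, e, .inl l => p.code (fun l => ι (.inl l)) e l
  | .ite _ _ _ q, ι, e, .inr l => q.code (fun l => ι (.inr l)) e l
  | .whl k c p, ι, e, none => .peek (.inr k) (fun v o => (v.1, o)) (.branch (fun v => c v.2)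
      (p.entry (fun l => ι (some l)) (.goto fun _ => ι none)) e)
  | .whl _ _ p, ι, _, some l => p.code (fun l => ι (some l)) (.goto fun _ => ι none) l

/-- The stacks of a machine together with additional stacks of bits. -/
def join (A : ∀ k, List (Γ₁ k)) (s : S → List Bool) : ∀ k, List (Alph Γ₁ S k)
  | .inl k => A k
  | .inr k => s k

theorem update_join_inr (A : ∀ k, List (Γ₁ k)) (s : S → List Bool) (k : S) (l : List Bool) :
    update (join A s) (.inr k) l = join A (update s k l) := by
  funext j
  rcases j with j | j
  · exact update_of_ne (by simp) _ _
  · by_cases h : j = k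
    · subst h
      exact (update_self (Sum.inr j : K₁ ⊕ S) (β := fun k => List (Alph Γ₁ S k)) l _).trans
        (update_self j l s).symm
    · exact (update_of_ne (a := (Sum.inr j : K₁ ⊕ S)) (a' := Sum.inr k)
        (β := fun k => List (Alph Γ₁ S k)) (fun e => h (Sum.inr.inj e)) l _).trans (show s j = update s k l j from (update_of_ne h l s).symm)

theorem update_join_inl (A : ∀ k, List (Γ₁ k)) (s : S → List Bool) (k : K₁) (l : List (Γ₁ k)) :
    update (join A s) (.inl k) l = join (update A k l) s := by
  funext j
  rcases j with j | j
  · by_cases h : j = k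
    · subst h
      exact (update_self (Sum.inl j : K₁ ⊕ S) (β := fun k => List (Alph Γ₁ S k)) l _).trans
        (update_self j l A).symm
    · exact (update_of_ne (a := (Sum.inl j : K₁ ⊕ S)) (a' := Sum.inl k)
        (β := fun k => List (Alph Γ₁ S k)) (fun e => h (Sum.inl.inj e)) l _).trans (show A j = update A k l j from (update_of_ne h l A).symm)
  · exact update_of_ne (by simp) _ _

section Steps

variable {K : Type} [DecidableEq K] {Γ : K → Type} {Λ' σ : Type}

/-- The machine `M` leads from the configuration `a` to `b` in `t` steps. -/
def Steps (M : Λ' → TM2.Stmt Γ Λ' σ) (t : ℕ) (a b : TM2.Cfg Γ Λ' σ) : Prop :=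
  (flip bind (TM2.step M))^[t] (some a) = some b

theorem Steps.refl (M : Λ' → TM2.Stmt Γ Λ' σ) (a : TM2.Cfg Γ Λ' σ) : Steps M 0 a a := rfl

theorem Steps.trans {M : Λ' → TM2.Stmt Γ Λ' σ} {t t' : ℕ} {a b c : TM2.Cfg Γ Λ' σ}
    (h : Steps M t a b) (h' : Steps M t' b c) : Steps M (t + t') a c := by
  unfold Steps at *
  rw [Nat.add_comm, iterate_add_apply, h, h']

theorem Steps.single (M : Λ' → TM2.Stmt Γ Λ' σ) (l : Λ') (v : σ) (A : ∀ k, List (Γ k)) :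
    Steps M 1 ⟨some l, v, A⟩ (TM2.stepAux (M l) v A) := rfl

theorem steps_succ {M : Λ' → TM2.Stmt Γ Λ' σ} {t : ℕ} {a b : TM2.Cfg Γ Λ' σ}
    (h : Steps M (t + 1) a b) : ∃ l, a.l = some l ∧
      Steps M t (TM2.stepAux (M l) a.var a.stk) b := by
  obtain ⟨l, v, A⟩ := a
  cases l with
  | none =>
    exfalso
    have : ∀ n, (flip bind (TM2.step M))^[n] none = none := by
      intro n
      induction n with
      | zero => rfl
      | succ n ih => rw [iterate_succ_apply]; exact ih
    unfold Steps at h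
    rw [iterate_succ_apply] at h
    have h2 : flip bind (TM2.step M) (some ⟨none, v, A⟩) = none := rfl
    rw [h2, this] at h
    cases h
  | some l => exact ⟨l, rfl, h⟩

end Steps

theorem stepAux_code_none (k : S) (c : Option Bool → Bool) (p : Prog S)
    (ι : (Prog.whl k c p).Label → Λ) (e : TM2.Stmt (Alph Γ₁ S) Λ (σ₁ × Option Bool))
    (v : σ₁) (o : Option Bool) (A : ∀ k, List (Γ₁ k)) (s : S → List Bool) :
    TM2.stepAux ((Prog.whl k c p).code ι e none) (v, o) (join A s) =
      cond (c (s k).head?)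
        (TM2.stepAux (p.entry (fun l => ι (some l)) (.goto fun _ => ι none)) (v, (s k).head?)
          (join A s))
        (TM2.stepAux e (v, (s k).head?) (join A s)) := rfl

/-- One machine step executes a whole statement up to the next jump. Pushes, pops and branches are
therefore free, and a step is spent exactly when the label of a loop is entered, which is why `Exec`
counts loop tests only. The arbitrary embedding `ι` and continuation `e` let the induction pass to
subprograms. -/
theorem Exec.steps {p : Prog S} {s s' : S → List Bool} {t : ℕ} (h : Exec p s s' t)
    (M : Λ → TM2.Stmt (Alph Γ₁ S) Λ (σ₁ × Option Bool)) (ι : p.Label → Λ)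
    (e : TM2.Stmt (Alph Γ₁ S) Λ (σ₁ × Option Bool)) (hM : ∀ l, M (ι l) = p.code ι e l)
    (v : σ₁) (o : Option Bool) (A : ∀ k, List (Γ₁ k)) :
    ∃ o', Steps M t (TM2.stepAux (p.entry ι e) (v, o) (join A s))
      (TM2.stepAux e (v, o') (join A s')) := by
  induction h generalizing o e with
  | push k b s =>
    exact ⟨o, congrArg some (congrArg (TM2.stepAux e (v, o)) (update_join_inr A s k (b :: s k)))⟩
  | pop k s =>
    exact ⟨o, congrArg some (congrArg (TM2.stepAux e (v, o)) (update_join_inr A s k (s k).tail))⟩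
  | seq _ _ ih1 ih2 =>
    obtain ⟨o1, h1⟩ := ih1 (fun l => ι (.inl l)) _ (fun l => hM (.inl l)) o
    obtain ⟨o2, h2⟩ := ih2 (fun l => ι (.inr l)) e (fun l => hM (.inr l)) o1
    exact ⟨o2, h1.trans h2⟩
  | @ite_true k c p q s s' t hc _ ih =>
    obtain ⟨o1, h1⟩ := ih (fun l => ι (.inl l)) e (fun l => hM (.inl l)) (s k).head?
    refine ⟨o1, ?_⟩
    have h2 : TM2.stepAux (Prog.entry (.ite k c p q) ι e) (v, o) (join A s) =
        cond (c (s k).head?)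
          (TM2.stepAux (p.entry (fun l => ι (.inl l)) e) (v, (s k).head?) (join A s))
          (TM2.stepAux (q.entry (fun l => ι (.inr l)) e) (v, (s k).head?) (join A s)) := rfl
    rw [h2, hc, cond_true]
    exact h1
  | @ite_false k c p q s s' t hc _ ih =>
    obtain ⟨o1, h1⟩ := ih (fun l => ι (.inr l)) e (fun l => hM (.inr l)) (s k).head?
    refine ⟨o1, ?_⟩
    have h2 : TM2.stepAux (Prog.entry (.ite k c p q) ι e) (v, o) (join A s) =
        cond (c (s k).head?)
          (TM2.stepAux (p.entry (fun l => ι (.inl l)) e) (v, (s k).head?) (join A s))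
          (TM2.stepAux (q.entry (fun l => ι (.inr l)) e) (v, (s k).head?) (join A s)) := rfl
    rw [h2, hc, cond_false]
    exact h1
  | @whl_done k c p s hc =>
    have h1 := stepAux_code_none k c p ι e v o A s
    rw [hc, cond_false, ← hM none] at h1
    exact ⟨(s k).head?, h1 ▸ Steps.single M (ι none) (v, o) (join A s)⟩
  | @whl_step k c p s s' s'' t t' hc _ _ ih1 ih2 =>
    have h1 := stepAux_code_none k c p ι e v o A s
    rw [hc, cond_true, ← hM none] at h1
    obtain ⟨o1, h2⟩ := ih1 (fun l => ι (some l)) _ (fun l => hM (some l)) (s k).head?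
    obtain ⟨o2, h3⟩ := ih2 ι e hM o1
    refine ⟨o2, ?_⟩
    have h4 := ((h1 ▸ Steps.single M (ι none) (v, o) (join A s)).trans h2).trans h3
    rwa [show 1 + t + t' = t + t' + 1 by ring] at h4

/-! ### Composition of a machine with a while program -/

/-- The number of push instructions of a statement. -/
def stmtPushes {K : Type} {Γ : K → Type} {Λ σ : Type} : TM2.Stmt Γ Λ σ → ℕ
  | .push _ _ q => stmtPushes q + 1
  | .peek _ _ q => stmtPushes q
  | .pop _ _ q => stmtPushes q
  | .load _ q => stmtPushes q
  | .branch _ q r => stmtPushes q + stmtPushes r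
  | .goto _ => 0
  | .halt => 0

theorem length_stepAux_le {K : Type} [DecidableEq K] {Γ : K → Type} {Λ σ : Type}
    (q : TM2.Stmt Γ Λ σ) (v : σ) (A : ∀ k, List (Γ k)) (k : K) :
    ((TM2.stepAux q v A).stk k).length ≤ (A k).length + stmtPushes q := by
  induction q generalizing v A with
  | push k' f q ih =>
    refine (ih _ _).trans ?_
    by_cases e : k = k'
    · subst e; simp [stmtPushes]; omega
    · simp [e, stmtPushes]
  | peek k' f q ih => exact ih _ _
  | pop k' f q ih =>
    refine (ih _ _).trans ?_
    by_cases e : k = k'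
    · subst e; simp [stmtPushes]
    · simp [e, stmtPushes]
  | load f q ih => exact ih _ _
  | branch f q r ih1 ih2 =>
    simp only [TM2.stepAux, stmtPushes]
    cases f v
    · have := ih2 v A
      simp only [cond_false]; omega
    · have := ih1 v A
      simp only [cond_true]; omega
  | goto f => simp [TM2.stepAux, stmtPushes]
  | halt => simp [TM2.stepAux, stmtPushes]

/-- Bounds the output length of the first machine, hence the input length of the program that
follows it. -/
theorem Steps.length_le {K : Type} [DecidableEq K] {Γ : K → Type} {Λ σ : Type} [Fintype Λ]
    {M : Λ → TM2.Stmt Γ Λ σ} {t : ℕ} {a b : TM2.Cfg Γ Λ σ} (h : Steps M t a b) (k : K) :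
    (b.stk k).length ≤ (a.stk k).length + t * ∑ l, stmtPushes (M l) := by
  induction t generalizing a with
  | zero =>
    have : some a = some b := h
    cases this; simp
  | succ t ih =>
    obtain ⟨l, -, h2⟩ := steps_succ h
    have h3 := ih h2
    have h4 := length_stepAux_le (M l) a.var a.stk k
    have h5 : stmtPushes (M l) ≤ ∑ l, stmtPushes (M l) :=
      Finset.single_le_sum (f := fun l => stmtPushes (M l)) (fun _ _ => Nat.zero_le _)
        (Finset.mem_univ l)
    nlinarith

section Compose

variable (M₁ : FinTM2) (p : Prog S) (kin kout : S) (β : M₁.Γ M₁.k₁ ≃ Bool)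

/-- The labels of the composed machine. -/
abbrev CLabel : Type := M₁.Λ ⊕ Option p.Label

/-- A statement of the first machine as a statement of the composed machine: instead of halting,
it goes on to the copying loop. -/
def liftStmt : TM2.Stmt M₁.Γ M₁.Λ M₁.σ →
    TM2.Stmt (Alph M₁.Γ S) (CLabel M₁ p) (M₁.σ × Option Bool)
  | .push k f q => .push (.inl k) (fun v => f v.1) (liftStmt q)
  | .peek k f q => .peek (.inl k) (fun v o => (f v.1 o, v.2)) (liftStmt q)
  | .pop k f q => .pop (.inl k) (fun v o => (f v.1 o, v.2)) (liftStmt q)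
  | .load f q => .load (fun v => (f v.1, v.2)) (liftStmt q)
  | .branch f q r => .branch (fun v => f v.1) (liftStmt q) (liftStmt r)
  | .goto f => .goto fun v => .inl (f v.1)
  | .halt => .goto fun _ => .inr none

/-- The end of the composed program. -/
def finish : TM2.Stmt (Alph M₁.Γ S) (CLabel M₁ p) (M₁.σ × Option Bool) :=
  .load (fun _ => (M₁.initialState, none)) .halt

/-- The copying loop, which moves the output of the first machine to the stack `kin`. -/
def copyLoop : TM2.Stmt (Alph M₁.Γ S) (CLabel M₁ p) (M₁.σ × Option Bool) :=
  .pop (.inl M₁.k₁) (fun v o => (v.1, o.map β)) <|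
    .branch (fun v => v.2.isSome)
      (.push (.inr kin) (fun v => v.2.getD false) (.goto fun _ => .inr none))
      (p.entry (fun l => .inr (some l)) (finish M₁ p))

/-- The program of the composed machine. -/
def composedProgram : CLabel M₁ p →
    TM2.Stmt (Alph M₁.Γ S) (CLabel M₁ p) (M₁.σ × Option Bool)
  | .inl l => liftStmt M₁ p (M₁.m l)
  | .inr none => copyLoop M₁ p kin β
  | .inr (some l) => p.code (fun l => .inr (some l)) (finish M₁ p) l

/-- The configuration of the composed machine that corresponds to one of the first machine. -/
def liftCfg (c : TM2.Cfg M₁.Γ M₁.Λ M₁.σ) :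
    TM2.Cfg (Alph M₁.Γ S) (CLabel M₁ p) (M₁.σ × Option Bool) :=
  ⟨some (c.l.elim (.inr none) .inl), (c.var, none), join c.stk fun _ => []⟩

theorem stepAux_liftStmt (q : TM2.Stmt M₁.Γ M₁.Λ M₁.σ) (v : M₁.σ) (A : ∀ k, List (M₁.Γ k)) :
    TM2.stepAux (liftStmt M₁ p q) (v, none) (join A fun _ => []) =
      liftCfg M₁ p (TM2.stepAux q v A) := by
  induction q generalizing v A with
  | push k f q ih =>
    exact (congrArg (TM2.stepAux (liftStmt M₁ p q) (v, none))
      (update_join_inl A _ k (f v :: A k))).trans (ih _ _)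
  | peek k f q ih => exact ih _ _
  | pop k f q ih =>
    exact (congrArg (TM2.stepAux (liftStmt M₁ p q) (f v (A k).head?, none))
      (update_join_inl A _ k (A k).tail)).trans (ih _ _)
  | load f q ih => exact ih _ _
  | branch f q r ih1 ih2 =>
    simp only [liftStmt, TM2.stepAux]
    cases f v
    · exact ih2 _ _
    · exact ih1 _ _
  | goto f => rfl
  | halt => rfl

theorem steps_liftCfg {t : ℕ} {a b : TM2.Cfg M₁.Γ M₁.Λ M₁.σ} (h : Steps M₁.m t a b) :
    Steps (composedProgram M₁ p kin β) t (liftCfg M₁ p a) (liftCfg M₁ p b) := by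
  induction t generalizing a with
  | zero =>
    have : some a = some b := h
    cases this; exact Steps.refl _ _
  | succ t ih =>
    obtain ⟨l, hl, h2⟩ := steps_succ h
    have h3 := ih h2
    rw [← stepAux_liftStmt] at h3
    have h4 : liftCfg M₁ p a = ⟨some (.inl l), (a.var, none), join a.stk fun _ => []⟩ := by
      simp [liftCfg, hl]
    rw [h4, Nat.add_comm]
    exact (Steps.single _ _ _ _).trans h3

theorem stepAux_copyLoop (A : ∀ k, List (M₁.Γ k)) (v : M₁.σ) (o : Option Bool)
    (s : S → List Bool) :
    TM2.stepAux (copyLoop M₁ p kin β) (v, o) (join A s) =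
      cond ((A M₁.k₁).head?.map β).isSome
        ⟨some (.inr none), (v, (A M₁.k₁).head?.map β),
          join (update A M₁.k₁ (A M₁.k₁).tail)
            (update s kin (((A M₁.k₁).head?.map β).getD false :: s kin))⟩
        (TM2.stepAux (p.entry (fun l => .inr (some l)) (finish M₁ p))
          (v, (A M₁.k₁).head?.map β) (join (update A M₁.k₁ (A M₁.k₁).tail) s)) := by
  rw [← update_join_inr, ← update_join_inl]
  rfl

/-- Moving a word from one stack to another reverses it. There is one step per symbol and one for
the test that finds the stack empty; after it all stacks of the first machine are empty, as a
halting configuration of the composed machine requires. -/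
theorem steps_copyLoop (A : ∀ k, List (M₁.Γ k)) (hA : ∀ k, k ≠ M₁.k₁ → A k = []) (v : M₁.σ)
    (o : Option Bool) (y : List Bool) (hy : (A M₁.k₁).map β = y) (s : S → List Bool) :
    Steps (composedProgram M₁ p kin β) (y.length + 1)
      ⟨some (.inr none), (v, o), join A s⟩
      (TM2.stepAux (p.entry (fun l => .inr (some l)) (finish M₁ p)) (v, none)
        (join (fun _ => []) (update s kin (y.reverse ++ s kin)))) := by
  have hstep := stepAux_copyLoop M₁ p kin β A v o s
  induction y generalizing A o s with
  | nil =>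
    have h0 : A M₁.k₁ = [] := by simpa using hy
    have h2 : A = fun _ => [] := by
      funext k
      by_cases h : k = M₁.k₁
      · subst h; exact h0
      · exact hA k h
    subst h2
    have h4 : update (fun k : M₁.K => ([] : List (M₁.Γ k))) M₁.k₁ [] = fun _ => [] := by
      funext k; by_cases h : k = M₁.k₁
      · subst h; simp
      · simp [h]
    simp only [List.head?_nil, Option.map_none, Option.isSome_none, cond_false, List.tail_nil,
      h4] at hstep
    have h1 := Steps.single (composedProgram M₁ p kin β) (.inr none) (v, o)
      (join (fun _ => []) s)
    have h6 : composedProgram M₁ p kin β (.inr none) = copyLoop M₁ p kin β := rfl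
    rw [h6, hstep] at h1
    simpa using h1
  | cons b y ih =>
    obtain ⟨c, l, hcl, hc, hl⟩ := List.map_eq_cons_iff.1 hy
    simp only [hcl, List.head?_cons, Option.map_some, Option.isSome_some, cond_true,
      List.tail_cons, Option.getD_some] at hstep
    have h1 := Steps.single (composedProgram M₁ p kin β) (.inr none) (v, o) (join A s)
    have h6 : composedProgram M₁ p kin β (.inr none) = copyLoop M₁ p kin β := rfl
    rw [h6, hstep] at h1
    have h5 := ih (update A M₁.k₁ l) (fun k hk => by simp [hk, hA]) (some (β c))
      (by simpa using hl) (update s kin (β c :: s kin)) (stepAux_copyLoop _ _ _ _ _ _ _ _)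
    have h7 := h1.trans h5
    rw [List.length_cons, Nat.add_comm (y.length + 1) 1]
    convert h7 using 2
    simp [hc]

/-- The machine that runs `M₁` and then the while program `p` on the output of `M₁`, reversed. -/
def composed [Fintype S] : FinTM2 where
  K := M₁.K ⊕ S
  kDecidableEq := inferInstance
  kFin := by letI := M₁.kFin; infer_instance
  k₀ := .inl M₁.k₀
  k₁ := .inr kout
  Γ := Alph M₁.Γ S
  Λ := CLabel M₁ p
  main := .inl M₁.main
  ΛFin := by letI := M₁.ΛFin; infer_instance
  σ := M₁.σ × Option Bool
  initialState := (M₁.initialState, none)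
  σFin := by letI := M₁.σFin; infer_instance
  Γk₀Fin := M₁.Γk₀Fin
  m := composedProgram M₁ p kin β

end Compose

end StackProg

/-! ### Polynomial time of a machine followed by a while program -/

namespace QEA

open Turing Function StackProg

/-- Polynomially bounded functions. -/
def PolyBdd (f : ℕ → ℕ) : Prop := ∃ P : Polynomial ℕ, ∀ L, f L ≤ P.eval L

/-- A polynomial-time function followed by a while program that runs in polynomial time. -/
theorem PolyTime.of_prog {S : Type} [DecidableEq S] [Fintype S] {g f : List Bool → List Bool}
    (hg : PolyTime g) (p : Prog S) (kin kout : S) (B : ℕ → ℕ) (hB : PolyBdd B) (hB' : Monotone B)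
    (h : ∀ x, ∃ t ≤ B (g x).length, Exec p (update (fun _ => []) kin (g x).reverse)
      (update (fun _ => []) kout (f x)) t) : PolyTime f := by
  obtain ⟨⟨⟨M₁, α, β⟩, T, hT⟩⟩ := hg
  obtain ⟨P, hP⟩ := hB
  let := M₁.ΛFin
  let := M₁.kDecidableEq
  set c := ∑ l, stmtPushes (M₁.m l) with hc
  -- `ℓ` bounds the length of `g x`: the input length plus at most `c` pushes per step.
  set ℓ : Polynomial ℕ := Polynomial.X + T * Polynomial.C c with hℓ
  have main : ∀ x, ∃ t ≤ (T + (ℓ + 1) + P.comp ℓ).eval x.length,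
      (flip bind (composed M₁ p kin kout β).step)^[t]
        (some (initList (composed M₁ p kin kout β) (List.map α.invFun x))) =
      some (haltList (composed M₁ p kin kout β) (List.map (Equiv.refl Bool).invFun (f x))) := ?_
  · exact ⟨{ tm := composed M₁ p kin kout β, inputAlphabet := α, outputAlphabet := Equiv.refl _,
             time := T + (ℓ + 1) + P.comp ℓ,
             outputsFun := fun x => ⟨⟨(main x).choose, (main x).choose_spec.2⟩,
               (main x).choose_spec.1⟩ }⟩
  intro x
  obtain ⟨⟨t₁, h₁⟩, ht₁⟩ := hT x
  obtain ⟨t₂, ht₂, h₂⟩ := h x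
  simp only [id] at ht₁ h₁ ⊢
  set fin₁ := haltList M₁ (List.map β.invFun (g x)) with hfin
  have h₁' : Steps M₁.m t₁ (initList M₁ (List.map α.invFun x)) fin₁ := h₁
  have hk₁ : fin₁.stk M₁.k₁ = List.map β.invFun (g x) := by
    simp [hfin, haltList]
  have hk₁' : ∀ k, k ≠ M₁.k₁ → fin₁.stk k = [] := by
    intro k hk; simp [hfin, haltList, hk]
  have hlen : (g x).length ≤ ℓ.eval x.length := by
    have h3 := h₁'.length_le M₁.k₁
    rw [hk₁, List.length_map, ← hc] at h3
    have h4 : ((initList M₁ (List.map α.invFun x)).stk M₁.k₁).length ≤ x.length := by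
      by_cases h : M₁.k₁ = M₁.k₀
      · have : ((initList M₁ (List.map α.invFun x)).stk M₁.k₁).length =
          ((initList M₁ (List.map α.invFun x)).stk M₁.k₀).length := by rw [h]
        rw [this]; simp [initList]
      · simp [initList, h]
    rw [hℓ]
    simp only [Polynomial.eval_add, Polynomial.eval_X, Polynomial.eval_mul, Polynomial.eval_C]
    have : t₁ * c ≤ Polynomial.eval x.length T * c := Nat.mul_le_mul_right _ ht₁
    omega
  have e1 := steps_liftCfg M₁ p kin β h₁'
  have e2 := steps_copyLoop M₁ p kin β fin₁.stk hk₁' M₁.initialState none (g x)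
    (by rw [hk₁]; simp [Function.comp_def]) (fun _ => [])
  obtain ⟨o', e3⟩ := h₂.steps (composedProgram M₁ p kin β) (fun l => .inr (some l)) (finish M₁ p)
    (fun l => rfl) M₁.initialState none (fun _ => [])
  have e4 : liftCfg M₁ p fin₁ =
    ⟨some (.inr none), (M₁.initialState, none), join fin₁.stk fun _ => []⟩ := rfl
  rw [e4] at e1
  simp only [List.append_nil] at e2
  have e5 := (e1.trans e2).trans e3
  refine ⟨t₁ + ((g x).length + 1) + t₂, ?_, ?_⟩
  rotate_left
  · have i1 : initList (composed M₁ p kin kout β) (List.map α.invFun x) =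
        liftCfg M₁ p (initList M₁ (List.map α.invFun x)) := by
      have hs : (initList (composed M₁ p kin kout β) (List.map α.invFun x)).stk =
          (liftCfg M₁ p (initList M₁ (List.map α.invFun x))).stk := by
        funext k
        rcases k with k | k
        · by_cases hk : k = M₁.k₀
          · subst hk
            simp [initList, liftCfg, join, composed]
            rfl
          · simp [initList, liftCfg, join, composed, hk]
        · simp [initList, liftCfg, join, composed]
      have : ∀ a b : (composed M₁ p kin kout β).Cfg, a.l = b.l → a.var = b.var → a.stk = b.stk →
          a = b := by
        rintro ⟨_, _, _⟩ ⟨_, _, _⟩ rfl rfl rfl; rfl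
      exact this _ _ rfl rfl hs
    -- A halting configuration must carry the initial internal state. `finish` restores it, whatever
    -- value `o'` the last test left behind.
    have i2 : haltList (composed M₁ p kin kout β)
        (List.map (Equiv.refl Bool).invFun (f x)) =
        TM2.stepAux (finish M₁ p) (M₁.initialState, o')
          (join (fun _ => []) (update (fun _ => []) kout (f x))) := by
      have : ∀ a b : (composed M₁ p kin kout β).Cfg, a.l = b.l → a.var = b.var → a.stk = b.stk →
          a = b := by
        rintro ⟨_, _, _⟩ ⟨_, _, _⟩ rfl rfl rfl; rfl
      refine this _ _ rfl rfl ?_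
      funext k
      rcases k with k | k
      · simp [haltList, finish, TM2.stepAux, join, composed]
      · by_cases hk : k = kout
        · subst hk
          simp [haltList, finish, TM2.stepAux, join, composed]
          rfl
        · simp [haltList, finish, TM2.stepAux, join, composed, hk]
    have i3 := congrArg some i2
    refine Eq.trans ?_ i3.symm
    rw [i1]
    exact e5
  · have h6 : P.eval (ℓ.eval x.length) ≥ t₂ := by
      refine le_trans ?_ (hP _)
      exact ht₂.trans (hB' hlen)
    simp only [Polynomial.eval_add, Polynomial.eval_comp, Polynomial.eval_one]
    omega

end QEA

/-! ### Timed rules for while programs and unary arithmetic -/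

namespace StackProg

open Function

variable {S : Type} [DecidableEq S]

/-- The program `p` leads from `s` to `s'` in time at most `T`. -/
def Runs (p : Prog S) (s s' : S → List Bool) (T : ℕ) : Prop := ∃ t ≤ T, Exec p s s' t

theorem Runs.mono {p : Prog S} {s s' : S → List Bool} {T T' : ℕ} (h : Runs p s s' T)
    (hT : T ≤ T') : Runs p s s' T' := by
  obtain ⟨t, ht, h⟩ := h
  exact ⟨t, ht.trans hT, h⟩

theorem Runs.congr {p : Prog S} {s₀ s s' s₁ : S → List Bool} {T : ℕ} (h : Runs p s₀ s₁ T)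
    (h₀ : s₀ = s) (h₁ : s₁ = s') : Runs p s s' T := h₀ ▸ h₁ ▸ h

theorem update_of_eq {s : S → List Bool} {a : S} {l : List Bool} (h : s a = l) :
    update s a l = s := h ▸ update_eq_self a s

theorem Runs.seq {p q : Prog S} {s s' s'' : S → List Bool} {T T' : ℕ} (h : Runs p s s' T)
    (h' : Runs q s' s'' T') : Runs (p ;; q) s s'' (T + T') := by
  obtain ⟨t, ht, h⟩ := h
  obtain ⟨t', ht', h'⟩ := h'
  exact ⟨t + t', by omega, .seq h h'⟩

theorem Runs.push {s s' : S → List Bool} {k : S} {b : Bool} (h : s' = update s k (b :: s k)) :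
    Runs (.push k b) s s' 0 := ⟨0, le_rfl, h ▸ .push k b s⟩

theorem Runs.pop {s s' : S → List Bool} {k : S} (h : s' = update s k (s k).tail) :
    Runs (.pop k) s s' 0 := ⟨0, le_rfl, h ▸ .pop k s⟩

theorem Runs.push_seq {s s' : S → List Bool} {k : S} {b : Bool} {q : Prog S} {T : ℕ}
    (h : Runs q (update s k (b :: s k)) s' T) : Runs (.push k b ;; q) s s' T := by
  simpa using Runs.seq (Runs.push rfl) h

theorem Runs.pop_seq {s s' : S → List Bool} {k : S} {q : Prog S} {T : ℕ}
    (h : Runs q (update s k (s k).tail) s' T) : Runs (.pop k ;; q) s s' T := by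
  simpa using Runs.seq (Runs.pop rfl) h

theorem Runs.whl_done {s : S → List Bool} {k : S} {c : Option Bool → Bool} {p : Prog S}
    (h : c (s k).head? = false) : Runs (.whl k c p) s s 1 := ⟨1, le_rfl, .whl_done h⟩

theorem Runs.whl_step {s s' s'' : S → List Bool} {k : S} {c : Option Bool → Bool} {p : Prog S}
    {T T' : ℕ} (h : c (s k).head? = true) (h1 : Runs p s s' T)
    (h2 : Runs (.whl k c p) s' s'' T') : Runs (.whl k c p) s s'' (T + T' + 1) := by
  obtain ⟨t, ht, h1⟩ := h1
  obtain ⟨t', ht', h2⟩ := h2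
  exact ⟨t + t' + 1, by omega, .whl_step h h1 h2⟩

/-- The top of the stack is `true`. -/
def isT (o : Option Bool) : Bool := o == some true

/-- The unary representation of a number on a stack. -/
abbrev ones (n : ℕ) : List Bool := List.replicate n true

theorem ones_append_cons (n : ℕ) (l : List Bool) : ones n ++ true :: l = true :: (ones n ++ l) := by
  induction n with
  | zero => rfl
  | succ n ih => simp only [List.replicate_succ, List.cons_append, ih]

/-- `f i` is the invariant before pass `i`. The counter is popped before the body, so the body
starts with one mark less; each pass costs its body and one test, and one failing test ends the
loop. -/
theorem Runs.forLoop {a : S} {body : Prog S} {T : ℕ} (f : ℕ → S → List Bool) (n : ℕ)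
    (hf : ∀ i ≤ n, f i a = ones (n - i))
    (h : ∀ i < n, Runs body (update (f i) a (ones (n - i - 1))) (f (i + 1)) T) :
    Runs (.whl a isT (.pop a ;; body)) (f 0) (f n) (n * (T + 1) + 1) := by
  induction n generalizing f with
  | zero => exact (Runs.whl_done (by simp [hf, isT])).mono (by simp)
  | succ n ih =>
    have h1 := h 0 (by omega)
    have h2 := ih (fun i => f (i + 1)) (fun i hi => by rw [hf _ (by omega)]; congr 1; omega)
      (fun i hi => by
        have := h (i + 1) (by omega)
        rwa [show n + 1 - (i + 1) - 1 = n - i - 1 by omega] at this)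
    have h0 := hf 0 (by omega)
    simp only [Nat.sub_zero] at h0 h1
    refine (Runs.whl_step (by simp [h0, isT, List.replicate_succ]) (Runs.pop_seq (T := T) ?_)
      h2).mono (by ring_nf; omega)
    rw [h0]
    simpa [List.replicate_succ] using h1

/-- Moves a unary number from `a` to `c`. -/
def moveOnes (a c : S) : Prog S := .whl a isT (.pop a ;; .push c true)

theorem runs_moveOnes {a c : S} (hac : a ≠ c) {n : ℕ} {l : List Bool} {s s' : S → List Bool}
    (ha : s a = ones n ++ l) (hl : isT l.head? = false)
    (hs : s' = update (update s a l) c (ones n ++ s c)) :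
    Runs (moveOnes a c) s s' (n + 1) := by
  subst hs
  induction n generalizing s with
  | zero =>
    have : update (update s a l) c (ones 0 ++ s c) = s := by
      rw [update_of_eq (a := a) (by simpa using ha)]; simp
    rw [this]
    exact (Runs.whl_done (by simpa [ha] using hl)).mono (by simp)
  | succ n ih =>
    have h1 := ih (s := update (update s a (ones n ++ l)) c (true :: s c))
      (by simp [hac])
    refine ((Runs.whl_step (T := 0) (by simp [ha, isT, List.replicate_succ])
      (Runs.pop_seq (Runs.push ?_)) h1).mono (T' := n + 1 + 1) (by omega)).congr rfl ?_
    · simp [ha, List.replicate_succ, hac.symm]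
    · funext r
      by_cases h1 : r = c
      · subst h1; simp [ones_append_cons, List.replicate_succ]
      · by_cases h2 : r = a
        · subst h2; simp [hac]
        · simp [h1, h2]

/-- Adds the unary number on `a` to `c`, by means of `x`. -/
def copyTo (a c x : S) : Prog S :=
  .whl a isT (.pop a ;; .push x true ;; .push c true) ;; moveOnes x a

theorem runs_copyTo {a c x : S} (hac : a ≠ c) (hax : a ≠ x) (hcx : c ≠ x) {n : ℕ}
    {s s' : S → List Bool} (ha : s a = ones n) (hx : s x = [])
    (hs : s' = update s c (ones n ++ s c)) :
    Runs (copyTo a c x) s s' (2 * n + 2) := by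
  subst hs
  refine (Runs.seq (T := n + 1) (T' := n + 1)
    (s' := update (update (update s a []) x (ones n)) c (ones n ++ s c)) ?_
    (runs_moveOnes hax.symm (n := n) (l := []) ?_ rfl ?_)).mono (by omega)
  · have key : Runs (.whl a isT (.pop a ;; .push x true ;; .push c true)) s
      (update (update (update s a []) x (ones n ++ s x)) c (ones n ++ s c)) (n + 1) := by
      clear hx
      induction n generalizing s with
      | zero =>
        have : update (update (update s a []) x (ones 0 ++ s x)) c (ones 0 ++ s c) = s := by
          rw [update_of_eq (a := a) (by simpa using ha)]
          simp
        rw [this]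
        exact (Runs.whl_done (by simp [ha, isT])).mono (by simp)
      | succ n ih =>
        refine (Runs.whl_step (T := 0) (by simp [ha, isT, List.replicate_succ])
          (Runs.pop_seq (Runs.push_seq (Runs.push rfl))) ?_).mono (T := 0 + (n + 1) + 1) (by omega)
        convert ih (s := _) ?_ using 1
        · funext r
          by_cases h1 : r = c
          · subst h1; simp [hac.symm, hcx, ones_append_cons, List.replicate_succ]
          · by_cases h2 : r = a
            · subst h2; simp [hac, hax]
            · by_cases h3 : r = x
              · subst h3
                simp [hcx.symm, hax.symm, ones_append_cons, List.replicate_succ]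
              · simp [h1, h2, h3]
        · simp [hac, hax, ha, List.replicate_succ]
    simpa [hx] using key
  · simp [hcx.symm]
  · funext r
    by_cases h1 : r = c
    · subst h1; simp [hac.symm, hcx]
    · by_cases h2 : r = a
      · subst h2; simp [hac, hax, ha]
      · by_cases h3 : r = x
        · subst h3
          simp [hcx.symm, hax.symm, hx]
        · simp [h1, h2, h3]

/-- Adds the product of the numbers on `a` and `b` to `c` and clears `a`, by means of `x`. -/
def mulTo (a b c x : S) : Prog S := .whl a isT (.pop a ;; copyTo b c x)

theorem runs_mulTo {a b c x : S} (hab : a ≠ b) (hac : a ≠ c) (hax : a ≠ x) (hbc : b ≠ c)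
    (hbx : b ≠ x) (hcx : c ≠ x) {n k : ℕ} {s s' : S → List Bool} (ha : s a = ones n)
    (hb : s b = ones k) (hx : s x = [])
    (hs : s' = update (update s a []) c (ones (n * k) ++ s c)) :
    Runs (mulTo a b c x) s s' (n * (2 * k + 2 + 1) + 1) := by
  subst hs
  have h := Runs.forLoop (a := a) (body := copyTo b c x) (T := 2 * k + 2)
    (fun i => update (update s a (ones (n - i))) c (ones (i * k) ++ s c)) n
    (fun i _ => by simp [hac]) (fun i _ => by
      refine runs_copyTo hbc hbx hcx (n := k) (by simp [hbc, hab.symm, hb])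
        (by simp [hcx.symm, hax.symm, hx]) ?_
      funext r
      by_cases h1 : r = c
      · subst h1
        rw [update_self, update_of_ne hac.symm, update_self, update_self, ← List.append_assoc,
          ← List.replicate_add, Nat.succ_mul, Nat.add_comm]
      · by_cases h2 : r = a
        · subst h2; simp [hac, Nat.sub_sub]
        · simp [h1, h2])
  refine h.congr ?_ (by simp)
  simp only [Nat.sub_zero, Nat.zero_mul, List.replicate_zero, List.nil_append]
  rw [update_of_eq ha, update_eq_self]

/-- Clears the stack `a`. -/
def clear (a : S) : Prog S := .whl a Option.isSome (.pop a)

theorem runs_clear {a : S} {s s' : S → List Bool} (hs : s' = update s a []) :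
    Runs (clear a) s s' ((s a).length + 1) := by
  subst hs
  generalize hl : s a = l
  induction l generalizing s with
  | nil =>
    rw [update_of_eq hl]
    exact (Runs.whl_done (by simp [hl])).mono (by simp)
  | cons b l ih =>
    have h1 := ih (s := update s a l) (by simp)
    rw [update_idem] at h1
    exact (Runs.whl_step (T := 0) (by simp [hl]) (Runs.pop (by simp [hl])) h1).mono
      (by simp)

/-- Moves the contents of `a` to `c`, in reverse order. -/
def revMove (a c : S) : Prog S :=
  .whl a Option.isSome (.ite a isT (.pop a ;; .push c true) (.pop a ;; .push c false))

theorem runs_revMove {a c : S} (hac : a ≠ c) {s s' : S → List Bool}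
    (hs : s' = update (update s a []) c ((s a).reverse ++ s c)) :
    Runs (revMove a c) s s' ((s a).length + 1) := by
  subst hs
  generalize hl : s a = l
  induction l generalizing s with
  | nil =>
    simp only [update_of_eq hl, List.reverse_nil, List.nil_append, update_eq_self]
    exact (Runs.whl_done (by simp [hl])).mono (by simp)
  | cons b l ih =>
    have h1 := ih (s := update (update s a l) c (b :: s c)) (by simp [hac])
    have h2 : Runs (.ite a isT (.pop a ;; .push c true) (.pop a ;; .push c false)) s
        (update (update s a l) c (b :: s c)) 0 := by
      cases b
      · obtain ⟨t, ht, h⟩ := Runs.pop_seq (s := s) (k := a) (Runs.push (k := c) (b := false) rfl)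
        refine ⟨t, ht, .ite_false (by simp [hl, isT]) ?_⟩
        simpa [hl, hac.symm] using h
      · obtain ⟨t, ht, h⟩ := Runs.pop_seq (s := s) (k := a) (Runs.push (k := c) (b := true) rfl)
        refine ⟨t, ht, .ite_true (by simp [hl, isT]) ?_⟩
        simpa [hl, hac.symm] using h
    have h3 := (Runs.whl_step (by simp [hl]) h2 h1).mono (T' := (b :: l).length + 1) (by simp)
    refine h3.congr rfl ?_
    funext r
    by_cases h1 : r = c
    · subst h1; simp
    · by_cases h2 : r = a
      · subst h2; simp [hac]
      · simp [h1, h2]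

end StackProg

/-! ### The generator of circuits: its store and its arithmetic -/

namespace StackProg

open Function QEA

/-- The stacks of the program that generates circuits. -/
inductive Reg : Type
  | I | J | D | O | N | M | T | U | W | P | Q | X | Z | R
  deriving DecidableEq

instance : Fintype Reg where
  elems := {.I, .J, .D, .O, .N, .M, .T, .U, .W, .P, .Q, .X, .Z, .R}
  complete r := by cases r <;> decide

/-- The program `p` leads from `s` to `s'`; if it is started at time `c`, it ends by time `T`. -/
def RunsAfter {S : Type} [DecidableEq S] (c : ℕ) (p : Prog S) (s s' : S → List Bool) (T : ℕ) :
    Prop := ∃ t, c + t ≤ T ∧ Exec p s s' t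

theorem RunsAfter.runs {S : Type} [DecidableEq S] {p : Prog S} {s s' : S → List Bool} {T : ℕ}
    (h : RunsAfter 0 p s s' T) : Runs p s s' T := by
  obtain ⟨t, ht, h⟩ := h
  exact ⟨t, by omega, h⟩

/-- Accumulating the elapsed time in `c` leaves, for a straight-line program, one arithmetic
inequality at the very end. -/
theorem Runs.andThen {S : Type} [DecidableEq S] {p q : Prog S} {s s₁ s' : S → List Bool}
    {c T₁ T : ℕ} (h : Runs p s s₁ T₁) (h' : RunsAfter (c + T₁) q s₁ s' T) :
    RunsAfter c (p ;; q) s s' T := by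
  obtain ⟨t₁, ht₁, h⟩ := h
  obtain ⟨t, ht, h'⟩ := h'
  exact ⟨t₁ + t, by omega, h.seq h'⟩

theorem Runs.last {S : Type} [DecidableEq S] {p : Prog S} {s s₁ s' : S → List Bool}
    {c T₁ T : ℕ} (h : Runs p s s₁ T₁) (hs : s₁ = s') (hT : c + T₁ ≤ T) :
    RunsAfter c p s s' T := by
  obtain ⟨t₁, ht₁, h⟩ := h
  exact ⟨t₁, by omega, hs ▸ h⟩

/-- The contents of the stacks. -/
structure St where
  (i j d o n m t u w p q x z r : List Bool)

/-- The contents of the stacks, as a function. -/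
def St.fn (s : St) : Reg → List Bool
  | .I => s.i
  | .J => s.j
  | .D => s.d
  | .O => s.o
  | .N => s.n
  | .M => s.m
  | .T => s.t
  | .U => s.u
  | .W => s.w
  | .P => s.p
  | .Q => s.q
  | .X => s.x
  | .Z => s.z
  | .R => s.r

section
variable (s : St) (l : List Bool)
theorem St.update_i : update s.fn .I l = {s with i := l}.fn := by funext r; cases r <;> rfl
theorem St.update_j : update s.fn .J l = {s with j := l}.fn := by funext r; cases r <;> rfl
theorem St.update_d : update s.fn .D l = {s with d := l}.fn := by funext r; cases r <;> rfl
theorem St.update_o : update s.fn .O l = {s with o := l}.fn := by funext r; cases r <;> rfl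
theorem St.update_n : update s.fn .N l = {s with n := l}.fn := by funext r; cases r <;> rfl
theorem St.update_m : update s.fn .M l = {s with m := l}.fn := by funext r; cases r <;> rfl
theorem St.update_t : update s.fn .T l = {s with t := l}.fn := by funext r; cases r <;> rfl
theorem St.update_u : update s.fn .U l = {s with u := l}.fn := by funext r; cases r <;> rfl
theorem St.update_w : update s.fn .W l = {s with w := l}.fn := by funext r; cases r <;> rfl
theorem St.update_p : update s.fn .P l = {s with p := l}.fn := by funext r; cases r <;> rfl
theorem St.update_q : update s.fn .Q l = {s with q := l}.fn := by funext r; cases r <;> rfl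
theorem St.update_x : update s.fn .X l = {s with x := l}.fn := by funext r; cases r <;> rfl
theorem St.update_z : update s.fn .Z l = {s with z := l}.fn := by funext r; cases r <;> rfl
theorem St.update_r : update s.fn .R l = {s with r := l}.fn := by funext r; cases r <;> rfl
end

attribute [simp] St.fn St.update_i St.update_j St.update_d St.update_o St.update_n St.update_m
  St.update_t St.update_u St.update_w St.update_p St.update_q St.update_x St.update_z St.update_r

theorem ones_succ (n : ℕ) : ones (n + 1) = true :: ones n := List.replicate_succ

theorem reverse_encodeNat (n : ℕ) : (encodeNat n).reverse = false :: ones n := by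
  simp [encodeNat]

/-- Pushes the elements of a list and goes on with `q`. -/
def pushAll (k : Reg) (l : List Bool) (q : Prog Reg) : Prog Reg :=
  l.foldr (fun b q => .push k b ;; q) q

theorem runs_pushAll {k : Reg} {l : List Bool} {q : Prog Reg} {s s' : Reg → List Bool} {T : ℕ}
    (h : Runs q (update s k (l.reverse ++ s k)) s' T) : Runs (pushAll k l q) s s' T := by
  induction l generalizing s with
  | nil => simpa [pushAll] using h
  | cons b l ih =>
    refine Runs.push_seq (ih ?_)
    simpa using h

/-- Emits the code of the number on `a`. -/
def emitNum (a : Reg) : Prog Reg := copyTo a .Z .X ;; .push .Z false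

theorem runs_emitNum {a : Reg} (haz : a ≠ .Z) (hax : a ≠ .X) {n : ℕ} {s s' : St}
    (ha : s.fn a = ones n) (hx : s.x = [])
    (hs : s' = {s with z := (encodeNat n).reverse ++ s.z}) :
    Runs (emitNum a) s.fn s'.fn (2 * n + 2) := by
  subst hs
  refine Runs.seq (T' := 0) (runs_copyTo haz hax (by decide) ha hx rfl) (Runs.push ?_)
  simp [reverse_encodeNat]

/-! ### Reading the circuit -/

/-- Reads the number of qubits and the output qubit. -/
def readHeader : Prog Reg :=
  moveOnes .I .D ;; .pop .I ;; .pop .I ;; .pop .I ;; moveOnes .I .O ;; .pop .I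

theorem runs_readHeader {k o : ℕ} {g : List Bool} {s s' : St}
    (hi : s.i = encodeNat k ++ encodeNat 1 ++ encodeNat o ++ g) (hd : s.d = []) (ho : s.o = [])
    (hs : s' = {s with i := g, d := ones k, o := ones o}) :
    Runs readHeader s.fn s'.fn (k + 1 + (o + 1)) := by
  subst hs
  refine Runs.seq (runs_moveOnes (by decide) (n := k) (l := false :: (encodeNat 1 ++ encodeNat o
    ++ g)) (by simp [hi, encodeNat]) rfl rfl) ?_
  refine Runs.pop_seq (Runs.pop_seq (Runs.pop_seq ?_))
  refine Runs.seq (T' := 0) (runs_moveOnes (by decide) (n := o) (l := false :: g)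
    (by simp [encodeNat]) rfl rfl) (Runs.pop ?_)
  simp [hd, ho]

/-- Moves half of the number on `D`, rounded up, to `X`. -/
def halve : Prog Reg := .whl .D isT (.pop .D ;; .pop .D ;; .push .X true)

/-- For odd `k` the last second pop meets an empty stack and has no effect, hence the rounding up.
-/
theorem runs_halve {k c : ℕ} {s s' : St} (hd : s.d = ones k) (hx : s.x = ones c)
    (hs : s' = {s with d := [], x := ones ((k + 1) / 2 + c)}) :
    Runs halve s.fn s'.fn (k + 1) := by
  subst hs
  induction k using Nat.strong_induction_on generalizing c s with
  | _ k ih =>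
    rcases k with _ | k
    · refine ((Runs.whl_done (by simp [hd, isT])).mono (T' := 0 + 1) le_rfl).congr rfl ?_
      obtain ⟨⟩ := s
      simp_all
    · refine ((Runs.whl_step (T := 0) (by simp [hd, isT, ones_succ]) (Runs.pop_seq
        (Runs.pop_seq (Runs.push rfl))) ((ih (k - 1) (by omega) (c := c + 1)
          (s := {s with d := ones (k - 1), x := ones (c + 1)}) rfl rfl).congr ?_ rfl)).mono
          (by omega)).congr rfl ?_
      · simp only [St.fn, St.update_d, St.update_x, hd, hx, ones_succ, List.tail_cons]
        congr
        simp
      · congr 3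
        rcases k with _ | k
        · simp; omega
        · simp; omega

/-- Doubles the number on `N` as often as the number on `D` can be halved. -/
def doubling : Prog Reg := .whl .D isT (.pop .D ;; halve ;; moveOnes .X .D ;;
  .whl .N isT (.pop .N ;; .push .X true ;; .push .X true) ;; moveOnes .X .N)

theorem runs_doubleN {n : ℕ} {s s' : St} (hn : s.n = ones n) (hx : s.x = [])
    (hs : s' = {s with n := [], x := ones (2 * n)}) :
    Runs (.whl .N isT (.pop .N ;; .push .X true ;; .push .X true)) s.fn s'.fn (n + 1) := by
  subst hs
  have h := Runs.forLoop (a := Reg.N) (body := .push .X true ;; .push .X true) (T := 0)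
    (fun i => St.fn {s with n := ones (n - i), x := ones (2 * i)}) n (fun i _ => rfl)
    (fun i _ => Runs.push_seq (Runs.push (by
      simp [Nat.sub_sub, mul_add, List.replicate_succ])))
  refine (h.congr ?_ (by simp)).mono (by omega)
  obtain ⟨⟩ := s
  simp_all

/-- One mark is removed before halving upwards, and `⌈(k - 1) / 2⌉ = ⌊k / 2⌋`. So each pass deletes
one binary digit of `k`, and there are `k.size` passes. The resulting factor is a power of two above
`k` and at most `2 * k + 1`. -/
theorem runs_doubling {k n : ℕ} {s s' : St} (hd : s.d = ones k) (hn : s.n = ones n)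
    (hx : s.x = []) (hs : s' = {s with d := [], n := ones (n * 2 ^ k.size)}) :
    Runs doubling s.fn s'.fn (k.size * (2 * k + 3 * (n * 2 ^ k.size) + 5) + 1) := by
  subst hs
  -- The induction is on the number `j` of binary digits. The fixed bounds `b` and `c` on the two
  -- stacks make the cost of a pass independent of the pass.
  have key : ∀ (j k n : ℕ) (s : St), k < 2 ^ j → (k = 0 → j = 0) → (k ≠ 0 → 2 ^ (j - 1) ≤ k) →
      s.d = ones k → s.n = ones n → s.x = [] → ∀ b, k ≤ b → ∀ c, n * 2 ^ j ≤ c →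
      Runs doubling s.fn {s with d := [], n := ones (n * 2 ^ j)}.fn
        (j * (2 * b + 3 * c + 5) + 1) := by
    intro j
    induction j with
    | zero =>
      intro k n s hk _ _ hd hn hx b _ c _
      have : k = 0 := by simpa using hk
      subst this
      refine ((Runs.whl_done (by simp [hd, isT])).mono (by omega)).congr rfl ?_
      obtain ⟨⟩ := s
      simp_all
    | succ j ih =>
      intro k n s hk hk0 hk1 hd hn hx b hb c hc
      have hkpos : k ≠ 0 := fun h => by simpa using hk0 h
      have hk1' := hk1 hkpos
      obtain ⟨k', rfl⟩ := Nat.exists_eq_succ_of_ne_zero hkpos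
      simp only [Nat.add_sub_cancel, pow_succ] at hk1' hk hc
      have h2 := ih ((k' + 1) / 2) (2 * n) {s with d := ones ((k' + 1) / 2), n := ones (2 * n)}
        (by omega) (fun h => by
          by_contra hj
          obtain ⟨i, rfl⟩ := Nat.exists_eq_succ_of_ne_zero hj
          have : 2 ^ i > 0 := by positivity
          rw [Nat.succ_eq_add_one, pow_succ] at hk1'
          omega) (fun h => by
          rcases j with _ | j
          · simp only [zero_tsub, pow_zero]; omega
          · rw [pow_succ] at hk1'; simp only [Nat.add_sub_cancel]; omega)
        rfl rfl hx b (by omega) c (by rw [mul_assoc, mul_left_comm]; linarith)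
      have hn' : n ≤ c := le_trans (Nat.le_mul_of_pos_right _ (by positivity)) hc
      have hn'' : 2 * n ≤ c := le_trans (by
        have : 1 ≤ 2 ^ j := Nat.one_le_two_pow
        nlinarith) hc
      refine ((Runs.whl_step (T := k' + 1 + ((k' + 1) / 2 + 1 + (n + 1 + (2 * n + 1))))
        (by simp [hd, isT, ones_succ]) (Runs.pop_seq
        (Runs.seq ((runs_halve (s := {s with d := ones k'}) (k := k') (c := 0) rfl (by simpa)
          rfl).congr ?_ rfl)
        (Runs.seq (runs_moveOnes (n := (k' + 1) / 2) (l := []) (by decide) (by simp) rfl rfl)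
        (Runs.seq ((runs_doubleN (s := {s with d := ones ((k' + 1) / 2)}) hn hx rfl).congr ?_ rfl)
        (runs_moveOnes (n := 2 * n) (l := []) (by decide) (by simp) rfl rfl))))) (h2.congr ?_ ?_)).mono
        ?_)
      · simp [hd, ones_succ]
      · simp [hx]
      · simp [hx]
      · simp only [pow_succ]; congr 3; ring
      · have h5 : (j + 1) * (2 * b + 3 * c + 5) = j * (2 * b + 3 * c + 5) + (2 * b + 3 * c + 5) := by
          ring
        rw [h5]
        omega
  refine key k.size k n s (Nat.lt_size_self k) (fun h => by simp [h]) (fun h => ?_) hd hn hx k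
    le_rfl _ le_rfl
  have h1 : k.size ≠ 0 := fun h' => h (Nat.size_eq_zero.1 h')
  rw [← Nat.lt_size]; omega

/-! ### Computing sizes and emitting the header -/

/-- Computes the numbers of copies and of qubits from the number `n` on the stack `N`. -/
def computeSizes : Prog Reg :=
  copyTo .N .W .X ;; mulTo .W .N .M .X ;; copyTo .M .W .X ;; mulTo .W .M .T .X ;;
  clear .M ;; copyTo .N .U .X ;; mulTo .U .T .W .X ;; copyTo .W .Q .X ;;
  copyTo .T .W .X ;; copyTo .T .W .X

/-- `T` receives the number `n ^ 4` of copies, `Q` the first leaf wire `n ^ 5` (after all blocks),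
and `W` the first output wire `n ^ 5 + 2 * n ^ 4` (after leaves, inner nodes and coin). -/
theorem runs_computeSizes {n : ℕ} {s s' : St} (hn : s.n = ones n) (hx : s.x = [])
    (hw : s.w = []) (hm : s.m = []) (ht : s.t = []) (hu : s.u = []) (hq : s.q = [])
    (hs : s' = {s with t := ones (n ^ 4), w := ones (n * n ^ 4 + 2 * n ^ 4),
                       q := ones (n * n ^ 4)}) :
    Runs computeSizes s.fn s'.fn (30 * (n + 1) ^ 5 + 30) := by
  subst hs
  obtain ⟨⟩ := s
  simp only at hn hx hw hm ht hu hq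
  subst hn hx hw hm ht hu hq
  apply RunsAfter.runs
  refine Runs.andThen (runs_copyTo (n := n) (by decide) (by decide) (by decide) rfl rfl
      (St.update_w _ _).symm) ?_
  dsimp only
  refine Runs.andThen (runs_mulTo (n := n) (k := n) (by decide) (by decide) (by decide) (by decide)
      (by decide) (by decide) (by simp) rfl rfl (by rw [St.update_w, St.update_m])) ?_
  dsimp only
  refine Runs.andThen (runs_copyTo (n := n * n) (by decide) (by decide) (by decide) (by simp) rfl
      (St.update_w _ _).symm) ?_
  dsimp only
  refine Runs.andThen (runs_mulTo (n := n * n) (k := n * n) (by decide) (by decide) (by decide)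
      (by decide) (by decide) (by decide) (by simp) (by simp) rfl
      (by rw [St.update_w, St.update_t])) ?_
  dsimp only
  refine Runs.andThen (runs_clear (St.update_m _ _).symm) ?_
  dsimp only
  refine Runs.andThen (runs_copyTo (n := n) (by decide) (by decide) (by decide) rfl rfl
      (St.update_u _ _).symm) ?_
  dsimp only
  refine Runs.andThen (runs_mulTo (n := n) (k := n * n * (n * n)) (by decide) (by decide)
      (by decide) (by decide) (by decide) (by decide) (by simp) (by simp) rfl
      (by rw [St.update_u, St.update_w])) ?_
  dsimp only
  refine Runs.andThen (runs_copyTo (n := n * (n * n * (n * n))) (by decide) (by decide) (by decide)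
      (by simp) rfl (St.update_q _ _).symm) ?_
  dsimp only
  refine Runs.andThen (runs_copyTo (n := n * n * (n * n)) (by decide) (by decide) (by decide)
      (by simp) rfl (St.update_w _ _).symm) ?_
  dsimp only
  refine Runs.last (runs_copyTo (n := n * n * (n * n)) (by decide) (by decide) (by decide)
      (by simp) rfl (St.update_w _ _).symm) ?_ ?_
  · have h4 : n * n * (n * n) = n ^ 4 := by ring
    simp only [St.fn, List.append_nil, h4]
    congr 2
    rw [← List.append_assoc, ← List.replicate_add, ← List.replicate_add]
    congr 1
    ring
  · simp only [St.fn, List.length_append, List.length_replicate, List.length_nil]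
    ring_nf
    nlinarith [sq_nonneg n, pow_nonneg (Nat.zero_le n) 3, pow_nonneg (Nat.zero_le n) 4,
      pow_nonneg (Nat.zero_le n) 5]

/-- Emits the number of qubits, the number of output qubits, and the output qubits. -/
def emitHeader : Prog Reg :=
  copyTo .W .Z .X ;; emitNum .N ;; emitNum .N ;; copyTo .N .U .X ;;
  .whl .U isT (.pop .U ;; emitNum .W ;; .push .W true) ;; clear .W

theorem runs_emitHeader {n w : ℕ} {s s' : St} (hn : s.n = ones n) (hx : s.x = [])
    (hw : s.w = ones w) (hu : s.u = [])
    (hs : s' = {s with w := [], z := (encodeNat (w + n) ++ encodeNat n ++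
      (List.range n).flatMap fun i => encodeNat (w + i)).reverse ++ s.z}) :
    Runs emitHeader s.fn s'.fn (20 * (n + w + 1) ^ 2) := by
  subst hs
  obtain ⟨⟩ := s
  simp only at hn hx hw hu
  subst hn hx hw hu
  rename_i i j d o m t p q z r
  have h5 := Runs.forLoop (a := Reg.U) (body := emitNum .W ;; .push .W true) (T := 2 * (w + n) + 2)
    (fun l => St.fn ⟨i, j, d, o, ones n, m, t, ones (n - l), ones (w + l), p, q, [],
      ((List.range l).flatMap fun i => encodeNat (w + i)).reverse ++
        ((encodeNat n).reverse ++ ((encodeNat n).reverse ++ (ones w ++ z))), r⟩) n (fun l _ => rfl)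
    (fun l hl => (Runs.seq (T' := 0) (runs_emitNum (n := w + l) (by decide) (by decide)
        (s := ⟨i, j, d, o, ones n, m, t, ones (n - l - 1), ones (w + l), p, q, [],
      ((List.range l).flatMap fun i => encodeNat (w + i)).reverse ++
        ((encodeNat n).reverse ++ ((encodeNat n).reverse ++ (ones w ++ z))), r⟩) rfl rfl rfl)
        (Runs.push rfl)).congr (by rw [St.update_u]) (by
          simp [List.range_succ, ← add_assoc, List.replicate_succ, Nat.sub_sub]) |>.mono
            (by omega))
  apply RunsAfter.runs
  refine Runs.andThen (runs_copyTo (n := w) (by decide) (by decide) (by decide) rfl rfl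
      (St.update_z _ _).symm) ?_
  dsimp only
  refine Runs.andThen (runs_emitNum (n := n) (by decide) (by decide) rfl rfl rfl) ?_
  dsimp only
  refine Runs.andThen (runs_emitNum (n := n) (by decide) (by decide) rfl rfl rfl) ?_
  dsimp only
  refine Runs.andThen (runs_copyTo (n := n) (by decide) (by decide) (by decide) rfl rfl
      (St.update_u _ _).symm) ?_
  dsimp only
  refine Runs.andThen (h5.congr (by simp) rfl) ?_
  refine Runs.last (runs_clear (St.update_w _ _).symm) ?_ ?_
  -- The `w` marks placed before the code of `n` turn it into the code of `w + n`.
  · have : (encodeNat (w + n)).reverse = (encodeNat n).reverse ++ ones w := by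
      simp [reverse_encodeNat, Nat.add_comm w n]
    simp [this]
  · simp only [St.fn, List.length_replicate]
    ring_nf
    nlinarith [sq_nonneg n, sq_nonneg w, Nat.zero_le (n * w)]

end StackProg

namespace StackProg

open Function QEA

/-! ### Copies of the circuit -/

/-- The code of a gate given by its kind and its qubits. -/
def encodeRaw (r : ℕ × List ℕ) : List Bool := encodeNat r.1 ++ r.2.flatMap encodeNat

/-- The gate with its qubits shifted by `d`. -/
def shiftRaw (d : ℕ) (r : ℕ × List ℕ) : ℕ × List ℕ := (r.1, r.2.map (d + ·))

/-- Copies a number from `I` to `J` and `Z`. -/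
def copyNum : Prog Reg :=
  .whl .I isT (.pop .I ;; .push .J true ;; .push .Z true) ;;
    .pop .I ;; .push .J false ;; .push .Z false

theorem runs_copyNum {a : ℕ} {g : List Bool} {s s' : St} (hi : s.i = encodeNat a ++ g)
    (hs : s' = {s with i := g, j := (encodeNat a).reverse ++ s.j,
                       z := (encodeNat a).reverse ++ s.z}) :
    Runs copyNum s.fn s'.fn (a + 1) := by
  subst hs
  have h : Runs (.whl .I isT (.pop .I ;; .push .J true ;; .push .Z true)) s.fn
      {s with i := false :: g, j := ones a ++ s.j, z := ones a ++ s.z}.fn (a + 1) := by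
    induction a generalizing s with
    | zero =>
      refine (Runs.whl_done (by simp [hi, isT, encodeNat])).congr rfl ?_
      obtain ⟨⟩ := s
      simp_all [encodeNat]
    | succ a ih =>
      have hi' : s.i = true :: (encodeNat a ++ g) := by
        simp [hi, encodeNat, List.replicate_succ]
      refine ((Runs.whl_step (T := 0) (by simp [hi', isT]) (Runs.pop_seq
        (Runs.push_seq (Runs.push rfl))) ((ih (s := {s with i := encodeNat a ++ g,
                                                            j := true :: s.j, z := true :: s.z}) rfl).congr ?_ rfl)).mono
        (by omega)).congr rfl ?_
      · simp [hi']
      · simp [List.replicate_succ, ones_append_cons]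
  refine (h.seq (T' := 0) (Runs.pop_seq (Runs.push_seq (Runs.push rfl)))).congr rfl ?_
  simp [reverse_encodeNat]

/-- Copies a number from `I` to `J`, `Z` and `D`. -/
def copyKind : Prog Reg :=
  .whl .I isT (.pop .I ;; .push .J true ;; .push .Z true ;; .push .D true) ;;
    .pop .I ;; .push .J false ;; .push .Z false

theorem runs_copyKind {a : ℕ} {g : List Bool} {s s' : St} (hi : s.i = encodeNat a ++ g)
    (hs : s' = {s with i := g, j := (encodeNat a).reverse ++ s.j, d := ones a ++ s.d,
                       z := (encodeNat a).reverse ++ s.z}) :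
    Runs copyKind s.fn s'.fn (a + 1) := by
  subst hs
  have h : Runs (.whl .I isT (.pop .I ;; .push .J true ;; .push .Z true ;; .push .D true)) s.fn
      {s with i := false :: g, j := ones a ++ s.j, z := ones a ++ s.z,
              d := ones a ++ s.d}.fn (a + 1) := by
    induction a generalizing s with
    | zero =>
      refine (Runs.whl_done (by simp [hi, isT, encodeNat])).congr rfl ?_
      obtain ⟨⟩ := s
      simp_all [encodeNat]
    | succ a ih =>
      have hi' : s.i = true :: (encodeNat a ++ g) := by
        simp [hi, encodeNat, List.replicate_succ]
      refine ((Runs.whl_step (T := 0) (by simp [hi', isT]) (Runs.pop_seq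
        (Runs.push_seq (Runs.push_seq (Runs.push rfl)))) ((ih (s := {s with i := encodeNat a ++ g,
                                                                            j := true :: s.j, z := true :: s.z, d := true :: s.d}) rfl).congr ?_ rfl)).mono
        (by omega)).congr rfl ?_
      · simp [hi']
      · simp [List.replicate_succ, ones_append_cons]
  refine (h.seq (T' := 0) (Runs.pop_seq (Runs.push_seq (Runs.push rfl)))).congr rfl ?_
  simp [reverse_encodeNat]

/-- Copies the qubits of a gate, shifted by the number on `P`; their number is on `D`. -/
def copyArgs : Prog Reg := .whl .D isT (.pop .D ;; copyTo .P .Z .X ;; copyNum)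

theorem runs_copyArgs {args : List ℕ} {g : List Bool} {p b : ℕ} {s s' : St}
    (hi : s.i = args.flatMap encodeNat ++ g) (hd : s.d = ones args.length) (hp : s.p = ones p)
    (hx : s.x = []) (hpb : p ≤ b) (hb : ∀ a ∈ args, a ≤ b)
    (hs : s' = {s with i := g, d := [], j := (args.flatMap encodeNat).reverse ++ s.j,
                       z := ((args.map (p + ·)).flatMap encodeNat).reverse ++ s.z}) :
    Runs copyArgs s.fn s'.fn (args.length * (3 * b + 4) + 1) := by
  subst hs
  induction args generalizing s with
  | nil =>
    refine ((Runs.whl_done (by simp [hd, isT])).mono (by omega)).congr rfl ?_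
    obtain ⟨⟩ := s
    simp_all
  | cons a args ih =>
    have h1 : Runs (copyTo .P .Z .X) {s with d := ones args.length}.fn
      {s with d := ones args.length, z := ones p ++ s.z}.fn (2 * p + 2) :=
      runs_copyTo (by decide) (by decide) (by decide) hp hx (by rw [St.update_z]; rfl)
    have h2 := runs_copyNum (a := a) (g := args.flatMap encodeNat ++ g)
      (s := {s with d := ones args.length, z := ones p ++ s.z}) (by simp [hi]) rfl
    have h3 := ih (s := {s with d := ones args.length, i := args.flatMap encodeNat ++ g,
                                j := (encodeNat a).reverse ++ s.j, z := (encodeNat a).reverse ++ (ones p ++ s.z)})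
      rfl rfl hp hx (fun a ha => hb a (by simp [ha]))
    have ha := hb a (by simp)
    refine ((Runs.whl_step (by simp [hd, isT, ones_succ])
      (Runs.pop_seq ((Runs.seq h1 h2).congr ?_ rfl)) h3).mono ?_).congr rfl ?_
    · simp [hd, ones_succ]
    · have : (a :: args).length * (3 * b + 4) = args.length * (3 * b + 4) + (3 * b + 4) := by
        simp [Nat.succ_mul]
      omega
    · have : (encodeNat (p + a)).reverse = (encodeNat a).reverse ++ ones p := by
        simp [reverse_encodeNat, Nat.add_comm p a]
      simp [this]

/-- Turns the kind of a gate on `D` into the number of its qubits. -/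
def countArgs : Prog Reg :=
  .pop .D ;; .ite .D Option.isNone (.push .D true) (.push .D true ;; .pop .D)

/-- Kinds 0, 1 and 2 take one qubit, kind 3 two and kind 4 three. -/
theorem runs_countArgs {q : ℕ} {s s' : St} (hd : s.d = ones q)
    (hs : s' = {s with d := ones (max 1 (q - 1))}) : Runs countArgs s.fn s'.fn 0 := by
  subst hs
  refine Runs.pop_seq ?_
  simp only [St.update_d, St.fn, hd]
  rcases Nat.lt_or_ge q 2 with h2 | h2
  · refine ⟨0, le_rfl, .ite_true ?_ ?_⟩
    · interval_cases q <;> rfl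
    · convert Exec.push Reg.D true _ using 1
      interval_cases q <;> simp
  · obtain ⟨q, rfl⟩ := Nat.exists_eq_add_of_le h2
    refine ⟨0, le_rfl, .ite_false ?_ ?_⟩
    · simp [show 2 + q = q + 1 + 1 by ring, ones_succ]
    · convert Exec.seq (Exec.push Reg.D true _) (Exec.pop Reg.D _) using 1
      simp [show 2 + q - 1 = q + 1 by omega]

/-- Copies a gate, shifted by the number on `P`. -/
def copyGate : Prog Reg := copyKind ;; countArgs ;; copyArgs

/-- The kind of a gate determines the number of its qubits. -/
def ValidRaw (b : ℕ) (r : ℕ × List ℕ) : Prop :=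
  r.1 ≤ 4 ∧ r.2.length = max 1 (r.1 - 1) ∧ ∀ a ∈ r.2, a ≤ b

theorem runs_copyGate {r : ℕ × List ℕ} {g : List Bool} {p b : ℕ} {s s' : St}
    (hi : s.i = encodeRaw r ++ g) (hd : s.d = []) (hp : s.p = ones p)
    (hx : s.x = []) (hpb : p ≤ b) (hr : ValidRaw b r)
    (hs : s' = {s with i := g, j := (encodeRaw r).reverse ++ s.j,
                       z := (encodeRaw (shiftRaw p r)).reverse ++ s.z}) :
    Runs copyGate s.fn s'.fn (9 * b + 18) := by
  subst hs
  obtain ⟨q, args⟩ := r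
  obtain ⟨hq, hl, hb⟩ := hr
  simp only at hq hl hb
  obtain ⟨⟩ := s
  simp only at hi hd hp hx
  subst hi hd hp hx
  apply RunsAfter.runs
  refine Runs.andThen (runs_copyKind (a := q) (g := args.flatMap encodeNat ++ g)
    (by simp [encodeRaw]) rfl) ?_
  dsimp only
  refine Runs.andThen (runs_countArgs (q := q) (by simp) rfl) ?_
  dsimp only
  rw [← hl]
  refine Runs.last (runs_copyArgs (args := args) (g := g) (p := p) (b := b) rfl rfl rfl rfl hpb
      hb rfl) ?_ ?_
  · simp [encodeRaw, shiftRaw]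
  · have : args.length ≤ 3 := by omega
    nlinarith

/-- Copies all gates, shifted by the number on `P`. -/
def copyGates : Prog Reg := .whl .I Option.isSome copyGate

theorem encodeRaw_ne_nil (r : ℕ × List ℕ) : encodeRaw r ≠ [] := by
  simp [encodeRaw, encodeNat]

/-- The gates consumed from `I` are kept in reverse on `J`, from which `block` restores them for the
next copy. -/
theorem runs_copyGates {rs : List (ℕ × List ℕ)} {p b : ℕ} {s s' : St}
    (hi : s.i = rs.flatMap encodeRaw) (hd : s.d = []) (hp : s.p = ones p)
    (hx : s.x = []) (hpb : p ≤ b) (hr : ∀ r ∈ rs, ValidRaw b r)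
    (hs : s' = {s with i := [], j := (rs.flatMap encodeRaw).reverse ++ s.j,
                       z := ((rs.map (shiftRaw p)).flatMap encodeRaw).reverse ++ s.z}) :
    Runs copyGates s.fn s'.fn (rs.length * (9 * b + 19) + 1) := by
  subst hs
  induction rs generalizing s with
  | nil =>
    refine ((Runs.whl_done (by simp [hi])).mono (by omega)).congr rfl ?_
    obtain ⟨⟩ := s
    simp_all
  | cons r rs ih =>
    refine ((Runs.whl_step ?_ (runs_copyGate (r := r) (g := rs.flatMap encodeRaw) (p := p) (b := b)
      (by simp [hi]) hd hp hx hpb (hr r (by simp)) rfl)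
      (ih rfl hd hp hx fun r hr' => hr r (by simp [hr']))).mono ?_).congr rfl ?_
    · obtain ⟨c, l, h⟩ := List.exists_cons_of_ne_nil (encodeRaw_ne_nil r)
      simp [hi, h]
    · simp only [List.length_cons, Nat.succ_mul]; omega
    · simp

/-- One copy of the circuit, followed by copying its output qubit. -/
def block : Prog Reg :=
  copyGates ;; revMove .J .I ;; pushAll .Z (encodeNat 3) (copyTo .P .Z .X ;; emitNum .O ;;
    emitNum .Q ;; copyTo .N .P .X ;; .push .Q true)

theorem Runs.last_push {k : Reg} {b : Bool} {s s' : Reg → List Bool} {c T : ℕ}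
    (h : update s k (b :: s k) = s') (hT : c ≤ T) : RunsAfter c (.push k b) s s' T :=
  Runs.last (Runs.push rfl) h (by simpa)

theorem runsAfter_pushAll {k : Reg} {l : List Bool} {q : Prog Reg} {s s' : Reg → List Bool}
    {c T : ℕ} (h : RunsAfter c q (update s k (l.reverse ++ s k)) s' T) :
    RunsAfter c (pushAll k l q) s s' T := by
  obtain ⟨t, ht, h⟩ := h
  obtain ⟨t', ht', h'⟩ := runs_pushAll (l := l) ⟨t, le_rfl, h⟩
  exact ⟨t', by omega, h'⟩

/-- The gates of a block. -/
def blockGates (rs : List (ℕ × List ℕ)) (n o R j : ℕ) : List (ℕ × List ℕ) :=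
  rs.map (shiftRaw (j * n)) ++ [(3, [j * n + o, R + j])]

theorem reverse_encodeNat_add (a b : ℕ) :
    (encodeNat (a + b)).reverse = (encodeNat b).reverse ++ ones a := by
  simp [reverse_encodeNat, Nat.add_comm a b]

/-- `P` holds the offset of the current block and `Q` the leaf that receives its result. Both are
merely advanced, so the loop over the copies needs no multiplication. -/
theorem runs_block {rs : List (ℕ × List ℕ)} {j n o R b : ℕ} {s s' : St}
    (hi : s.i = rs.flatMap encodeRaw) (hj : s.j = []) (hd : s.d = []) (hp : s.p = ones (j * n))
    (hn : s.n = ones n) (hq : s.q = ones (R + j)) (ho : s.o = ones o)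
    (hx : s.x = []) (hpb : j * n ≤ b) (hr : ∀ r ∈ rs, ValidRaw b r) (hnb : n ≤ b) (hob : o ≤ b)
    (hqb : R + j ≤ b) (hrs : rs.length ≤ b) (hrl : (rs.flatMap encodeRaw).length ≤ b)
    (hs : s' = {s with p := ones ((j + 1) * n), q := ones (R + (j + 1)),
                       z := ((blockGates rs n o R j).flatMap encodeRaw).reverse ++ s.z}) :
    Runs block s.fn s'.fn (9 * b * b + 40 * b + 20) := by
  subst hs
  obtain ⟨⟩ := s
  simp only at hi hd hp hx hj hn hq ho
  subst hi hd hp hx hj hn hq ho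
  apply RunsAfter.runs
  refine Runs.andThen (runs_copyGates (p := j * n) (b := b) rfl rfl rfl rfl hpb hr rfl) ?_
  dsimp only
  refine Runs.andThen (runs_revMove (by decide) (by rw [St.update_j, St.update_i])) ?_
  refine runsAfter_pushAll ?_
  rw [St.update_z]
  dsimp only
  refine Runs.andThen (runs_copyTo (n := j * n) (by decide) (by decide) (by decide) rfl rfl
      (St.update_z _ _).symm) ?_
  dsimp only
  refine Runs.andThen (runs_emitNum (n := o) (by decide) (by decide) rfl rfl rfl) ?_
  dsimp only
  refine Runs.andThen (runs_emitNum (n := R + j) (by decide) (by decide) rfl rfl rfl) ?_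
  dsimp only
  refine Runs.andThen (runs_copyTo (n := n) (by decide) (by decide) (by decide) rfl rfl
      (St.update_p _ _).symm) ?_
  dsimp only
  refine Runs.last_push ?_ ?_
  · rw [St.update_q]
    simp [blockGates, encodeRaw, reverse_encodeNat_add (j * n) o, Nat.succ_mul,
      ← Nat.add_assoc, List.replicate_succ, Nat.add_comm (j * n) n]
  · simp only [St.fn, List.length_append, List.length_reverse, List.length_nil]
    nlinarith

/-- All copies of the circuit. -/
def blocks : Prog Reg := .whl .T isT (.pop .T ;; .push .U true ;; block)

/-- At the end `P` holds `T * n` and `Q` holds `R + T`. For `R = n * T` these are the first leaf and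
the first inner node, where `tree` has to start; `U` has collected the count of leaves for it. -/
theorem runs_blocks {rs : List (ℕ × List ℕ)} {n o R b T : ℕ} {s s' : St}
    (hi : s.i = rs.flatMap encodeRaw) (hj : s.j = []) (hd : s.d = []) (hp : s.p = [])
    (hn : s.n = ones n) (hq : s.q = ones R) (ho : s.o = ones o) (ht : s.t = ones T)
    (hu : s.u = []) (hx : s.x = []) (hpb : T * n ≤ b) (hr : ∀ r ∈ rs, ValidRaw b r) (hnb : n ≤ b)
    (hob : o ≤ b) (hqb : R + T ≤ b) (hrs : rs.length ≤ b)
    (hrl : (rs.flatMap encodeRaw).length ≤ b)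
    (hs : s' = {s with t := [], u := ones T, p := ones (T * n), q := ones (R + T),
                       z := (((List.range T).flatMap (blockGates rs n o R)).flatMap encodeRaw).reverse ++ s.z}) :
    Runs blocks s.fn s'.fn (b * (9 * b * b + 40 * b + 21) + 1) := by
  subst hs
  have h := Runs.forLoop (a := Reg.T) (body := .push .U true ;; block)
    (T := 9 * b * b + 40 * b + 20)
    (fun l => St.fn {s with t := ones (T - l), u := ones l, p := ones (l * n), q := ones (R + l),
                            z := (((List.range l).flatMap (blockGates rs n o R)).flatMap encodeRaw).reverse ++ s.z}) T
    (fun l _ => rfl) (fun l hl => Runs.push_seq (by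
      have hln : l * n ≤ T * n := Nat.mul_le_mul_right _ hl.le
      refine (runs_block (s := {s with t := ones (T - l - 1), u := ones (l + 1), p := ones (l * n),
                                       q := ones (R + l), z := (((List.range l).flatMap
                                         (blockGates rs n o R)).flatMap encodeRaw).reverse ++ s.z})
        hi hj hd rfl hn rfl ho hx (hln.trans hpb) hr hnb hob (by omega) hrs hrl rfl).congr ?_ ?_
      · simp [List.replicate_succ]
      · simp [List.range_succ, Nat.sub_sub]))
  refine (h.congr ?_ (by simp)).mono ?_
  · obtain ⟨⟩ := s
    simp_all
  · have : T ≤ b := by omega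
    exact Nat.add_le_add_right (Nat.mul_le_mul this le_rfl) 1

/-! ### The tree of gates -/

/-- The gates that compute one node of the tree. -/
def nodeGates (A B i : ℕ) : List (ℕ × List ℕ) :=
  [(0, [B + i]), (4, [A + 2 * i, A + 2 * i + 1, B + i])]

/-- Emits the gates of the tree. -/
def tree : Prog Reg :=
  .pop .U ;; .whl .U isT (.pop .U ;; pushAll .Z (encodeNat 0) (emitNum .Q ;;
    pushAll .Z (encodeNat 4) (emitNum .P ;; .push .P true ;; emitNum .P ;; .push .P true ;;
      emitNum .Q ;; .push .Q true)))

/-- The initial pop accounts for the fact that `T` leaves require `T - 1` inner nodes. Reading pairs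
and writing results in consecutive order realises the heap layout, since `P` advances by two while
`Q` advances by one. -/
theorem runs_tree {A B T b : ℕ} {s s' : St} (hp : s.p = ones A) (hq : s.q = ones B)
    (hu : s.u = ones T) (hx : s.x = []) (hA : A + 2 * T ≤ b) (hB : B + T ≤ b)
    (hs : s' = {s with u := [], p := ones (A + 2 * (T - 1)), q := ones (B + (T - 1)),
                       z := (((List.range (T - 1)).flatMap (nodeGates A B)).flatMap encodeRaw).reverse ++ s.z}) :
    Runs tree s.fn s'.fn (b * (8 * b + 9) + 1) := by
  subst hs
  have h := Runs.forLoop (a := Reg.U) (body := pushAll .Z (encodeNat 0) (emitNum .Q ;;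
    pushAll .Z (encodeNat 4) (emitNum .P ;; .push .P true ;; emitNum .P ;; .push .P true ;;
      emitNum .Q ;; .push .Q true)))
    (T := 8 * b + 8)
    (fun l => St.fn {s with u := ones (T - 1 - l), p := ones (A + 2 * l), q := ones (B + l),
                            z := (((List.range l).flatMap (nodeGates A B)).flatMap encodeRaw).reverse ++ s.z}) (T - 1)
    (fun l _ => rfl) (fun l hl => by
      obtain ⟨⟩ := s
      simp only at hx
      subst hx
      apply RunsAfter.runs
      rw [St.update_u]
      refine runsAfter_pushAll ?_
      rw [St.update_z]
      dsimp only
      refine Runs.andThen (runs_emitNum (n := B + l) (by decide) (by decide) rfl rfl rfl) ?_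
      refine runsAfter_pushAll ?_
      rw [St.update_z]
      dsimp only
      refine Runs.andThen (runs_emitNum (n := A + 2 * l) (by decide) (by decide) rfl rfl rfl) ?_
      dsimp only
      refine Runs.andThen (T₁ := 0) (Runs.push (St.update_p _ _).symm) ?_
      dsimp only
      refine Runs.andThen (runs_emitNum (n := A + 2 * l + 1) (by decide) (by decide)
        (by simp [List.replicate_succ]) rfl rfl) ?_
      dsimp only
      refine Runs.andThen (T₁ := 0) (Runs.push (St.update_p _ _).symm) ?_
      dsimp only
      refine Runs.andThen (runs_emitNum (n := B + l) (by decide) (by decide) rfl rfl rfl) ?_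
      dsimp only
      refine Runs.last_push ?_ (by omega)
      rw [St.update_q]
      simp [List.range_succ, nodeGates, encodeRaw, Nat.sub_sub, mul_add, ← add_assoc,
        List.replicate_succ])
  refine ((Runs.pop_seq (h.congr ?_ rfl)).congr rfl (by simp)).mono ?_
  · obtain ⟨⟩ := s
    simp_all
  · have : T - 1 ≤ b := by omega
    nlinarith

/-- The gates after the tree: a coin is tossed and combined with the result of the tree. -/
def coinGates (A B : ℕ) : List (ℕ × List ℕ) := [(1, [B]), (4, [A, B, B + 1])]

/-- Emits the gates after the tree. -/
def coin : Prog Reg :=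
  pushAll .Z (encodeNat 1) (emitNum .Q ;; pushAll .Z (encodeNat 4) (emitNum .P ;;
    emitNum .Q ;; .push .Q true ;; emitNum .Q))

theorem runs_coin {A B : ℕ} {s s' : St} (hp : s.p = ones A) (hq : s.q = ones B) (hx : s.x = [])
    (hs : s' = {s with q := ones (B + 1),
                       z := ((coinGates A B).flatMap encodeRaw).reverse ++ s.z}) :
    Runs coin s.fn s'.fn (2 * A + 6 * B + 10) := by
  subst hs
  obtain ⟨⟩ := s
  simp only at hp hq hx
  subst hp hq hx
  apply RunsAfter.runs
  refine runsAfter_pushAll ?_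
  rw [St.update_z]
  dsimp only
  refine Runs.andThen (runs_emitNum (n := B) (by decide) (by decide) rfl rfl rfl) ?_
  refine runsAfter_pushAll ?_
  rw [St.update_z]
  dsimp only
  refine Runs.andThen (runs_emitNum (n := A) (by decide) (by decide) rfl rfl rfl) ?_
  dsimp only
  refine Runs.andThen (runs_emitNum (n := B) (by decide) (by decide) rfl rfl rfl) ?_
  dsimp only
  refine Runs.andThen (T₁ := 0) (Runs.push (St.update_q _ _).symm) ?_
  dsimp only
  refine Runs.last (runs_emitNum (n := B + 1) (by decide) (by decide)
    (by simp [List.replicate_succ]) rfl rfl) ?_ (by omega)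
  simp [coinGates, encodeRaw, List.replicate_succ]

end StackProg

namespace StackProg

open Function QEA

/-! ### The whole program -/

/-- The gates of the circuit that is generated from the circuit with gates `rs` and output
qubit `o`. -/
def generatedGates (rs : List (ℕ × List ℕ)) (n o : ℕ) : List (ℕ × List ℕ) :=
  (List.range (n ^ 4)).flatMap (blockGates rs n o (n * n ^ 4)) ++
    ((List.range (n ^ 4 - 1)).flatMap (nodeGates (n * n ^ 4) (n * n ^ 4 + n ^ 4)) ++
      coinGates (n * n ^ 4 + 2 * (n ^ 4 - 1)) (n * n ^ 4 + n ^ 4 + (n ^ 4 - 1)))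

/-- The description of the generated circuit. -/
def generatedString (rs : List (ℕ × List ℕ)) (n o : ℕ) : List Bool :=
  encodeNat (n * n ^ 4 + 2 * n ^ 4 + n) ++ encodeNat n ++
    ((List.range n).flatMap fun i => encodeNat (n * n ^ 4 + 2 * n ^ 4 + i)) ++
    (generatedGates rs n o).flatMap encodeRaw

/-- Generates the description of the circuit in reverse order on `Z`. -/
def generateReversed (n₀ : ℕ) : Prog Reg :=
  revMove .J .I ;; readHeader ;; pushAll .N (ones n₀) (doubling ;; computeSizes ;; emitHeader ;;
    blocks ;; tree ;; coin ;; clear .I ;; clear .O ;; clear .N ;; clear .P ;; clear .Q)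

/-- The number `b` dominates every wire number, all being below `(n + 1) ^ 5`, and the input length.
Each phase is then at most cubic in `b`; copying the blocks is the dominant one. -/
theorem runs_generateReversed {n₀ k o b : ℕ} {rs : List (ℕ × List ℕ)} {y : List Bool}
    (hy : y = encodeNat k ++ encodeNat 1 ++ encodeNat o ++ rs.flatMap encodeRaw)
    (hr : ∀ r ∈ rs, ValidRaw k r) (hyb : (n₀ * 2 ^ k.size + 1) ^ 5 + y.length ≤ b) :
    Runs (generateReversed n₀) (St.fn ⟨[], y.reverse, [], [], [], [], [], [], [], [], [], [], [],
      []⟩) (St.fn ⟨[], [], [], [], [], [], [], [], [], [], [], [],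
        (generatedString rs (n₀ * 2 ^ k.size) o).reverse, []⟩) (200 * (b + 1) ^ 3) := by
  set n := n₀ * 2 ^ k.size with hn
  have hlen : k + 1 + 2 + (o + 1) + (rs.flatMap encodeRaw).length = y.length := by
    simp [hy, encodeNat]; ring
  have hrl : rs.length ≤ (rs.flatMap encodeRaw).length := by
    clear hlen hy hyb hr
    induction rs with
    | nil => simp
    | cons r rs ih =>
      have := List.length_pos_iff.2 (encodeRaw_ne_nil r)
      simp only [List.length_cons, List.flatMap_cons, List.length_append]
      omega
  have hnb : n * n ^ 4 + 2 * n ^ 4 + n ≤ (n + 1) ^ 5 := by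
    ring_nf
    nlinarith [pow_nonneg (Nat.zero_le n) 3, pow_nonneg (Nat.zero_le n) 4,
      pow_nonneg (Nat.zero_le n) 2]
  have hsize : k.size ≤ k := Nat.size_le.2 Nat.lt_two_pow_self
  have hT : n * n ^ 4 = n ^ 4 * n := mul_comm _ _
  apply RunsAfter.runs
  refine Runs.andThen (runs_revMove (by decide) (by rw [St.update_j, St.update_i])) ?_
  dsimp only
  refine Runs.andThen (runs_readHeader (k := k) (o := o) (g := rs.flatMap encodeRaw)
    (by simp [hy]) rfl rfl rfl) ?_
  refine runsAfter_pushAll ?_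
  rw [St.update_n]
  dsimp only
  refine Runs.andThen (runs_doubling (k := k) (n := n₀) rfl (by simp) rfl rfl) ?_
  rw [← hn]
  dsimp only
  refine Runs.andThen (runs_computeSizes (n := n) rfl rfl rfl rfl rfl rfl rfl rfl) ?_
  dsimp only
  refine Runs.andThen (runs_emitHeader (n := n) (w := n * n ^ 4 + 2 * n ^ 4) rfl rfl rfl rfl
    rfl) ?_
  dsimp only
  refine Runs.andThen (runs_blocks (rs := rs) (n := n) (o := o) (R := n * n ^ 4) (T := n ^ 4)
    (b := b) rfl rfl rfl rfl rfl rfl rfl rfl rfl rfl (by omega)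
    (fun r hr' => ⟨(hr r hr').1, (hr r hr').2.1, fun a ha => ((hr r hr').2.2 a ha).trans
      (by omega)⟩) (by omega) (by omega) (by omega) (by omega) (by omega) rfl) ?_
  dsimp only
  refine Runs.andThen (runs_tree (A := n ^ 4 * n) (B := n * n ^ 4 + n ^ 4) (T := n ^ 4) (b := b)
    rfl rfl rfl rfl (by omega) (by omega) rfl) ?_
  dsimp only
  refine Runs.andThen (runs_coin (A := n ^ 4 * n + 2 * (n ^ 4 - 1))
    (B := n * n ^ 4 + n ^ 4 + (n ^ 4 - 1)) rfl rfl rfl rfl) ?_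
  dsimp only
  refine Runs.andThen (runs_clear (St.update_i _ _).symm) ?_
  dsimp only
  refine Runs.andThen (runs_clear (St.update_o _ _).symm) ?_
  dsimp only
  refine Runs.andThen (runs_clear (St.update_n _ _).symm) ?_
  dsimp only
  refine Runs.andThen (runs_clear (St.update_p _ _).symm) ?_
  dsimp only
  refine Runs.last (runs_clear (St.update_q _ _).symm) ?_ ?_
  · simp only [generatedString, generatedGates, hT, List.flatMap_append, List.reverse_append,
      List.append_assoc, List.append_nil]
  · simp only [St.fn, List.length_reverse, List.length_replicate]
    have e1 : k.size * (2 * k + 3 * n + 5) ≤ b * (2 * b + 3 * b + 5) := by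
      gcongr <;> omega
    have e2 : 20 * (n + (n * n ^ 4 + 2 * n ^ 4) + 1) ^ 2 ≤ 20 * (b + 1) ^ 2 := by
      gcongr; omega
    have e3 : 200 * (b + 1) ^ 3 = b * (9 * b * b + 40 * b + 21) + b * (8 * b + 9) +
      b * (2 * b + 3 * b + 5) + 20 * (b + 1) ^ 2 +
        (191 * (b * (b * b)) + 527 * (b * b) + 525 * b + 180) := by ring
    have e4 : 0 ≤ b * (b * b) := Nat.zero_le _
    have e5 : 0 ≤ b * b := Nat.zero_le _
    rw [e3]
    omega

/-- The program that generates the description of the circuit. -/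
def generate (n₀ : ℕ) : Prog Reg := generateReversed n₀ ;; revMove .Z .R

end StackProg

/-! ### The generated description is computable in polynomial time -/

namespace QEA

open StackProg Function

/-- `n₀` is hard-wired into the program; it is through this constant that `N` and the `α`-dependent
lower bound on `n` enter the reduction. Since `2 ^ k.size ≤ 2 * k + 1`, the number `n` stays linear
in the input length. -/
theorem polyTime_generate (n₀ : ℕ) {g f : List Bool → List Bool} (hg : PolyTime g)
    (h : ∀ x, ∃ k o rs, g x = encodeNat k ++ encodeNat 1 ++ encodeNat o ++ rs.flatMap encodeRaw ∧
      (∀ r ∈ rs, ValidRaw k r) ∧ f x = generatedString rs (n₀ * 2 ^ k.size) o) : PolyTime f := by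
  set c := (generateReversed n₀).pushes with hc
  refine hg.of_prog (generate n₀) .J .R
    (fun L => (c + 1) * (200 * ((n₀ * (2 * L + 1) + 1) ^ 5 + L + 1) ^ 3 + 1)) ?_ ?_ ?_
  · refine ⟨Polynomial.C (c + 1) * (Polynomial.C 200 * ((Polynomial.C n₀ *
      (Polynomial.C 2 * Polynomial.X + 1) + 1) ^ 5 + Polynomial.X + 1) ^ 3 + 1), fun L => ?_⟩
    simp only [Polynomial.eval_mul, Polynomial.eval_add, Polynomial.eval_pow, Polynomial.eval_C,
      Polynomial.eval_X, Polynomial.eval_one, le_refl]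
  · intro L L' hL
    dsimp only
    gcongr
  · intro x
    obtain ⟨k, o, rs, hgx, hrs, hfx⟩ := h x
    have hk : k ≤ (g x).length := by simp [hgx, encodeNat]
    have h2 : 2 ^ k.size ≤ 2 * k + 1 := by
      rcases Nat.eq_zero_or_pos k with rfl | hk
      · simp
      · have h3 : 0 < k.size := Nat.size_pos.2 hk
        have h4 : 2 ^ (k.size - 1) ≤ k := Nat.lt_size.1 (by omega)
        obtain ⟨j, hj⟩ := Nat.exists_eq_succ_of_ne_zero h3.ne'
        rw [hj, Nat.succ_eq_add_one, pow_succ]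
        rw [hj, Nat.succ_eq_add_one, Nat.add_sub_cancel] at h4
        omega
    obtain ⟨t, ht, h1⟩ := runs_generateReversed (n₀ := n₀)
      (b := (n₀ * (2 * (g x).length + 1) + 1) ^ 5 + (g x).length) hgx hrs (by
        gcongr
        omega)
    -- The time of the final reversal depends on the length of the output, which is bounded by
    -- counting pushes instead of measuring the generated string.
    have hlen := h1.length_le .Z
    simp only [St.fn, List.length_nil, Nat.zero_add, ← hc] at hlen
    obtain ⟨t', ht', h5⟩ := runs_revMove (a := Reg.Z) (c := Reg.R) (by decide)
      (s := St.fn ⟨[], [], [], [], [], [], [], [], [], [], [], [],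
        (generatedString rs (n₀ * 2 ^ k.size) o).reverse, []⟩)
      (s' := St.fn ⟨[], [], [], [], [], [], [], [], [], [], [], [], [],
        generatedString rs (n₀ * 2 ^ k.size) o⟩) (by
        rw [St.update_z, St.update_r]; simp)
    have h6 := h1.seq h5
    refine ⟨t + t', ?_, ?_⟩
    · simp only [St.fn] at ht'
      have e : c * (t + 1) ≤ c * (200 * ((n₀ * (2 * (g x).length + 1) + 1) ^ 5 +
        (g x).length + 1) ^ 3 + 1) := by gcongr
      calc t + t' ≤ t + (c * (t + 1) + 1) := by
            have := ht'.trans (Nat.add_le_add_right hlen 1)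
            omega
        _ ≤ _ := by rw [add_mul, one_mul]; omega
    · have i1 : update (fun _ => []) Reg.J (g x).reverse = St.fn ⟨[], (g x).reverse, [], [], [],
          [], [], [], [], [], [], [], [], []⟩ := by
        funext r; cases r <;> rfl
      have i2 : update (fun _ => []) Reg.R (f x) = St.fn ⟨[], [], [], [], [],
          [], [], [], [], [], [], [], [], f x⟩ := by
        funext r; cases r <;> rfl
      rw [i1, i2, hfx]
      exact h6

end QEA

namespace QEA

open Function StackProg

/-! ### The action of gates on states -/

theorem mulVec_classicalOp {m : ℕ} (f : (Fin m → Bool) → (Fin m → Bool)) (hf : Involutive f)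
    (ψ : (Fin m → Bool) → ℂ) (x : Fin m → Bool) :
    (classicalOp f).mulVec ψ x = ψ (f x) := by
  simp only [Matrix.mulVec, dotProduct, classicalOp, Matrix.of_apply, ite_mul, one_mul, zero_mul]
  rw [Finset.sum_eq_single (f x)]
  · simp [hf x]
  · intro y _ hy
    rw [if_neg]
    rintro rfl
    exact hy (hf y).symm
  · simp

theorem mulVec_oneQubit {m : ℕ} (U : Matrix Bool Bool ℂ) (i : Fin m)
    (ψ : (Fin m → Bool) → ℂ) (x : Fin m → Bool) :
    (oneQubit U i).mulVec ψ x = ∑ b, U (x i) b * ψ (update x i b) := by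
  simp only [Matrix.mulVec, dotProduct, oneQubit, Matrix.of_apply, ite_mul, zero_mul]
  rw [← Finset.sum_filter]
  refine Finset.sum_bij' (fun y _ => y i) (fun b _ => update x i b) ?_ ?_ ?_ ?_ ?_
  · simp
  · intro b _
    simp only [Finset.mem_filter, Finset.mem_univ, true_and]
    intro j hj
    simp [hj]
  · intro y hy
    simp only [Finset.mem_filter, Finset.mem_univ, true_and] at hy
    funext j
    by_cases h : j = i
    · subst h; simp
    · simp [h, hy j h]
  · simp
  · intro y hy
    simp only [Finset.mem_filter, Finset.mem_univ, true_and] at hy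
    congr 2
    funext j
    by_cases h : j = i
    · subst h; simp
    · simp [h, hy j h]

theorem involutive_flip {ι : Type*} [DecidableEq ι] (t : ι) (c : (ι → Bool) → Bool)
    (hc : ∀ x b, c (update x t b) = c x) : Involutive fun x => update x t (xor (x t) (c x)) := by
  intro x
  simp [hc]

/-- The kind and the qubits of a gate. -/
def Gate.raw {m : ℕ} : Gate m → ℕ × List ℕ
  | .X i => (0, [↑i])
  | .H i => (1, [↑i])
  | .T i => (2, [↑i])
  | .CNOT c t _ => (3, [↑c, ↑t])
  | .Toffoli a b t _ _ _ => (4, [↑a, ↑b, ↑t])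

theorem Gate.encode_eq {m : ℕ} (g : Gate m) : g.encode = encodeRaw g.raw := by
  cases g <;> simp [Gate.encode, Gate.raw, encodeRaw]

theorem Gate.validRaw {m : ℕ} (g : Gate m) : ValidRaw m g.raw := by
  cases g <;> simp [ValidRaw, Gate.raw, le_of_lt]

/-- The classical gates as maps of assignments of bits to wires. -/
def clMap (r : ℕ × List ℕ) (z : ℕ → Bool) : ℕ → Bool :=
  match r with
  | (0, [i]) => update z i (!z i)
  | (3, [c, t]) => update z t (xor (z t) (z c))
  | (4, [a, b, t]) => update z t (xor (z t) (z a && z b))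
  | _ => z

/-- The action of gates on amplitudes of assignments of bits to wires. -/
noncomputable def act (r : ℕ × List ℕ) (Ψ : (ℕ → Bool) → ℂ) (z : ℕ → Bool) : ℂ :=
  match r with
  | (1, [i]) => ∑ b, hadamard (z i) b * Ψ (update z i b)
  | (2, [i]) => ∑ b, tMatrix (z i) b * Ψ (update z i b)
  | r => Ψ (clMap r z)

/-- The action of a sequence of gates. -/
noncomputable def run (rs : List (ℕ × List ℕ)) (Ψ : (ℕ → Bool) → ℂ) : (ℕ → Bool) → ℂ :=
  rs.foldl (fun Ψ r => act r Ψ) Ψ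

theorem run_append (rs rs' : List (ℕ × List ℕ)) (Ψ : (ℕ → Bool) → ℂ) :
    run (rs ++ rs') Ψ = run rs' (run rs Ψ) := by
  simp [run]

theorem run_cons (r : ℕ × List ℕ) (rs : List (ℕ × List ℕ)) (Ψ : (ℕ → Bool) → ℂ) :
    run (r :: rs) Ψ = run rs (act r Ψ) := rfl

/-- The bits on the wires `d, …, d + k - 1`. -/
def window (d k : ℕ) (z : ℕ → Bool) : Fin k → Bool := fun i => z (d + i)

theorem window_update {d k : ℕ} (z : ℕ → Bool) (i : Fin k) (b : Bool) :
    window d k (update z (d + i) b) = update (window d k z) i b := by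
  funext j
  by_cases h : j = i
  · subst h; simp [window]
  · have : (j : ℕ) ≠ i := fun h' => h (Fin.ext h')
    simp [window, h, this]

theorem act_shift {k : ℕ} (g : Gate k) (d : ℕ) (ψ : (Fin k → Bool) → ℂ) (χ : (ℕ → Bool) → ℂ)
    (hχ : ∀ z (i : Fin k) b, χ (update z (d + i) b) = χ z) :
    act (shiftRaw d g.raw) (fun z => ψ (window d k z) * χ z) =
      fun z => g.op.mulVec ψ (window d k z) * χ z := by
  funext z
  cases g with
  | X i =>
    simp only [Gate.raw, shiftRaw, List.map, act, clMap, Gate.op]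
    rw [mulVec_classicalOp _ (by simpa using involutive_flip i (fun _ => true) (by simp)),
      window_update, hχ]
    rfl
  | H i =>
    simp only [Gate.raw, shiftRaw, List.map, act, Gate.op]
    rw [mulVec_oneQubit, Finset.sum_mul]
    refine Finset.sum_congr rfl fun b _ => ?_
    rw [window_update, hχ, mul_assoc]
    rfl
  | T i =>
    simp only [Gate.raw, shiftRaw, List.map, act, Gate.op]
    rw [mulVec_oneQubit, Finset.sum_mul]
    refine Finset.sum_congr rfl fun b _ => ?_
    rw [window_update, hχ, mul_assoc]
    rfl
  | CNOT c t h =>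
    simp only [Gate.raw, shiftRaw, List.map, act, clMap, Gate.op]
    rw [mulVec_classicalOp _ (involutive_flip t (fun x => x c) (by simp [h])),
      window_update, hχ]
    rfl
  | Toffoli a b t hab hat hbt =>
    simp only [Gate.raw, shiftRaw, List.map, act, clMap, Gate.op]
    rw [mulVec_classicalOp _ (involutive_flip t (fun x => x a && x b) (by simp [hat, hbt])),
      window_update, hχ]
    rfl

/-- A shifted gate only touches the wires of the window, along which `χ` is constant, so it acts on
the factor `ψ` alone. Wires are indexed by `ℕ` so that a shift is plain addition. -/
theorem run_shift {k : ℕ} (gs : List (Gate k)) (d : ℕ) (ψ : (Fin k → Bool) → ℂ)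
    (χ : (ℕ → Bool) → ℂ) (hχ : ∀ z (i : Fin k) b, χ (update z (d + i) b) = χ z) :
    run ((gs.map Gate.raw).map (shiftRaw d)) (fun z => ψ (window d k z) * χ z) =
      fun z => (gatesOp gs).mulVec ψ (window d k z) * χ z := by
  induction gs generalizing ψ with
  | nil => simp [run, gatesOp]
  | cons g gs ih =>
    simp only [List.map_cons, run_cons, gatesOp, ← Matrix.mulVec_mulVec]
    rw [act_shift g d ψ χ hχ, ih]

/-- An assignment of bits to the first `m` wires, extended by `false`. -/
def ext {m : ℕ} (x : Fin m → Bool) : ℕ → Bool := fun i => if h : i < m then x ⟨i, h⟩ else false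

theorem window_zero_ext {m : ℕ} (x : Fin m → Bool) : window 0 m (ext x) = x := by
  funext i
  simp [window, ext]

theorem ext_update {m : ℕ} (x : Fin m → Bool) (i : Fin m) (b : Bool) :
    ext (update x i b) = update (ext x) i b := by
  funext j
  by_cases h : j = i
  · subst h; simp [ext]
  · by_cases hj : j < m
    · have : (⟨j, hj⟩ : Fin m) ≠ i := fun h' => h (by simp [← h'])
      simp [ext, h, hj, this]
    · simp [ext, h, hj]

/-- The amplitudes of the state in which the first `m` wires are `0`. -/
noncomputable def zeroState (m : ℕ) (z : ℕ → Bool) : ℂ :=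
  if window 0 m z = fun _ => false then 1 else 0

theorem shiftRaw_zero (r : ℕ × List ℕ) : shiftRaw 0 r = r := by
  simp [shiftRaw]

theorem state_eq_run {m n : ℕ} (C : Circuit m n) (x : Fin m → Bool) :
    C.state x = run (C.gates.map Gate.raw) (zeroState m) (ext x) := by
  have h := run_shift C.gates 0 (Pi.single (fun _ => false) 1) (fun _ => 1) (by simp)
  have h0 : (fun z => (Pi.single (fun _ => false) 1 : (Fin m → Bool) → ℂ) (window 0 m z) * 1) =
      zeroState m := by
    funext z
    simp [zeroState, Pi.single_apply]
  rw [h0, show shiftRaw 0 = id from funext shiftRaw_zero, List.map_id] at h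
  rw [h]
  simp [Circuit.state, window_zero_ext]

/-! ### Normalization -/

theorem sum_flip {m : ℕ} (i : Fin m) (F : (Fin m → Bool) → ℝ) :
    ∑ x, F (update x i (!x i)) = ∑ x, F x := by
  have h : Involutive fun x : Fin m → Bool => update x i (!x i) := by
    simpa using involutive_flip i (fun _ => true) (by simp)
  exact Equiv.sum_comp h.toPerm F

/-- Doubling the sum and pairing each `x` with its flip at `i` reduces the claim to the isometry of
`U` on one qubit. -/
theorem sum_norm_sq_mulVec_oneQubit {m : ℕ} (U : Matrix Bool Bool ℂ)
    (hU : ∀ a b : ℂ, ‖U false false * a + U false true * b‖ ^ 2 +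
      ‖U true false * a + U true true * b‖ ^ 2 = ‖a‖ ^ 2 + ‖b‖ ^ 2)
    (i : Fin m) (ψ : (Fin m → Bool) → ℂ) :
    ∑ x, ‖(oneQubit U i).mulVec ψ x‖ ^ 2 = ∑ x, ‖ψ x‖ ^ 2 := by
  have h2 : ∀ F : (Fin m → Bool) → ℝ, 2 * ∑ x, F x = ∑ x, (F x + F (update x i (!x i))) := by
    intro F
    rw [Finset.sum_add_distrib, sum_flip, two_mul]
  have : 2 * ∑ x, ‖(oneQubit U i).mulVec ψ x‖ ^ 2 = 2 * ∑ x, ‖ψ x‖ ^ 2 := by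
    rw [h2, h2]
    refine Finset.sum_congr rfl fun x _ => ?_
    rw [mulVec_oneQubit, mulVec_oneQubit]
    have h3 := hU (ψ (update x i false)) (ψ (update x i true))
    cases hx : x i
    · have : ψ x = ψ (update x i false) := by rw [← hx, update_eq_self]
      simp only [update_self, update_idem, Fintype.sum_bool, Bool.not_false, this]
      rw [add_comm (U false true * _), add_comm (U true true * _)]
      exact h3
    · have : ψ x = ψ (update x i true) := by rw [← hx, update_eq_self]
      simp only [update_self, update_idem, Fintype.sum_bool, Bool.not_true, this]
      rw [add_comm (U false true * _), add_comm (U true true * _)]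
      linarith
  linarith

theorem norm_sq_hadamard (a b : ℂ) : ‖hadamard false false * a + hadamard false true * b‖ ^ 2 +
      ‖hadamard true false * a + hadamard true true * b‖ ^ 2 = ‖a‖ ^ 2 + ‖b‖ ^ 2 := by
  have h1 : hadamard false false * a + hadamard false true * b =
      (1 / (Real.sqrt 2 : ℂ)) * (a + b) := by
    simp [hadamard]; ring
  have h2 : hadamard true false * a + hadamard true true * b =
      (1 / (Real.sqrt 2 : ℂ)) * (a - b) := by
    simp [hadamard]; ring
  have h3 : ‖(1 / (Real.sqrt 2 : ℂ))‖ ^ 2 = 1 / 2 := by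
    rw [norm_div, norm_one, Complex.norm_real, div_pow, one_pow, Real.norm_eq_abs, sq_abs,
      Real.sq_sqrt (by norm_num)]
  rw [h1, h2, norm_mul, norm_mul, mul_pow, mul_pow, h3]
  have h4 := parallelogram_law_with_norm ℝ a b
  nlinarith

theorem norm_sq_tMatrix (a b : ℂ) : ‖tMatrix false false * a + tMatrix false true * b‖ ^ 2 +
      ‖tMatrix true false * a + tMatrix true true * b‖ ^ 2 = ‖a‖ ^ 2 + ‖b‖ ^ 2 := by
  have h : ‖Complex.exp (Complex.I * (Real.pi / 4 : ℝ))‖ = 1 := by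
    rw [mul_comm]; exact Complex.norm_exp_ofReal_mul_I _
  simp [tMatrix, Matrix.diagonal, -Complex.ofReal_div, h]

theorem sum_norm_sq_mulVec_classicalOp {m : ℕ} (f : (Fin m → Bool) → (Fin m → Bool))
    (hf : Involutive f) (ψ : (Fin m → Bool) → ℂ) :
    ∑ x, ‖(classicalOp f).mulVec ψ x‖ ^ 2 = ∑ x, ‖ψ x‖ ^ 2 := by
  simp only [mulVec_classicalOp f hf]
  exact Equiv.sum_comp hf.toPerm fun x => ‖ψ x‖ ^ 2

theorem sum_norm_sq_mulVec_op {m : ℕ} (g : Gate m) (ψ : (Fin m → Bool) → ℂ) :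
    ∑ x, ‖g.op.mulVec ψ x‖ ^ 2 = ∑ x, ‖ψ x‖ ^ 2 := by
  cases g with
  | X i =>
    exact sum_norm_sq_mulVec_classicalOp _
      (by simpa using involutive_flip i (fun _ => true) (by simp)) ψ
  | H i => exact sum_norm_sq_mulVec_oneQubit _ norm_sq_hadamard i ψ
  | T i => exact sum_norm_sq_mulVec_oneQubit _ norm_sq_tMatrix i ψ
  | CNOT c t h =>
    exact sum_norm_sq_mulVec_classicalOp _
      (involutive_flip t (fun x => x c) (by simp [h])) ψ
  | Toffoli a b t hab hat hbt =>
    exact sum_norm_sq_mulVec_classicalOp _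
      (involutive_flip t (fun x => x a && x b) (by simp [hat, hbt])) ψ

theorem sum_norm_sq_mulVec_gatesOp {m : ℕ} (gs : List (Gate m)) (ψ : (Fin m → Bool) → ℂ) :
    ∑ x, ‖(gatesOp gs).mulVec ψ x‖ ^ 2 = ∑ x, ‖ψ x‖ ^ 2 := by
  induction gs generalizing ψ with
  | nil => simp [gatesOp]
  | cons g gs ih =>
    simp only [gatesOp, ← Matrix.mulVec_mulVec]
    rw [ih, sum_norm_sq_mulVec_op]

theorem sum_norm_sq_state {m n : ℕ} (C : Circuit m n) : ∑ x, ‖C.state x‖ ^ 2 = 1 := by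
  rw [Circuit.state, sum_norm_sq_mulVec_gatesOp]
  simp [Pi.single_apply, apply_ite]

end QEA

namespace QEA

open Function StackProg

/-! ### Measuring a state in the computational basis -/

/-- The expectation of `F` when the first `m` wires are measured in the state `Ψ`. -/
noncomputable def measured (m : ℕ) (Ψ : (ℕ → Bool) → ℂ) (F : (ℕ → Bool) → ℝ) : ℝ :=
  ∑ x : Fin m → Bool, ‖Ψ (ext x)‖ ^ 2 * F (ext x)

/-- A controlled flip permutes the basis and is its own inverse, so it can be moved from the state
to the measured function, as in the Heisenberg picture. -/
theorem measured_flip {m t : ℕ} (ht : t < m) (c : (ℕ → Bool) → Bool)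
    (hc : ∀ z b, c (update z t b) = c z) (Ψ : (ℕ → Bool) → ℂ) (F : (ℕ → Bool) → ℝ) :
    measured m (fun z => Ψ (update z t (xor (z t) (c z)))) F =
      measured m Ψ fun z => F (update z t (xor (z t) (c z))) := by
  have hf : Involutive fun x : Fin m → Bool =>
      update x ⟨t, ht⟩ (xor (x ⟨t, ht⟩) (c (ext x))) :=
    involutive_flip _ (fun x => c (ext x)) fun x b => by rw [ext_update]; exact hc _ _
  have he : ∀ x : Fin m → Bool, ext (update x ⟨t, ht⟩ (xor (x ⟨t, ht⟩) (c (ext x)))) =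
      update (ext x) t (xor (ext x t) (c (ext x))) := by
    intro x
    rw [ext_update]
    simp [ext, ht]
  unfold measured
  rw [← Equiv.sum_comp hf.toPerm]
  refine Finset.sum_congr rfl fun x _ => ?_
  have h1 := he x
  have h2 := he (update x ⟨t, ht⟩ (xor (x ⟨t, ht⟩) (c (ext x))))
  have h3 := hf x
  dsimp only at h3
  rw [h3] at h2
  simp only [Involutive.coe_toPerm]
  rw [← h2, h1]

/-- The bits in the window and those outside vary independently. Adding `v` modulo 2 on the window
maps the fibre over `0` to the fibre over `v` and leaves `B` unchanged. -/
theorem sum_window {m d k : ℕ} (hd : d + k ≤ m) (A : (Fin k → Bool) → ℝ) (B : (ℕ → Bool) → ℝ)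
    (hB : DependsOn B {w | ¬(d ≤ w ∧ w < d + k)}) :
    ∑ x : Fin m → Bool, A (window d k (ext x)) * B (ext x) =
      (∑ v, A v) * ∑ x : Fin m → Bool,
        if window d k (ext x) = (fun _ => false) then B (ext x) else 0 := by
  have key : ∀ v : Fin k → Bool,
      (∑ x : Fin m → Bool, if window d k (ext x) = (fun _ => false) then B (ext x) else 0) =
        ∑ x : Fin m → Bool, if window d k (ext x) = v then B (ext x) else 0 := by
    intro v
    let σ : (Fin m → Bool) → Fin m → Bool := fun x i =>
      xor (x i) (if h : d ≤ i ∧ (i : ℕ) < d + k then v ⟨i - d, by omega⟩ else false)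
    have hσ : Involutive σ := by
      intro x
      funext i
      simp [σ]
    rw [← Equiv.sum_comp hσ.toPerm fun x => if window d k (ext x) = v then B (ext x) else 0]
    refine Finset.sum_congr rfl fun x _ => ?_
    have h1 : ∀ i, window d k (ext (σ x)) i = xor (window d k (ext x) i) (v i) := by
      intro i
      have hi : d + (i : ℕ) < m := by omega
      simp [window, ext, σ, hi]
    have h2 : window d k (ext (σ x)) = v ↔ window d k (ext x) = fun _ => false := by
      constructor
      · intro h
        funext i
        have := h1 i
        rw [h] at this
        revert this
        cases v i <;> cases window d k (ext x) i <;> simp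
      · intro h
        funext i
        rw [h1 i, h]
        simp
    have h3 : B (ext (σ x)) = B (ext x) := by
      refine hB fun w hw => ?_
      simp only [Set.mem_ofPred_eq] at hw
      by_cases hwm : w < m
      · simp [ext, hwm, σ, hw]
      · simp [ext, hwm]
    change _ = if window d k (ext (σ x)) = v then B (ext (σ x)) else 0
    simp only [h2, h3]
  have hv : ∀ v ∈ (Finset.univ : Finset (Fin k → Bool)), (A v * ∑ x : Fin m → Bool,
      if window d k (ext x) = (fun _ => false) then B (ext x) else 0) =
        ∑ x : Fin m → Bool, A v * if window d k (ext x) = v then B (ext x) else 0 :=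
    fun v _ => by rw [key v, Finset.mul_sum]
  rw [Finset.sum_mul, Finset.sum_congr rfl hv, Finset.sum_comm]
  refine Finset.sum_congr rfl fun x _ => ?_
  simp

/-! ### Running a circuit on a fresh block of wires -/

theorem act_cnot (c t : ℕ) (Ψ : (ℕ → Bool) → ℂ) :
    act (3, [c, t]) Ψ = fun z => Ψ (update z t (xor (z t) (z c))) := rfl

theorem act_x (t : ℕ) (Ψ : (ℕ → Bool) → ℂ) :
    act (0, [t]) Ψ = fun z => Ψ (update z t (!z t)) := rfl

theorem act_toffoli (a b t : ℕ) (Ψ : (ℕ → Bool) → ℂ) :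
    act (4, [a, b, t]) Ψ = fun z => Ψ (update z t (xor (z t) (z a && z b))) := rfl

/-- The assignment that is `false` on the wires `d, …, d + k - 1` and agrees with `z` elsewhere. -/
def zeroed (d k : ℕ) (z : ℕ → Bool) : ℕ → Bool := fun w => if d ≤ w ∧ w < d + k then false else z w

theorem sum_ite_acceptProb {k : ℕ} (C : Circuit k 1) (a b : ℝ) :
    (∑ v : Fin k → Bool, ‖C.state v‖ ^ 2 * if v (C.out 0) = true then a else b) =
      (1 - C.acceptProb) * b + C.acceptProb * a := by
  have h := sum_norm_sq_state C
  have h1 : ∀ v : Fin k → Bool, (‖C.state v‖ ^ 2 * if v (C.out 0) = true then a else b) =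
      ‖C.state v‖ ^ 2 * b + (if v (C.out 0) = true then ‖C.state v‖ ^ 2 else 0) * (a - b) := by
    intro v
    split_ifs <;> ring
  simp_rw [h1]
  rw [Finset.sum_add_distrib, ← Finset.sum_mul, ← Finset.sum_mul, h, ← Circuit.acceptProb]
  ring

section Block

variable {k d s : ℕ} (C : Circuit k 1) {Ψ : (ℕ → Bool) → ℂ}

/-- The hypothesis says that the wires of the block are still in state `0`, so `Ψ` is the product of
`|0…0⟩` on the block and an amplitude on the other wires. -/
theorem run_block (hΨ : ∀ z w, d ≤ w → w < d + k → z w = true → Ψ z = 0) :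
    run ((C.gates.map Gate.raw).map (shiftRaw d)) Ψ =
      fun z => C.state (window d k z) * Ψ (zeroed d k z) := by
  have h0 : Ψ = fun z => (Pi.single (fun _ => false) 1 : (Fin k → Bool) → ℂ) (window d k z) *
      Ψ (zeroed d k z) := by
    funext z
    by_cases h : window d k z = fun _ => false
    · have : zeroed d k z = z := by
        funext w
        unfold zeroed
        split_ifs with hw
        · have := congrFun h ⟨w - d, by omega⟩
          simp only [window] at this
          rw [← this]
          congr 1
          omega
        · rfl
      simp [h, this]
    · obtain ⟨i, hi⟩ : ∃ i, window d k z i ≠ false := by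
        by_contra! hc
        exact h (funext hc)
      rw [hΨ z (d + i) (by omega) (by omega) (by simpa [window] using hi)]
      simp [h]
  conv_lhs => rw [h0]
  rw [run_shift C.gates d _ (fun z => Ψ (zeroed d k z))]
  · rfl
  · intro z i b
    congr 1
    funext w
    unfold zeroed
    split_ifs with hw
    · rfl
    · rw [update_of_ne]
      omega

theorem act_run_block_eq_zero (hΨ : ∀ z w, d ≤ w → w < d + k → z w = true → Ψ z = 0) {w : ℕ}
    (hw : ¬(d ≤ w ∧ w < d + k)) (hs : w ≠ s) (h : ∀ z, z w = true → Ψ z = 0) (z : ℕ → Bool)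
    (hz : z w = true) :
    act (3, [d + C.out 0, s]) (run ((C.gates.map Gate.raw).map (shiftRaw d)) Ψ) z = 0 := by
  rw [run_block C hΨ, act_cnot]
  dsimp only
  rw [h (zeroed _ _ _), mul_zero]
  simp [zeroed, hw, hs, hz]

/-- The CNOT records the answer of `C` on wire `s`. A function that ignores the block only sees the
distribution of this answer: the wire is flipped with the probability that `C` accepts. -/
theorem measured_block {m : ℕ} (hΨ : ∀ z w, d ≤ w → w < d + k → z w = true → Ψ z = 0)
    (hm : d + k ≤ m) (hsm : s < m) (hs : ¬(d ≤ s ∧ s < d + k)) (F : (ℕ → Bool) → ℝ)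
    (hF : DependsOn F {w | ¬(d ≤ w ∧ w < d + k)}) :
    measured m (act (3, [d + C.out 0, s]) (run ((C.gates.map Gate.raw).map (shiftRaw d)) Ψ)) F =
      (1 - C.acceptProb) * measured m Ψ F +
        C.acceptProb * measured m Ψ fun z => F (update z s (!z s)) := by
  rw [act_cnot, measured_flip hsm (fun z => z (d + C.out 0)) _ _ _]
  swap
  · intro z b
    rw [update_of_ne]
    omega
  have hG : ∀ G : (ℕ → Bool) → ℝ, measured m Ψ G =
      ∑ x : Fin m → Bool, if window d k (ext x) = (fun _ => false) then
        ‖Ψ (zeroed d k (ext x))‖ ^ 2 * G (ext x) else 0 := by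
    intro G
    refine Finset.sum_congr rfl fun x _ => ?_
    split_ifs with h
    · congr 4
      funext w
      unfold zeroed
      split_ifs with hw
      · have := congrFun h ⟨w - d, by omega⟩
        simp only [window] at this
        rw [← this]
        congr 1
        omega
      · rfl
    · obtain ⟨i, hi⟩ : ∃ i, window d k (ext x) i ≠ false := by
        by_contra! hc
        exact h (funext hc)
      rw [hΨ _ (d + i) (by omega) (by omega) (by simpa [window] using hi)]
      simp
  have hZ : ∀ G : (ℕ → Bool) → ℝ, DependsOn G {w | ¬(d ≤ w ∧ w < d + k)} →
      DependsOn (fun z => ‖Ψ (zeroed d k z)‖ ^ 2 * G z) {w | ¬(d ≤ w ∧ w < d + k)} := by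
    intro G hGd z z' hzz
    have : zeroed d k z = zeroed d k z' := by
      funext w
      unfold zeroed
      split_ifs with hw
      · rfl
      · exact hzz w hw
    simp only [this, hGd hzz]
  have hF' : DependsOn (fun z => F (update z s (!z s))) {w | ¬(d ≤ w ∧ w < d + k)} := by
    intro z z' hzz
    refine hF fun w hw => ?_
    by_cases h : w = s
    · subst h; simp [hzz w hw]
    · simp [h, hzz w hw]
  rw [hG F, hG, run_block C hΨ]
  -- The indicators of acceptance and of rejection as weights on the window give the coefficients
  -- `acceptProb` and `1 - acceptProb`.
  have h1 := sum_window hm (fun v => ‖C.state v‖ ^ 2 * if v (C.out 0) = true then 1 else 0) _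
    (hZ _ hF')
  have h2 := sum_window hm (fun v => ‖C.state v‖ ^ 2 * if v (C.out 0) = true then 0 else 1) _
    (hZ _ hF)
  rw [sum_ite_acceptProb] at h1 h2
  simp only [mul_zero, mul_one, zero_add, add_zero] at h1 h2
  rw [← h1, ← h2, ← Finset.sum_add_distrib]
  refine Finset.sum_congr rfl fun x _ => ?_
  have hw : window d k (ext x) (C.out 0) = ext x (d + C.out 0) := rfl
  rw [hw, norm_mul, mul_pow]
  dsimp only
  generalize ext x (d + C.out 0) = b
  cases b <;> simp [mul_assoc]

end Block

end QEA

namespace QEA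

open Function StackProg

/-! ### Independent trials and NAND trees -/

/-- The expectation of `G y` when `y 0, …, y (j - 1)` are independent bits, each of which is `true`
with probability `p`, and `y` agrees with `y₀` from `j` on. -/
def trials (p : ℝ) (y₀ : ℕ → Bool) : ℕ → ((ℕ → Bool) → ℝ) → ℝ
  | 0, G => G y₀
  | j + 1, G => (1 - p) * trials p y₀ j (fun y => G (update y j false)) +
      p * trials p y₀ j (fun y => G (update y j true))

theorem trials_congr {p : ℝ} {y₀ : ℕ → Bool} {j : ℕ} {G G' : (ℕ → Bool) → ℝ}
    (h : ∀ y, (∀ i, j ≤ i → y i = y₀ i) → G y = G' y) : trials p y₀ j G = trials p y₀ j G' := by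
  induction j generalizing G G' with
  | zero => exact h y₀ fun _ _ => rfl
  | succ j ih =>
    have h1 : ∀ b y, (∀ i, j ≤ i → y i = y₀ i) → G (update y j b) = G' (update y j b) := by
      intro b y hy
      refine h _ fun i hi => ?_
      rw [update_of_ne (by omega)]
      exact hy i (by omega)
    rw [trials, trials, ih (h1 false), ih (h1 true)]

theorem trials_affine (p : ℝ) (y₀ : ℕ → Bool) (j : ℕ) (a b : ℝ) (G : (ℕ → Bool) → ℝ) :
    trials p y₀ j (fun y => a + b * G y) = a + b * trials p y₀ j G := by
  induction j generalizing G with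
  | zero => rfl
  | succ j ih => rw [trials, trials, ih, ih]; ring

theorem trials_const (p : ℝ) (y₀ : ℕ → Bool) (j : ℕ) (a : ℝ) :
    trials p y₀ j (fun _ => a) = a := by
  simpa using trials_affine p y₀ j a 0 fun _ => 0

/-- The negated conjunctions of consecutive pairs of bits. -/
def pairs (y : ℕ → Bool) (i : ℕ) : Bool := !(y (2 * i) && y (2 * i + 1))

/-- Disjoint pairs of independent bits have independent NANDs, each `true` with probability `1 - p ^
2`. This is what makes the recursion of `nandProb` exact. -/
theorem trials_pairs (p : ℝ) (y₀ : ℕ → Bool) (T : ℕ) (F : (ℕ → Bool) → ℝ) :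
    trials p y₀ (2 * T) (fun y => F (pairs y)) = trials (1 - p ^ 2) (pairs y₀) T F := by
  induction T generalizing F with
  | zero => rfl
  | succ T ih =>
    have h : ∀ y b b', pairs (update (update y (2 * T) b) (2 * T + 1) b') =
        update (pairs y) T (!(b && b')) := by
      intro y b b'
      funext i
      by_cases hi : i = T
      · subst hi; simp [pairs]
      · have h1 : 2 * i ≠ 2 * T := by omega
        have h2 : 2 * i ≠ 2 * T + 1 := by omega
        have h3 : 2 * i + 1 ≠ 2 * T := by omega
        simp [pairs, hi, h2, h3]
    rw [show 2 * (T + 1) = 2 * T + 1 + 1 by ring]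
    simp only [trials, h]
    have h0 := ih fun y => F (update y T false)
    have h1 := ih fun y => F (update y T true)
    simp only [Bool.and_false, Bool.and_true, Bool.not_false, Bool.not_true]
    rw [h0, h1]
    ring

/-- The value of the complete binary tree of NAND gates of depth `L` on the inputs `y`. -/
def nandTree : ℕ → (ℕ → Bool) → Bool
  | 0, y => y 0
  | L + 1, y => nandTree L (pairs y)

/-- The probability that the NAND tree of depth `L` evaluates to `true` when its inputs are
independent and `true` with probability `p`. -/
def nandProb : ℕ → ℝ → ℝ
  | 0, p => p
  | L + 1, p => nandProb L (1 - p ^ 2)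

theorem nandTree_congr {L : ℕ} {y y' : ℕ → Bool} (h : ∀ i < 2 ^ L, y i = y' i) :
    nandTree L y = nandTree L y' := by
  induction L generalizing y y' with
  | zero => exact h 0 (by simp)
  | succ L ih =>
    refine ih fun i hi => ?_
    rw [pow_succ] at h
    rw [pairs, pairs, h _ (by omega), h _ (by omega)]

theorem trials_nandTree (L : ℕ) (p : ℝ) (y₀ : ℕ → Bool) :
    trials p y₀ (2 ^ L) (fun y => if nandTree L y = true then 1 else 0) = nandProb L p := by
  induction L generalizing p y₀ with
  | zero => simp [trials, nandTree, nandProb]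
  | succ L ih =>
    rw [pow_succ, mul_comm, nandProb, ← ih (1 - p ^ 2) (pairs y₀), ← trials_pairs]
    rfl

/-- Dropping the `2 ^ (L + 1)` leaves of a heap of depth `L + 1` leaves a heap of depth `L` whose
leaves are the NANDs of consecutive pairs; the root is the last entry. -/
theorem nandTree_of_heap {L : ℕ} {h : ℕ → Bool}
    (hh : ∀ i < 2 ^ L - 1, h (2 ^ L + i) = !(h (2 * i) && h (2 * i + 1))) :
    h (2 * 2 ^ L - 2) = nandTree L h := by
  induction L generalizing h with
  | zero => rfl
  | succ L ih =>
    have hpos : 0 < 2 ^ L := by positivity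
    rw [pow_succ] at hh ⊢
    have h1 := @ih (fun i => h (2 ^ L * 2 + i)) fun i hi => by
      rw [← add_assoc, add_assoc, hh _ (by omega)]
      congr 3 <;> ring
    rw [show 2 * (2 ^ L * 2) - 2 = 2 ^ L * 2 + (2 * 2 ^ L - 2) by omega, h1, nandTree]
    exact nandTree_congr fun i hi => hh i (by omega)

/-! ### The repeated runs of a circuit -/

/-- The assignment with `y` on the `T` wires from `R` on and `false` elsewhere. -/
def leaves (R T : ℕ) (y : ℕ → Bool) (w : ℕ) : Bool := if R ≤ w ∧ w < R + T then y (w - R) else false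

theorem measured_zeroState (m : ℕ) (F : (ℕ → Bool) → ℝ) :
    measured m (zeroState m) F = F fun _ => false := by
  rw [measured, Finset.sum_eq_single fun _ => false]
  · have : ext (fun _ : Fin m => false) = fun _ => false := by
      funext i; simp [ext]
    rw [this]
    have h : window 0 m (fun _ => false) = fun _ => false := rfl
    simp [zeroState, h]
  · intro x _ hx
    simp [zeroState, window_zero_ext, hx]
  · simp

/-- The two claims form a joint invariant: that later blocks are still `0` is needed to run the next
copy, and the expectation then gains one more independent bit. Only functions of wires beyond all
blocks are considered, so used blocks may stay entangled. -/
theorem run_blocks {k n T m : ℕ} (C : Circuit k 1) (hk : k ≤ n) (hm : n * T + T ≤ m) {j : ℕ}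
    (hj : j ≤ T) :
    (∀ w, j * n ≤ w → w < n * T → ∀ z, z w = true →
      run ((List.range j).flatMap (blockGates (C.gates.map Gate.raw) n (C.out 0) (n * T)))
        (zeroState m) z = 0) ∧
    ∀ F, DependsOn F {w | n * T ≤ w} →
      measured m
        (run ((List.range j).flatMap (blockGates (C.gates.map Gate.raw) n (C.out 0) (n * T)))
          (zeroState m)) F =
      trials C.acceptProb (fun _ => false) j fun y => F (leaves (n * T) T y) := by
  induction j with
  | zero =>
    constructor
    · intro w _ hw z hz
      simp only [List.range_zero, List.flatMap_nil, run, List.foldl_nil, zeroState]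
      rw [if_neg]
      intro h
      have := congrFun h ⟨w, by omega⟩
      simp [window, hz] at this
    · intro F _
      simp only [List.range_zero, List.flatMap_nil, run, List.foldl_nil, trials]
      rw [measured_zeroState]
      congr 1
      funext w
      simp [leaves]
  | succ j ih =>
    obtain ⟨ih1, ih2⟩ := ih (by omega)
    have hjn : (j + 1) * n ≤ n * T := by rw [mul_comm]; exact Nat.mul_le_mul_left _ hj
    have hjn' : (j + 1) * n = j * n + n := by ring
    set Ψ := run ((List.range j).flatMap (blockGates (C.gates.map Gate.raw) n (C.out 0) (n * T)))
      (zeroState m) with hΨ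
    have hstep : run ((List.range (j + 1)).flatMap
        (blockGates (C.gates.map Gate.raw) n (C.out 0) (n * T))) (zeroState m) =
        act (3, [j * n + C.out 0, n * T + j])
          (run ((C.gates.map Gate.raw).map (shiftRaw (j * n))) Ψ) := by
      rw [List.range_succ, List.flatMap_append, run_append, ← hΨ, List.flatMap_singleton,
        blockGates, run_append]
      rfl
    have hvan : ∀ z w, j * n ≤ w → w < j * n + k → z w = true → Ψ z = 0 :=
      fun z w h1 h2 hz => ih1 w h1 (by omega) z hz
    rw [hstep]
    constructor
    · intro w hw1 hw2 z hz
      exact act_run_block_eq_zero C hvan (by omega) (by omega)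
        (fun z hz => ih1 w (by omega) hw2 z hz) z hz
    · intro F hF
      have hF' : DependsOn (fun z => F (update z (n * T + j) (!z (n * T + j))))
          {w | n * T ≤ w} := by
        intro z z' hzz
        refine hF fun w hw => ?_
        by_cases h : w = n * T + j
        · subst h; simp [hzz _ hw]
        · simp [h, hzz w hw]
      rw [measured_block C hvan (by omega) (by omega) (by omega) F
        fun z z' hzz => hF fun w hw => hzz w (by
          simp only [Set.mem_ofPred_eq] at hw ⊢
          omega), ih2 F hF, ih2 _ hF', trials]
      congr 2
      -- Leaf `j` is still `false` before round `j`, so leaving it alone or flipping it amounts to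
      -- setting it to `false` or `true`.
      · refine trials_congr fun y hy => ?_
        rw [show update y j false = y by rw [← hy j le_rfl, update_eq_self]]
      · refine trials_congr fun y hy => ?_
        congr 1
        funext w
        by_cases h : w = n * T + j
        · subst h
          have h1 := hy j le_rfl
          have h2 : n * T + j < n * T + T := by omega
          simp [leaves, h2, h1]
        · by_cases h' : n * T ≤ w ∧ w < n * T + T
          · have : w - n * T ≠ j := by omega
            simp [leaves, h, h', this]
          · simp [leaves, h, h']

/-! ### The evaluation of the NAND tree -/

/-- The effect of a NAND gate with target `B + i`. -/
def node (A B i : ℕ) (z : ℕ → Bool) : ℕ → Bool :=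
  update z (B + i) (xor (!z (B + i)) (z (A + 2 * i) && z (A + 2 * i + 1)))

/-- The effect of the first `j` NAND gates. -/
def evalTree (A B : ℕ) : ℕ → (ℕ → Bool) → ℕ → Bool
  | 0, z => z
  | j + 1, z => node A B j (evalTree A B j z)

/-- X followed by Toffoli computes a NAND on a target that is initially `false`. The hypothesis `hA`
keeps the inputs of each gate off its own target. -/
theorem measured_nodes {m A B j : ℕ} (hA : ∀ i < j, A + 2 * i + 1 < B + i) (hm : B + j ≤ m)
    (Ψ : (ℕ → Bool) → ℂ) (F : (ℕ → Bool) → ℝ) :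
    measured m (run ((List.range j).flatMap (nodeGates A B)) Ψ) F =
      measured m Ψ fun z => F (evalTree A B j z) := by
  induction j generalizing F with
  | zero => rfl
  | succ j ih =>
    have hj := hA j (by omega)
    rw [List.range_succ, List.flatMap_append, run_append, List.flatMap_singleton, nodeGates,
      run_cons, run_cons, act_x, act_toffoli]
    change measured m (fun _ => _) F = _
    rw [run, List.foldl_nil, measured_flip (by omega)
      (fun z => z (A + 2 * j) && z (A + 2 * j + 1)) _
        (fun z => run ((List.range j).flatMap (nodeGates A B)) Ψ (update z (B + j) !z (B + j)))]
    · have := measured_flip (m := m) (t := B + j) (by omega) (fun _ => true) (by simp)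
        (run ((List.range j).flatMap (nodeGates A B)) Ψ)
      simp only [Bool.bne_true] at this
      rw [this, ih (fun i hi => hA i (by omega)) (by omega)]
      congr 1
      funext z
      congr 1
      have h1 : A + 2 * j ≠ B + j := by omega
      have h2 : A + 2 * j + 1 ≠ B + j := by omega
      simp [evalTree, node, h1, h2]
    · intro z b
      rw [update_of_ne (by omega), update_of_ne (by omega)]

theorem evalTree_of_lt {A B j w : ℕ} (z : ℕ → Bool) (hw : ¬(B ≤ w ∧ w < B + j)) :
    evalTree A B j z w = z w := by
  induction j with
  | zero => rfl
  | succ j ih =>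
    rw [evalTree, node, update_of_ne (by omega), ih (by omega)]

/-- A node is computed from wires before its target, and later gates write only beyond it; neither
the node nor its inputs change afterwards. -/
theorem evalTree_node {A B j i : ℕ} (hA : ∀ i < j, A + 2 * i + 1 < B + i) (hi : i < j)
    (z : ℕ → Bool) (hz : ∀ i, z (B + i) = false) :
    evalTree A B j z (B + i) =
      !(evalTree A B j z (A + 2 * i) && evalTree A B j z (A + 2 * i + 1)) := by
  induction j with
  | zero => omega
  | succ j ih =>
    have h0 := hA i hi
    have h1 : A + 2 * i ≠ B + j := by omega
    have h2 : A + 2 * i + 1 ≠ B + j := by omega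
    by_cases hij : i = j
    · subst hij
      rw [evalTree, node, update_self, update_of_ne h1, update_of_ne h2,
        evalTree_of_lt z (w := B + i) (by omega), hz]
      simp
    · rw [evalTree, node, update_of_ne (by omega), update_of_ne h1, update_of_ne h2]
      exact ih (fun i hi => hA i (by omega)) (by omega)

theorem evalTree_congr {A B j : ℕ} {z z' : ℕ → Bool} (h : ∀ w, A ≤ w → z w = z' w)
    {w : ℕ} (hw : A ≤ w) : evalTree A B j z w = evalTree A B j z' w := by
  induction j generalizing w with
  | zero => exact h w hw
  | succ j ih =>
    rw [evalTree, evalTree, node, node]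
    by_cases h : w = B + j
    · subst h
      rw [update_self, update_self, ih (by omega), ih (by omega), ih (by omega)]
    · rw [update_of_ne h, update_of_ne h, ih hw]

/-! ### The coin -/

/-- The effect of a Toffoli gate. -/
def toffoli (a c b : ℕ) (z : ℕ → Bool) : ℕ → Bool := update z b (xor (z b) (z a && z c))

/-- Since `Ψ` vanishes where wire `c` is `1`, the Hadamard gate gives both values of `c` half of the
squared amplitude at `c = 0`. Pairing `x` with its flip at `c` turns this into an average over the
two values. -/
theorem measured_coin {m a c b : ℕ} (ha : a ≠ b) (hc : c ≠ b) (hcm : c < m) (hb : b < m)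
    {Ψ : (ℕ → Bool) → ℂ} (hΨ : ∀ x : Fin m → Bool, x ⟨c, hcm⟩ = true → Ψ (ext x) = 0)
    (F : (ℕ → Bool) → ℝ) :
    measured m (run [(1, [c]), (4, [a, c, b])] Ψ) F = measured m Ψ fun z =>
      (F (toffoli a c b (update z c false)) + F (toffoli a c b (update z c true))) / 2 := by
  rw [run_cons, run_cons, act_toffoli, run, List.foldl_nil,
    measured_flip hb (fun z => z a && z c)
      (fun z b' => by rw [update_of_ne ha, update_of_ne hc])]
  change measured m _ (fun z => F (toffoli a c b z)) = _
  generalize hG : (fun z => F (toffoli a c b z)) = G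
  have hG' : ∀ z, F (toffoli a c b z) = G z := fun z => by rw [← hG]
  simp only [hG']
  have h2 : ∀ f : (Fin m → Bool) → ℝ, 2 * ∑ x, f x =
      ∑ x, (f x + f (update x ⟨c, hcm⟩ (!x ⟨c, hcm⟩))) := by
    intro f
    rw [Finset.sum_add_distrib, sum_flip, two_mul]
  have h3 : ‖(1 / (Real.sqrt 2 : ℂ))‖ ^ 2 = 1 / 2 := by
    rw [norm_div, norm_one, Complex.norm_real, div_pow, one_pow, Real.norm_eq_abs, sq_abs,
      Real.sq_sqrt (by norm_num)]
  have hact : ∀ x : Fin m → Bool, ‖act (1, [c]) Ψ (ext x)‖ ^ 2 =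
      1 / 2 * ‖Ψ (ext (update x ⟨c, hcm⟩ false))‖ ^ 2 := by
    intro x
    have h0 : Ψ (update (ext x) c true) = 0 := by
      have := hΨ (update x ⟨c, hcm⟩ true) (by simp)
      rwa [ext_update] at this
    have h1 : act (1, [c]) Ψ (ext x) = hadamard (ext x c) false * Ψ (update (ext x) c false) := by
      simp [act, h0]
    rw [h1, norm_mul, mul_pow, ext_update, ← h3]
    congr 3
    simp [hadamard]
  suffices h : 2 * measured m (act (1, [c]) Ψ) G =
      2 * measured m Ψ fun z => (G (update z c false) + G (update z c true)) / 2 by linarith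
  rw [measured, measured, h2, h2]
  refine Finset.sum_congr rfl fun x _ => ?_
  rw [hact, hact, update_idem]
  have h1 := hΨ (update x ⟨c, hcm⟩ true) (by simp)
  cases hx : x ⟨c, hcm⟩
  · have : update x ⟨c, hcm⟩ false = x := by rw [← hx, update_eq_self]
    have h4 : ext x = update (ext x) c false := by
      rw [← ext_update (i := ⟨c, hcm⟩), this]
    simp only [Bool.not_false, this, h1]
    rw [show update (ext x) c false = ext x from h4.symm,
      show ext (update x ⟨c, hcm⟩ true) = update (ext x) c true from ext_update _ _ _]
    simp
    ring
  · have : update x ⟨c, hcm⟩ true = x := by rw [← hx, update_eq_self]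
    have h4 : ext x = update (ext x) c true := by
      rw [← ext_update (i := ⟨c, hcm⟩), this]
    rw [this] at h1
    simp only [Bool.not_true, h1]
    rw [show ext (update x ⟨c, hcm⟩ false) = update (ext x) c false from ext_update _ _ _,
      show update (update (ext x) c false) c true = ext x by rw [update_idem, ← h4]]
    simp
    ring

end QEA

/-! ### The wires at the end of the generated circuit -/

namespace QEA

open Function StackProg

/-- The wires after a run of the generated circuit in which the measured bits are `y` and the coin
shows `b`. -/
def outcome (R T : ℕ) (y : ℕ → Bool) (b : Bool) : ℕ → Bool :=
  toffoli (R + 2 * (T - 1)) (R + T + (T - 1)) (R + T + (T - 1) + 1)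
    (update (evalTree R (R + T) (T - 1) (leaves R T y)) (R + T + (T - 1)) b)

theorem toffoli_congr {R a c b : ℕ} (ha : R ≤ a) (hc : R ≤ c) (hb : R ≤ b) {z z' : ℕ → Bool}
    (h : ∀ w, R ≤ w → z w = z' w) {w : ℕ} (hw : R ≤ w) :
    toffoli a c b z w = toffoli a c b z' w := by
  rw [toffoli, toffoli]
  by_cases hwb : w = b
  · rw [hwb, update_self, update_self, h a ha, h c hc, h b hb]
  · rw [update_of_ne hwb, update_of_ne hwb, h w hw]

theorem outcome_of_lt {R T w : ℕ} (hT : 0 < T) (y : ℕ → Bool) (b : Bool)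
    (hw : R + 2 * T < w) : outcome R T y b w = false := by
  rw [outcome, toffoli, update_of_ne (by omega), update_of_ne (by omega),
    evalTree_of_lt _ (by omega), leaves, if_neg (by omega)]

theorem outcome_coin {R T : ℕ} (y : ℕ → Bool) (b : Bool) :
    outcome R T y b (R + T + (T - 1)) = b := by
  rw [outcome, toffoli, update_of_ne (by omega), update_self]

theorem outcome_root {R T L : ℕ} (hT : T = 2 ^ L) (y : ℕ → Bool) (b : Bool) :
    outcome R T y b (R + 2 * (T - 1)) = nandTree L y := by
  have hpos : 0 < T := by rw [hT]; positivity
  rw [outcome, toffoli, update_of_ne (by omega), update_of_ne (by omega)]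
  have h := @nandTree_of_heap L (fun i => evalTree R (R + T) (T - 1) (leaves R T y) (R + i)) ?_
  · rw [show 2 * 2 ^ L - 2 = 2 * (T - 1) by omega] at h
    rw [h]
    refine nandTree_congr fun i hi => ?_
    rw [evalTree_of_lt _ (by omega), leaves, if_pos (by omega)]
    simp
  · intro i hi
    rw [← hT] at hi ⊢
    have := @evalTree_node R (R + T) (T - 1) i (fun i hi => by omega) hi (leaves R T y)
      (fun i => by rw [leaves, if_neg (by omega)])
    rw [← add_assoc, this, add_assoc R (2 * i) 1]

theorem outcome_target {R T : ℕ} (hT : 0 < T) (y : ℕ → Bool) (b : Bool) :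
    outcome R T y b (R + 2 * T) =
      (outcome R T y b (R + 2 * (T - 1)) && outcome R T y b (R + T + (T - 1))) := by
  have h : update (evalTree R (R + T) (T - 1) (leaves R T y)) (R + T + (T - 1)) b
      (R + T + (T - 1) + 1) = false := by
    rw [update_of_ne (by omega), evalTree_of_lt _ (by omega), leaves, if_neg (by omega)]
  rw [outcome, show R + 2 * T = R + T + (T - 1) + 1 by omega]
  generalize update (evalTree R (R + T) (T - 1) (leaves R T y)) (R + T + (T - 1)) b = z at h
  have h1 : R + 2 * (T - 1) ≠ R + T + (T - 1) + 1 := by omega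
  rw [toffoli, update_self, update_of_ne h1, update_of_ne (Nat.succ_ne_self _).symm, h,
    Bool.false_xor]

/-- Measuring the wires from `R` on is the same as drawing independent leaves and a fair coin and
evaluating classically; all quantum behaviour has been absorbed into `C.acceptProb`. -/
theorem measured_generatedGates {k n m : ℕ} (C : Circuit k 1) (hk : k ≤ n) (hn : 0 < n)
    (hm : n * n ^ 4 + 2 * n ^ 4 + 1 ≤ m) (F : (ℕ → Bool) → ℝ)
    (hF : DependsOn F {w | n * n ^ 4 ≤ w}) :
    measured m (run (generatedGates (C.gates.map Gate.raw) n (C.out 0)) (zeroState m)) F =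
      trials C.acceptProb (fun _ => false) (n ^ 4) fun y =>
        (F (outcome (n * n ^ 4) (n ^ 4) y false) + F (outcome (n * n ^ 4) (n ^ 4) y true)) / 2 := by
  have hT : 0 < n ^ 4 := by positivity
  unfold generatedGates
  set T := n ^ 4 with hTdef
  set R := n * T with hR
  have hblocks := (run_blocks C hk (m := m) (T := T) (by omega) le_rfl).2
  rw [run_append, run_append]
  set Ψ := run ((List.range T).flatMap (blockGates (C.gates.map Gate.raw) n (C.out 0) R))
    (zeroState m) with hΨ
  have hev : ∀ G : (ℕ → Bool) → ℝ, DependsOn G {w | R ≤ w} →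
      measured m (run ((List.range (T - 1)).flatMap (nodeGates R (R + T))) Ψ) G =
        trials C.acceptProb (fun _ => false) T fun y =>
          G (evalTree R (R + T) (T - 1) (leaves R T y)) := by
    intro G hG
    rw [measured_nodes (fun i hi => by omega) (by omega), hblocks]
    intro z z' hzz
    exact hG fun w hw => evalTree_congr (fun w hw => hzz w hw) hw
  -- The coin wire is untouched so far. The expectation of its indicator is `0`, and a vanishing sum
  -- of nonnegative terms forces each amplitude with this wire set to vanish.
  have hvan : ∀ x : Fin m → Bool, x ⟨R + T + (T - 1), by omega⟩ = true →
      run ((List.range (T - 1)).flatMap (nodeGates R (R + T))) Ψ (ext x) = 0 := by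
    have h := hev (fun z => if z (R + T + (T - 1)) = true then 1 else 0) fun z z' hzz => by
      dsimp only
      rw [hzz (R + T + (T - 1)) (by simp only [Set.mem_ofPred_eq]; omega)]
    have h0 : ∀ y, evalTree R (R + T) (T - 1) (leaves R T y) (R + T + (T - 1)) = false := by
      intro y
      rw [evalTree_of_lt _ (by omega), leaves, if_neg (by omega)]
    simp only [h0, Bool.false_eq_true, if_false, trials_const] at h
    intro x hx
    rw [measured, Finset.sum_eq_zero_iff_of_nonneg (fun x _ => by positivity)] at h
    have := h x (Finset.mem_univ _)
    have hx' : ext x (R + T + (T - 1)) = true := by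
      rw [ext, dif_pos (by omega), hx]
    simpa [hx'] using this
  rw [coinGates, measured_coin (by omega) (by omega) (by omega) (by omega) hvan, hev]
  · rfl
  · intro z z' hzz
    have : ∀ b, F (toffoli (R + 2 * (T - 1)) (R + T + (T - 1)) (R + T + (T - 1) + 1)
          (update z (R + T + (T - 1)) b)) =
        F (toffoli (R + 2 * (T - 1)) (R + T + (T - 1)) (R + T + (T - 1) + 1)
          (update z' (R + T + (T - 1)) b)) := by
      intro b
      have hu : ∀ w, R ≤ w → update z (R + T + (T - 1)) b w = update z' (R + T + (T - 1)) b w := by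
        intro w hw
        by_cases h : w = R + T + (T - 1)
        · subst h; simp
        · rw [update_of_ne h, update_of_ne h, hzz w hw]
      exact hF fun w hw => toffoli_congr (by omega) (by omega) (by omega) hu hw
    simp only [this]

/-! ### The generated circuit -/

theorem exists_gate_raw {m : ℕ} {r : ℕ × List ℕ} (h : ∃ g : Gate m, g.raw = r) {m' d : ℕ}
    (hd : d + m ≤ m') : ∃ g : Gate m', g.raw = shiftRaw d r := by
  obtain ⟨g, rfl⟩ := h
  let e : Fin m → Fin m' := fun i => ⟨d + i, by omega⟩
  have he : ∀ i j : Fin m, i ≠ j → e i ≠ e j := by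
    intro i j hij h
    apply hij
    have := congrArg Fin.val h
    simp only [e] at this
    exact Fin.ext (by omega)
  cases g with
  | X i => exact ⟨.X (e i), rfl⟩
  | H i => exact ⟨.H (e i), rfl⟩
  | T i => exact ⟨.T (e i), rfl⟩
  | CNOT c t h => exact ⟨.CNOT (e c) (e t) (he _ _ h), rfl⟩
  | Toffoli a b t hab hat hbt =>
    exact ⟨.Toffoli (e a) (e b) (e t) (he _ _ hab) (he _ _ hat) (he _ _ hbt), rfl⟩

theorem exists_gate_toffoli {m a b t : ℕ} (ha : a < m) (hb : b < m) (ht : t < m) (hab : a ≠ b)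
    (hat : a ≠ t) (hbt : b ≠ t) : ∃ g : Gate m, g.raw = (4, [a, b, t]) :=
  ⟨.Toffoli ⟨a, ha⟩ ⟨b, hb⟩ ⟨t, ht⟩ (by simpa using hab) (by simpa using hat) (by simpa using hbt),
    rfl⟩

theorem exists_gates_generated {k n m : ℕ} (C : Circuit k 1) (hk : k ≤ n) (hn : 0 < n)
    (hm : n * n ^ 4 + 2 * n ^ 4 + 1 ≤ m) : ∃ gs : List (Gate m),
      gs.map Gate.raw = generatedGates (C.gates.map Gate.raw) n (C.out 0) := by
  have hT : 0 < n ^ 4 := by positivity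
  suffices h : ∀ r ∈ generatedGates (C.gates.map Gate.raw) n (C.out 0), ∃ g : Gate m, g.raw = r by
    have := Set.range_list_map (Gate.raw : Gate m → _)
    have h' : generatedGates (C.gates.map Gate.raw) n (C.out 0) ∈
        Set.range (List.map (Gate.raw : Gate m → _)) := by
      rw [this]; exact h
    exact h'
  intro r hr
  unfold generatedGates at hr
  set T := n ^ 4 with hTdef
  simp only [List.mem_append, List.mem_flatMap, List.mem_range, blockGates, nodeGates, coinGates,
    List.mem_map, List.mem_cons, List.not_mem_nil, or_false] at hr
  rcases hr with ⟨j, hj, hr | rfl⟩ | ⟨i, hi, rfl | rfl⟩ | rfl | rfl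
  · have hjn : (j + 1) * n ≤ n * T := by rw [mul_comm]; exact Nat.mul_le_mul_left _ hj
    have hjn' : (j + 1) * n = j * n + n := by ring
    obtain ⟨_, ⟨g, _, rfl⟩, rfl⟩ := hr
    exact exists_gate_raw ⟨g, rfl⟩ (by omega)
  · have hjn : (j + 1) * n ≤ n * T := by rw [mul_comm]; exact Nat.mul_le_mul_left _ hj
    have hjn' : (j + 1) * n = j * n + n := by ring
    have := (C.out 0).2
    exact ⟨.CNOT ⟨j * n + C.out 0, by omega⟩ ⟨n * T + j, by omega⟩ (by simp; omega), rfl⟩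
  · exact ⟨.X ⟨n * T + T + i, by omega⟩, rfl⟩
  · exact exists_gate_toffoli (by omega) (by omega) (by omega) (by omega) (by omega) (by omega)
  · exact ⟨.H ⟨n * T + T + (T - 1), by omega⟩, rfl⟩
  · exact exists_gate_toffoli (by omega) (by omega) (by omega) (by omega) (by omega) (by omega)

/-- The string generated from the description of a circuit describes a circuit. -/
theorem exists_generated_circuit {k n m : ℕ} (C : Circuit k 1) (hk : k ≤ n) (hn : 0 < n)
    (hm : m = n * n ^ 4 + 2 * n ^ 4 + n) : ∃ Q : Circuit m n,
      Q.encode = generatedString (C.gates.map Gate.raw) n (C.out 0) ∧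
      Q.gates.map Gate.raw = generatedGates (C.gates.map Gate.raw) n (C.out 0) ∧
      ∀ i, (Q.out i : ℕ) = n * n ^ 4 + 2 * n ^ 4 + i := by
  obtain ⟨gs, hgs⟩ := exists_gates_generated C hk hn (m := m) (by omega)
  let Q : Circuit m n := ⟨gs, ⟨fun i => ⟨n * n ^ 4 + 2 * n ^ 4 + i, by omega⟩, fun i j h => by
    simpa [Fin.ext_iff] using h⟩⟩
  refine ⟨Q, ?_, hgs, fun i => rfl⟩
  have h1 : Q.gates.flatMap Gate.encode =
      (generatedGates (C.gates.map Gate.raw) n (C.out 0)).flatMap encodeRaw := by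
    rw [← hgs, List.flatMap_map]
    exact congrArg (fun f => gs.flatMap f) (funext Gate.encode_eq)
  have h2 : (List.ofFn fun i => encodeNat (Q.out i)).flatten =
      (List.range n).flatMap fun i => encodeNat (n * n ^ 4 + 2 * n ^ 4 + i) := by
    rw [List.flatMap, ← List.map_coe_finRange_eq_range, List.map_map, List.ofFn_eq_map]
    rfl
  rw [Circuit.encode, generatedString, h1, h2, ← hm]

end QEA

namespace QEA

open Function StackProg

/-! ### The output state of the generated circuit -/

/-- If the traced-out wires determine the whole basis state on the support, no two distinct basis
states contribute a common term, and all coherences vanish. -/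
theorem outputState_eq_diagonal {m n : ℕ} (Q : Circuit m n)
    (hQ : ∀ x y, Q.state x ≠ 0 → Q.state y ≠ 0 → (∀ j, (∀ i, Q.out i ≠ j) → x j = y j) → x = y) :
    Q.outputState = Matrix.diagonal fun a =>
      ((∑ x : Fin m → Bool, if ∀ i, x (Q.out i) = a i then ‖Q.state x‖ ^ 2 else 0 : ℝ) : ℂ) := by
  ext a b
  rw [Circuit.outputState, Matrix.of_apply, Matrix.diagonal_apply]
  have h0 : ∀ x y : Fin m → Bool, (if (∀ i, x (Q.out i) = a i) ∧ (∀ i, y (Q.out i) = b i) ∧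
        (∀ j, (∀ i, Q.out i ≠ j) → x j = y j)
      then Q.state x * star (Q.state y) else 0) =
      if x = y then (if (∀ i, x (Q.out i) = a i) ∧ a = b then ((‖Q.state x‖ ^ 2 : ℝ) : ℂ) else 0)
        else 0 := by
    intro x y
    by_cases hxy : x = y
    · subst hxy
      have : (∀ i, x (Q.out i) = a i) ∧ (∀ i, x (Q.out i) = b i) ∧
        (∀ j, (∀ i, Q.out i ≠ j) → x j = x j) ↔ (∀ i, x (Q.out i) = a i) ∧ a = b := by
        constructor
        · rintro ⟨h1, h2, _⟩
          exact ⟨h1, funext fun i => (h1 i).symm.trans (h2 i)⟩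
        · rintro ⟨h1, rfl⟩
          exact ⟨h1, h1, fun _ _ => rfl⟩
      rw [if_pos rfl]
      refine if_congr this ?_ rfl
      rw [← starRingEnd_apply, Complex.mul_conj, Complex.normSq_eq_norm_sq]
    · rw [if_neg hxy]
      split_ifs with h
      · by_contra hne
        exact hxy (hQ x y (fun h0 => hne (by simp [h0])) (fun h0 => hne (by simp [h0])) h.2.2)
      · rfl
  simp only [h0, Finset.sum_ite_eq, Finset.mem_univ, if_true]
  by_cases hab : a = b
  · subst hab
    rw [if_pos rfl, Complex.ofReal_sum]
    refine Finset.sum_congr rfl fun x _ => ?_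
    simp only [and_true]
    split_ifs <;> simp
  · simp [hab]

/-- Both multisets are the roots of the characteristic polynomial. The order of the eigenvalues is
irrelevant, since the entropies depend on the multiset only. -/
theorem map_eigenvalues_of_eq_diagonal {ι : Type*} [Fintype ι] [DecidableEq ι] {ρ : Matrix ι ι ℂ}
    (hρ : ρ.IsHermitian) {w : ι → ℝ} (h : ρ = Matrix.diagonal fun i => (w i : ℂ)) :
    Multiset.map hρ.eigenvalues Finset.univ.val = Multiset.map w Finset.univ.val := by
  have h1 := hρ.roots_charpoly_eq_eigenvalues
  have h2 : ρ.charpoly.roots = Multiset.map (fun i => (w i : ℂ)) Finset.univ.val := by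
    rw [h, Matrix.charpoly_diagonal]
    have := Polynomial.roots_multiset_prod_X_sub_C
      (Multiset.map (fun i => (w i : ℂ)) (Finset.univ : Finset ι).val)
    rw [Multiset.map_map] at this
    exact this
  rw [h2] at h1
  refine Multiset.map_injective Complex.ofReal_injective ?_
  rw [Multiset.map_map, Multiset.map_map]
  exact h1.symm

/-- The bit `s` followed by zeros. -/
def headBit (n : ℕ) (s : Bool) : Fin n → Bool := fun i => decide ((i : ℕ) = 0) && s

theorem headBit_ne {n : ℕ} (hn : 0 < n) : headBit n true ≠ headBit n false := by
  intro h
  simpa [headBit] using congrFun h ⟨0, hn⟩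

/-- The `α`-Rényi entropy of a bit that is `true` with probability `x`. -/
noncomputable def bitEntropy (α : ℝ≥0∞) (x : ℝ) : ℝ :=
  if α = 1 then -((1 - x) * Real.log (1 - x) + x * Real.log x)
  else if α = ⊤ then -Real.log (max (1 - x) x)
  else Real.log ((1 - x) ^ α.toReal + x ^ α.toReal) / (1 - α.toReal)

/-- The eigenvalues of the output state of the generated circuit. -/
noncomputable def bitWeights (n : ℕ) (x : ℝ) (a : Fin n → Bool) : ℝ :=
  if a = headBit n true then x else if a = headBit n false then 1 - x else 0

theorem sum_bitWeights {n : ℕ} (hn : 0 < n) (x : ℝ) (f : ℝ → ℝ) (hf : f 0 = 0) :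
    ∑ a, f (bitWeights n x a) = f (1 - x) + f x := by
  rw [Finset.sum_eq_add_of_mem _ _ (Finset.mem_univ (headBit n false))
    (Finset.mem_univ (headBit n true)) (headBit_ne hn).symm]
  · simp [bitWeights, (headBit_ne hn).symm]
  · rintro a _ ⟨h1, h2⟩
    simp [bitWeights, h1, h2, hf]

theorem iSup_bitWeights {n : ℕ} (hn : 0 < n) {x : ℝ} (h0 : 0 ≤ x) :
    ⨆ a, bitWeights n x a = max (1 - x) x := by
  have hfin : BddAbove (Set.range (bitWeights n x)) := (Set.finite_range _).bddAbove
  refine le_antisymm (ciSup_le fun a => ?_) (max_le ?_ ?_)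
  · unfold bitWeights
    split_ifs
    · exact le_max_right _ _
    · exact le_max_left _ _
    · exact h0.trans (le_max_right _ _)
  · refine le_of_eq_of_le ?_ (le_ciSup hfin (headBit n false))
    rw [bitWeights, if_neg (headBit_ne hn).symm, if_pos rfl]
  · refine le_of_eq_of_le ?_ (le_ciSup hfin (headBit n true))
    rw [bitWeights, if_pos rfl]

theorem entropy_eq_bitEntropy {m n : ℕ} (hn : 0 < n) (Q : Circuit m n) {x : ℝ} (h0 : 0 ≤ x)
    (hQ : Q.outputState = Matrix.diagonal fun a => (bitWeights n x a : ℂ)) {α : ℝ≥0∞}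
    (hα : 0 < α) : Q.entropy α = bitEntropy α x := by
  have hσ := map_eigenvalues_of_eq_diagonal Q.outputState_isHermitian hQ
  have hsum : ∀ f : ℝ → ℝ, f 0 = 0 →
      ∑ i, f (Q.outputState_isHermitian.eigenvalues i) = f (1 - x) + f x := by
    intro f hf
    rw [← sum_bitWeights hn x f hf]
    have := congrArg (fun s => (s.map f).sum) hσ
    simp only [Multiset.map_map] at this
    exact this
  unfold Circuit.entropy renyiEntropy bitEntropy
  split_ifs with h1 h2
  · rw [hsum (fun t => t * Real.log t) (by simp)]
  · rw [← iSup_bitWeights hn h0]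
    have hrange : Set.range Q.outputState_isHermitian.eigenvalues =
        Set.range (bitWeights n x) := by
      ext t
      simpa using congrArg (fun s => t ∈ s) hσ
    rw [iSup, iSup, hrange]
  · rw [hsum (fun t => t ^ α.toReal) (Real.zero_rpow (ENNReal.toReal_pos hα.ne' h2).ne')]

theorem rank_le_two {m n : ℕ} (Q : Circuit m n) {x : ℝ}
    (hQ : Q.outputState = Matrix.diagonal fun a => (bitWeights n x a : ℂ)) :
    Q.outputState.rank ≤ 2 := by
  classical
  rw [hQ, Matrix.rank_diagonal, Fintype.card_subtype]
  refine (Finset.card_le_card (t := {headBit n true, headBit n false}) ?_).trans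
    Finset.card_le_two
  intro a ha
  simp only [Finset.mem_filter, Finset.mem_univ, true_and] at ha
  simp only [Finset.mem_insert, Finset.mem_singleton]
  by_contra! h
  exact ha (by simp [bitWeights, h.1, h.2])

theorem outputState_generated {k n m L : ℕ} (C : Circuit k 1) (hk : k ≤ n) (hn : 0 < n)
    (hL : n ^ 4 = 2 ^ L) (hm : m = n * n ^ 4 + 2 * n ^ 4 + n) (Q : Circuit m n)
    (hgates : Q.gates.map Gate.raw = generatedGates (C.gates.map Gate.raw) n (C.out 0))
    (hout : ∀ i, (Q.out i : ℕ) = n * n ^ 4 + 2 * n ^ 4 + i) :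
    Q.outputState =
      Matrix.diagonal fun a => (bitWeights n (nandProb L C.acceptProb / 2) a : ℂ) := by
  have hT : 0 < n ^ 4 := by positivity
  have hmeas := measured_generatedGates C hk hn (m := m) (by omega)
  set T := n ^ 4 with hTdef
  set R := n * T with hR
  have hstate : ∀ x, Q.state x = run (generatedGates (C.gates.map Gate.raw) n (C.out 0))
      (zeroState m) (ext x) := fun x => by rw [state_eq_run, hgates]
  set Ψ := run (generatedGates (C.gates.map Gate.raw) n (C.out 0)) (zeroState m) with hΨ
  have hext : ∀ (x : Fin m → Bool) i, ext x (R + 2 * T + (i : Fin n)) = x (Q.out i) := by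
    intro x i
    have : R + 2 * T + (i : ℕ) < m := by omega
    rw [ext, dif_pos this]
    congr 1
    exact Fin.ext (hout i).symm
  have hroot : R + 2 * (T - 1) < m := by omega
  have hcoin : R + T + (T - 1) < m := by omega
  -- The event that the output wires differ from the AND of root and coin has probability `0`, so it
  -- contains no basis state of the support.
  have hsupp : ∀ x, Q.state x ≠ 0 → ∀ i, x (Q.out i) =
      headBit n (x ⟨R + 2 * (T - 1), hroot⟩ && x ⟨R + T + (T - 1), hcoin⟩) i := by
    classical
    let P : (ℕ → Bool) → Prop := fun z => ∀ i : Fin n, z (R + 2 * T + i) =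
      headBit n (z (R + 2 * (T - 1)) && z (R + T + (T - 1))) i
    have hP : ∀ y b, P (outcome R T y b) := by
      intro y b i
      by_cases hi : (i : ℕ) = 0
      · simpa [headBit, hi] using outcome_target hT y b
      · simpa [headBit, hi] using outcome_of_lt hT y b (by omega)
    have h := hmeas (fun z => if P z then 0 else 1) fun z z' hzz => by
      have : P z ↔ P z' := by
        have h0 : ∀ w, R ≤ w → z w = z' w := hzz
        refine forall_congr' fun i => ?_
        rw [h0 _ (by omega), h0 (R + 2 * (T - 1)) (by omega), h0 (R + T + (T - 1)) (by omega)]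
      simp only [this]
    simp only [hP, if_true, add_zero, zero_div, trials_const] at h
    rw [measured, Finset.sum_eq_zero_iff_of_nonneg (fun x _ => by positivity)] at h
    intro x hx
    have h1 := h x (Finset.mem_univ _)
    rw [hstate] at hx
    have h2 : P (ext x) := by
      by_contra h2
      simp [h2, hx] at h1
    intro i
    have h3 := h2 i
    rw [hext] at h3
    rw [h3, ext, ext, dif_pos hroot, dif_pos hcoin]
  rw [outputState_eq_diagonal]
  · congr 1
    funext a
    congr 1
    have hF : DependsOn (fun z : ℕ → Bool => if ∀ i : Fin n, z (R + 2 * T + i) = a i then (1 : ℝ)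
        else 0) {w | R ≤ w} := by
      intro z z' hzz
      have h0 : ∀ w, R ≤ w → z w = z' w := hzz
      have : (∀ i : Fin n, z (R + 2 * T + i) = a i) ↔ ∀ i : Fin n, z' (R + 2 * T + i) = a i :=
        forall_congr' fun i => by rw [h0 _ (by omega)]
      simp only [this]
    have h := hmeas _ hF
    have hsum : measured m Ψ (fun z => if ∀ i : Fin n, z (R + 2 * T + i) = a i then 1 else 0) =
        ∑ x : Fin m → Bool, if ∀ i, x (Q.out i) = a i then ‖Q.state x‖ ^ 2 else 0 := by
      refine Finset.sum_congr rfl fun x _ => ?_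
      simp only [hext, hstate]
      split_ifs <;> simp
    rw [← hsum, h]
    have hval : ∀ y b, (∀ i : Fin n, outcome R T y b (R + 2 * T + i) = a i) ↔
        a = headBit n (nandTree L y && b) := by
      intro y b
      have : ∀ i : Fin n, outcome R T y b (R + 2 * T + i) = headBit n (nandTree L y && b) i := by
        intro i
        by_cases hi : (i : ℕ) = 0
        · simpa [headBit, hi, outcome_root hL, outcome_coin] using outcome_target hT y b
        · simpa [headBit, hi] using outcome_of_lt hT y b (by omega)
      simp only [this]
      exact ⟨fun h => (funext h).symm, fun h i => by rw [h]⟩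
    -- Averaging over the coin leaves an affine function of the value of the tree, whose expectation
    -- `trials_affine` and `trials_nandTree` evaluate.
    have hfun : ∀ y, (((if ∀ i : Fin n, outcome R T y false (R + 2 * T + i) = a i then (1 : ℝ)
        else 0) + if ∀ i : Fin n, outcome R T y true (R + 2 * T + i) = a i then 1 else 0) / 2) =
        (if a = headBit n false then 1 else 0) +
        (((if a = headBit n true then 1 else 0) - if a = headBit n false then 1 else 0) / 2) *
          if nandTree L y = true then 1 else 0 := by
      intro y
      simp only [hval, Bool.and_false, Bool.and_true]
      cases nandTree L y
      · simp
      · simp only [if_true]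
        ring
    simp only [hfun]
    rw [trials_affine, hL, trials_nandTree, bitWeights]
    by_cases h1 : a = headBit n true
    · subst h1
      simp [headBit_ne hn]
      ring
    · by_cases h2 : a = headBit n false
      · subst h2
        simp [(headBit_ne hn).symm]
        ring
      · simp [h1, h2]
  · intro x y hx hy hxy
    have h1 : ∀ w : Fin m, (w : ℕ) < R + 2 * T → x w = y w := by
      intro w hw
      refine hxy w fun i hi => ?_
      have := hout i
      rw [hi] at this
      omega
    funext j
    by_cases hj : ∃ i, Q.out i = j
    · obtain ⟨i, rfl⟩ := hj
      rw [hsupp x hx, hsupp y hy, h1 _ (by simp only; omega), h1 _ (by simp only; omega)]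
    · exact hxy j fun i hi => hj ⟨i, hi⟩

theorem acceptProb_mem_Icc {k : ℕ} (C : Circuit k 1) : C.acceptProb ∈ Set.Icc (0 : ℝ) 1 := by
  constructor
  · exact Finset.sum_nonneg fun x _ => by split_ifs <;> positivity
  · rw [← sum_norm_sq_state C]
    refine Finset.sum_le_sum fun x _ => ?_
    split_ifs
    · exact le_rfl
    · positivity

theorem nandProb_mem_Icc (L : ℕ) {p : ℝ} (hp : p ∈ Set.Icc (0 : ℝ) 1) :
    nandProb L p ∈ Set.Icc (0 : ℝ) 1 := by
  induction L generalizing p with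
  | zero => exact hp
  | succ L ih =>
    obtain ⟨h0, h1⟩ := hp
    exact ih ⟨by nlinarith, by nlinarith⟩

end QEA

namespace QEA

open Filter Topology

/-! ### Amplification by NAND trees -/

theorem one_sub_sq_mem_Icc {p : ℝ} (hp : p ∈ Set.Icc (0 : ℝ) 1) :
    1 - p ^ 2 ∈ Set.Icc (0 : ℝ) 1 := nandProb_mem_Icc 1 hp

/-- Two levels send `p` to `1 - (1 - p ^ 2) ^ 2 ≤ 2 * p ^ 2`, so `2 * p` is at least squared
downwards. -/
theorem two_mul_nandProb_le (j : ℕ) {p c : ℝ} (hp : p ∈ Set.Icc (0 : ℝ) 1) (hc : 2 * p ≤ c) :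
    2 * nandProb (2 * j) p ≤ c ^ 2 ^ j := by
  induction j generalizing p c with
  | zero => simpa [nandProb] using hc
  | succ j ih =>
    have h := ih (one_sub_sq_mem_Icc (one_sub_sq_mem_Icc hp)) (c := c ^ 2)
      (by nlinarith [hp.1, sq_nonneg (p ^ 2)])
    rw [← pow_mul, ← pow_succ'] at h
    exact h

/-- Two levels send `1 - p` to `(1 - p ^ 2) ^ 2 ≤ (2 * (1 - p)) ^ 2`, so `4 * (1 - p)` drops to at
most its square. -/
theorem four_mul_one_sub_nandProb_le (j : ℕ) {p c : ℝ} (hp : p ∈ Set.Icc (0 : ℝ) 1)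
    (hc : 4 * (1 - p) ≤ c) : 4 * (1 - nandProb (2 * j) p) ≤ c ^ 2 ^ j := by
  induction j generalizing p c with
  | zero => simpa [nandProb] using hc
  | succ j ih =>
    have h := ih (one_sub_sq_mem_Icc (one_sub_sq_mem_Icc hp)) (c := c ^ 2) (by
      have h1 : 1 - p ^ 2 ≤ 2 * (1 - p) := by nlinarith [sq_nonneg (1 - p)]
      have h2 := (one_sub_sq_mem_Icc hp).1
      have h3 : (1 - p ^ 2) ^ 2 ≤ (2 * (1 - p)) ^ 2 := pow_le_pow_left₀ h2 h1 2
      have h4 : (4 * (1 - p)) ^ 2 ≤ c ^ 2 := pow_le_pow_left₀ (by linarith [hp.2]) hc 2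
      nlinarith)
    rw [← pow_mul, ← pow_succ'] at h
    exact h

theorem nandProb_le {l : ℕ} (hl : 8 ≤ l) {p : ℝ} (h0 : 0 ≤ p) (h1 : p ≤ 1 / 3) :
    nandProb (4 * l) p ≤ (1 / 16) ^ 2 ^ l := by
  have h := two_mul_nandProb_le (2 * l) (p := p) (c := 2 / 3) ⟨h0, by linarith⟩ (by linarith)
  have hb := (nandProb_mem_Icc (4 * l) (p := p) ⟨h0, by linarith⟩).1
  rw [← mul_assoc] at h
  have h2 : ((2 : ℝ) / 3) ^ 2 ^ (2 * l) ≤ (1 / 16) ^ 2 ^ l := by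
    rw [two_mul, pow_add, pow_mul]
    refine pow_le_pow_left₀ (by positivity) ?_ _
    calc ((2 : ℝ) / 3) ^ 2 ^ l ≤ (2 / 3) ^ 2 ^ 8 :=
          pow_le_pow_of_le_one (by norm_num) (by norm_num) (Nat.pow_le_pow_right (by norm_num) hl)
      _ ≤ (2 / 3) ^ 7 := pow_le_pow_of_le_one (by norm_num) (by norm_num) (by norm_num)
      _ ≤ 1 / 16 := by norm_num
  norm_num at h
  linarith

theorem le_nandProb {l : ℕ} (hl : 8 ≤ l) {p : ℝ} (h0 : 2 / 3 ≤ p) (h1 : p ≤ 1) :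
    1 - (1 / 16) ^ 2 ^ l ≤ nandProb (4 * l) p := by
  have hstep : ∀ {p b b' : ℝ}, p ∈ Set.Icc (0 : ℝ) 1 → 0 ≤ b → b ≤ p →
      1 - (1 - b ^ 2) ^ 2 ≥ b' → b' ≤ 1 - (1 - p ^ 2) ^ 2 := by
    intro p b b' hp hb hbp hb'
    have h2 : 1 - p ^ 2 ≤ 1 - b ^ 2 := by nlinarith
    have h3 := pow_le_pow_left₀ (one_sub_sq_mem_Icc hp).1 h2 2
    linarith
  have hp0 : p ∈ Set.Icc (0 : ℝ) 1 := ⟨by linarith, h1⟩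
  have hp1 := one_sub_sq_mem_Icc (one_sub_sq_mem_Icc hp0)
  have hp2 := one_sub_sq_mem_Icc (one_sub_sq_mem_Icc hp1)
  have hp3 := one_sub_sq_mem_Icc (one_sub_sq_mem_Icc hp2)
  -- At `p = 2/3` the quantity `4 * (1 - p)` exceeds 1 and squaring does not help yet. Three double
  -- levels lift `p` above 0.775, where it is at most 9/10.
  have hb1 := hstep (b' := 0.691) hp0 (by norm_num) h0 (by norm_num)
  have hb2 := hstep (b' := 0.726) hp1 (by norm_num) hb1 (by norm_num)
  have hb3 := hstep (b' := 0.775) hp2 (by norm_num) hb2 (by norm_num)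
  obtain ⟨j, rfl⟩ : ∃ j, l = j + 3 := ⟨l - 3, by omega⟩
  have h := four_mul_one_sub_nandProb_le (2 * j + 3) (c := 9 / 10) hp3
    (by norm_num at hb3 ⊢; linarith)
  have he : nandProb (4 * (j + 3)) p = nandProb (2 * (2 * j + 3)) (1 - (1 - (1 - (1 - (1 -
      (1 - p ^ 2) ^ 2) ^ 2) ^ 2) ^ 2) ^ 2) := by
    rw [show 4 * (j + 3) = 2 * (2 * j + 3) + 1 + 1 + 1 + 1 + 1 + 1 by ring]
    rfl
  rw [← he] at h
  -- Six of the `4 * l` levels are spent. The remaining exponent `2 ^ (2 * j + 3)` is the product of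
  -- `2 ^ j ≥ 32` and `2 ^ l`, and `(9 / 10) ^ 32 < 1 / 16`.
  have h2 : ((9 : ℝ) / 10) ^ 2 ^ (2 * j + 3) ≤ (1 / 16) ^ 2 ^ (j + 3) := by
    rw [show 2 * j + 3 = j + (j + 3) by ring, pow_add, pow_mul]
    refine pow_le_pow_left₀ (by positivity) ?_ _
    calc ((9 : ℝ) / 10) ^ 2 ^ j ≤ (9 / 10) ^ 2 ^ 5 :=
          pow_le_pow_of_le_one (by norm_num) (by norm_num)
            (Nat.pow_le_pow_right (by norm_num) (by omega))
      _ ≤ 1 / 16 := by norm_num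
  have h3 : (0 : ℝ) ≤ (1 / 16) ^ 2 ^ (j + 3) := by positivity
  linarith

/-! ### Thresholds and gaps -/

theorem half_pow_le {n k : ℕ} (h : k ≤ n) : ((1 : ℝ) / 2) ^ n ≤ (1 / 2) ^ k :=
  pow_le_pow_of_le_one (by norm_num) (by norm_num) h

theorem half_pow_two_mul (n : ℕ) : ((1 : ℝ) / 2) ^ (2 * n) = ((1 / 2) ^ n) ^ 2 := by
  rw [mul_comm, pow_mul]

theorem half_pow_two_mul_add_one (n : ℕ) :
    ((1 : ℝ) / 2) ^ (2 * n + 1) = ((1 / 2) ^ n) ^ 2 / 2 := by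
  rw [pow_succ, half_pow_two_mul]; ring

theorem neg_log_one_sub_le {x : ℝ} (hx : x < 1) : -Real.log (1 - x) ≤ x / (1 - x) := by
  have h := Real.one_sub_inv_le_log_of_pos (x := 1 - x) (by linarith)
  have : 1 - (1 - x)⁻¹ = -(x / (1 - x)) := by
    have : 1 - x ≠ 0 := by linarith
    field_simp
    ring
  linarith

theorem le_neg_log_one_sub {x : ℝ} (hx : x < 1) : x ≤ -Real.log (1 - x) := by
  have h := Real.log_le_sub_one_of_pos (x := 1 - x) (by linarith)
  linarith

theorem threshold_sub_gap_of_lt {α : ℝ≥0∞} (hα : α < 2) (n : ℕ) :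
    threshold α n - gap α n =
      Real.log 2 * (-Real.logb 2 (1 - ((1 / 2) ^ n) ^ 2 / 2)) ^ (α.toReal / 2) := by
  rw [threshold, gap, if_pos hα, if_pos hα, half_pow_two_mul_add_one]
  ring

theorem log_two_sub {n : ℕ} (hn : 2 ≤ n) : Real.log (2 - ((1 / 2) ^ n) ^ 2) =
    Real.log 2 + Real.log (1 - ((1 / 2) ^ n) ^ 2 / 2) := by
  have h := half_pow_le hn
  have h0 : (0 : ℝ) ≤ (1 / 2) ^ n := by positivity
  rw [← Real.log_mul (by norm_num) (by nlinarith)]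
  congr 1
  ring

theorem threshold_sub_gap_of_ge {α : ℝ≥0∞} (hα : 2 ≤ α) {n : ℕ} (hn : 2 ≤ n) :
    threshold α n - gap α n = -Real.log (1 - ((1 / 2) ^ n) ^ 2 / 2) := by
  rw [threshold, gap, if_neg hα.not_gt, if_neg hα.not_gt]
  split_ifs
  · rw [half_pow_two_mul, half_pow_two_mul_add_one, log_two_sub hn]
    ring
  · rw [half_pow_two_mul_add_one]
    ring

theorem orderFactor_mem_Icc {α : ℝ≥0∞} (hα : 2 ≤ α) :
    orderFactor α ∈ Set.Icc (1 / 4 : ℝ) (1 / 2) := by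
  unfold orderFactor
  split_ifs with h
  · norm_num
  · have h2 : 2 ≤ α.toReal := by
      have := ENNReal.toReal_mono h hα
      simpa using this
    constructor
    · rw [div_le_div_iff₀ (by norm_num) (by linarith)]
      linarith
    · rw [div_le_div_iff₀ (by linarith) (by norm_num)]
      linarith

/-- For `α ≤ 2` equality holds. For `α > 2` the left side is the bound times `2 * orderFactor α ≤
1`. -/
theorem threshold_add_gap_le (α : ℝ≥0∞) {n : ℕ} (hn : 2 ≤ n) :
    threshold α n + gap α n ≤ Real.log 2 - 2 * (1 / 2) ^ n + ((1 / 2) ^ n) ^ 2 := by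
  rcases lt_or_ge α 2 with hα | hα
  · rw [threshold, gap, if_pos hα, if_pos hα, half_pow_two_mul_add_one]
    linarith
  · rw [threshold, gap, if_neg hα.not_gt, if_neg hα.not_gt]
    split_ifs
    · rw [half_pow_two_mul, half_pow_two_mul_add_one, log_two_sub hn]
      linarith
    · have h := (orderFactor_mem_Icc hα).2
      have hq := half_pow_le hn
      have hlog := Real.log_two_gt_d9
      rw [half_pow_two_mul]
      have : 0 ≤ Real.log 2 - 2 * (1 / 2) ^ n + ((1 / 2) ^ n) ^ 2 := by
        norm_num at hq ⊢
        nlinarith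
      nlinarith

theorem two_le_of_minOutputs_le {α : ℝ≥0∞} (h0 : 0 < α) {n : ℕ} (hn : minOutputs α ≤ n) :
    2 ≤ n := by
  unfold minOutputs at hn
  split_ifs at hn with h
  · refine le_trans (Nat.le_floor ?_) hn
    have h1 : 0 < α.toReal := ENNReal.toReal_pos h0.ne' (h.trans ENNReal.one_lt_top).ne
    have h2 : α.toReal < 1 := by
      have := ENNReal.toReal_strict_mono ENNReal.one_ne_top h
      simpa using this
    rw [le_div_iff₀ h1]
    push_cast
    linarith
  · exact hn

theorem gap_le_threshold {α : ℝ≥0∞} {n : ℕ} (hn : 2 ≤ n) : gap α n ≤ threshold α n := by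
  have hq := half_pow_le hn
  have h0 : (0 : ℝ) < (1 / 2) ^ n := by positivity
  rw [← sub_nonneg]
  rcases lt_or_ge α 2 with hα | hα
  · rw [threshold_sub_gap_of_lt hα]
    refine mul_nonneg (Real.log_nonneg (by norm_num)) (Real.rpow_nonneg ?_ _)
    rw [neg_nonneg]
    exact Real.logb_nonpos (by norm_num) (by nlinarith) (by nlinarith)
  · rw [threshold_sub_gap_of_ge hα hn]
    exact le_trans (by positivity) (le_neg_log_one_sub (by nlinarith))

/-- The constant 0.746 lies just above `16 / (31 * ln 2)`, which comes from `q ^ 2 ≤ 1 / 16`, and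
just low enough for `0.746 / 16 < 0.36 ^ 3`, used in `gap_ge`. -/
theorem logb_bounds {n : ℕ} (hn : 2 ≤ n) :
    ((1 / 2) ^ n) ^ 2 / 2 ≤ -Real.logb 2 (1 - ((1 / 2) ^ n) ^ 2 / 2) ∧
    -Real.logb 2 (1 - ((1 / 2) ^ n) ^ 2 / 2) ≤ 0.746 * ((1 / 2) ^ n) ^ 2 := by
  have hq := half_pow_le hn
  have h0 : (0 : ℝ) < (1 / 2) ^ n := by positivity
  set q : ℝ := (1 / 2) ^ n
  have hq2 : q ^ 2 ≤ 1 / 16 := by nlinarith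
  have hlog := Real.log_two_gt_d9
  have hlog' := Real.log_two_lt_d9
  rw [Real.logb, ← neg_div]
  constructor
  · rw [le_div_iff₀ (by linarith)]
    have := le_neg_log_one_sub (x := q ^ 2 / 2) (by linarith)
    nlinarith [sq_nonneg q]
  · rw [div_le_iff₀ (by linarith)]
    refine (neg_log_one_sub_le (x := q ^ 2 / 2) (by linarith)).trans ?_
    rw [div_le_iff₀ (by linarith)]
    nlinarith [mul_nonneg (sq_nonneg q) (by linarith : 0 ≤ 1 / 16 - q ^ 2)]

/-- The estimate is tightest for `2 / 3 ≤ α < 2` at `n = 2`: there `0.64 * ln 2 / 2` exceeds `1 / 4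
- 1 / 32` by little more than 0.003. -/
theorem gap_ge {α : ℝ≥0∞} (h0 : 0 < α) {n : ℕ} (hn : minOutputs α ≤ n) : 0.003 ≤ gap α n := by
  have hn2 := two_le_of_minOutputs_le h0 hn
  have hq := half_pow_le hn2
  have hq0 : (0 : ℝ) < (1 / 2) ^ n := by positivity
  have hlog := Real.log_two_gt_d9
  obtain ⟨hu1, hu2⟩ := logb_bounds hn2
  have hl1 := neg_log_one_sub_le (x := ((1 / 2) ^ n) ^ 2 / 2) (by nlinarith)
  have hl2 : ((1 / 2 : ℝ) ^ n) ^ 2 / 2 / (1 - ((1 / 2) ^ n) ^ 2 / 2) ≤ 1 / 31 := by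
    rw [div_le_iff₀ (by nlinarith)]
    nlinarith
  rcases lt_or_ge α 2 with hα | hα
  · rw [gap, if_pos hα, half_pow_two_mul_add_one]
    have hne : α ≠ ⊤ := (hα.trans (by simp)).ne
    have ha0 : 0 < α.toReal := ENNReal.toReal_pos h0.ne' hne
    set u := -Real.logb 2 (1 - ((1 / 2) ^ n) ^ 2 / 2)
    have hu0 : 0 ≤ u := le_trans (by positivity) hu1
    by_cases ha : 2 / 3 ≤ α.toReal
    · have h36 : u ^ (α.toReal / 2) ≤ 0.36 := by
        have h1 : u ≤ 0.36 ^ 3 := by norm_num at hq ⊢; nlinarith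
        calc u ^ (α.toReal / 2) ≤ u ^ (1 / 3 : ℝ) := by
              refine Real.rpow_le_rpow_of_exponent_ge' hu0 (h1.trans (by norm_num)) (by norm_num) ?_
              linarith
          _ ≤ (0.36 ^ 3) ^ (1 / 3 : ℝ) := Real.rpow_le_rpow hu0 h1 (by norm_num)
          _ = 0.36 := by
              rw [← Real.rpow_natCast, ← Real.rpow_mul (by norm_num)]
              norm_num
      norm_num at hq h36 ⊢
      nlinarith
    · push Not at ha
      have hα1 : α < 1 := by
        rw [← ENNReal.toReal_lt_toReal hne ENNReal.one_ne_top]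
        simp only [ENNReal.toReal_one]
        linarith
      rw [minOutputs, if_pos hα1] at hn
      have h3 : 3 ≤ n := by
        refine le_trans (Nat.le_floor ?_) hn
        rw [le_div_iff₀ ha0]
        push_cast
        linarith
      have hq3 := half_pow_le h3
      -- From `n ≥ ⌊2 / α⌋` follows `(n + 1) * α > 2`. This bounds `q ^ α = 2 ^ (-n * α)` by `1 /
      -- 2`, and explains the form of `minOutputs`.
      have hna : 1 ≤ n * α.toReal := by
        have h1 := Nat.lt_of_floor_lt (Nat.lt_succ_of_le hn)
        rw [div_lt_iff₀ ha0] at h1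
        push_cast at h1
        linarith
      have hv : u ^ (α.toReal / 2) ≤ 1 / 2 := by
        calc u ^ (α.toReal / 2) ≤ (((1 / 2 : ℝ) ^ n) ^ 2) ^ (α.toReal / 2) :=
              Real.rpow_le_rpow hu0 (by nlinarith) (by linarith)
          _ = (1 / 2 : ℝ) ^ (n * α.toReal) := by
              rw [← pow_mul, ← Real.rpow_natCast, ← Real.rpow_mul (by norm_num)]
              congr 1
              push_cast
              ring
          _ ≤ (1 / 2 : ℝ) ^ (1 : ℝ) :=
              Real.rpow_le_rpow_of_exponent_ge (by norm_num) (by norm_num) hna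
          _ = 1 / 2 := by rw [Real.rpow_one]
      norm_num at hq3 hv ⊢
      nlinarith
  · rw [gap, if_neg hα.not_gt]
    split_ifs
    · rw [half_pow_two_mul, half_pow_two_mul_add_one, log_two_sub hn2]
      norm_num at hq hl1 hl2 ⊢
      nlinarith
    · have h := (orderFactor_mem_Icc hα).1
      rw [half_pow_two_mul, half_pow_two_mul_add_one]
      have h1 : 0.25 ≤ Real.log 2 - 2 * (1 / 2) ^ n + ((1 / 2) ^ n) ^ 2 := by
        norm_num at hq ⊢
        nlinarith
      have h2 := mul_le_mul h h1 (by norm_num) (by linarith)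
      norm_num at hl1 hl2 h2 ⊢
      linarith

end QEA

namespace QEA

open Filter Topology

/-! ### The entropy of a bit -/

theorem toReal_ne_one {α : ℝ≥0∞} (h1 : α ≠ 1) : α.toReal ≠ 1 := by
  rwa [Ne, ENNReal.toReal_eq_one_iff]

/-- The min-entropy is the least Rényi entropy. With `a` the real value of the order, `(1 - x) ^ a +
x ^ a` is the average of the `(a - 1)`-th powers with weights `1 - x` and `x`, and is compared with
the power of the larger weight; the direction depends on the sign of `a - 1`. -/
theorem neg_log_le_bitEntropy {α : ℝ≥0∞} (h0 : 0 < α) {x : ℝ} (hx0 : 0 ≤ x) (hx : x ≤ 1 / 2) :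
    -Real.log (1 - x) ≤ bitEntropy α x := by
  unfold bitEntropy
  have hM : 0 < 1 - x := by linarith
  split_ifs with h1 h2
  · rcases hx0.eq_or_lt with rfl | hx1
    · simp
    · have := Real.log_le_log hx1 (by linarith : x ≤ 1 - x)
      nlinarith
  · rw [max_eq_left (by linarith)]
  · have ha0 : 0 < α.toReal := ENNReal.toReal_pos h0.ne' h2
    have ha1 := toReal_ne_one h1
    set a := α.toReal
    have hpow : (1 - x) ^ a = (1 - x) ^ (a - 1) * (1 - x) := by
      rw [← Real.rpow_add_one hM.ne']; congr 1; ring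
    have hlog : Real.log ((1 - x) ^ (a - 1)) = (a - 1) * Real.log (1 - x) := Real.log_rpow hM _
    have hMa : 0 < (1 - x) ^ a := Real.rpow_pos_of_pos hM _
    have hxa : 0 ≤ x ^ a := Real.rpow_nonneg hx0 _
    have hxpow : x ^ a = x ^ (a - 1) * x := by
      rcases hx0.eq_or_lt with rfl | hx1
      · rw [Real.zero_rpow ha0.ne']; simp
      · rw [← Real.rpow_add_one hx1.ne']; congr 1; ring
    rcases ha1.lt_or_gt with ha | ha
    · rw [le_div_iff₀ (by linarith)]
      have h3 : (1 - x) ^ (a - 1) ≤ (1 - x) ^ a + x ^ a := by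
        rcases hx0.eq_or_lt with rfl | hx1
        · rw [Real.zero_rpow ha0.ne']; simp
        · have := Real.rpow_le_rpow_of_nonpos hx1 (by linarith : x ≤ 1 - x)
            (by linarith : a - 1 ≤ 0)
          rw [hpow, hxpow]
          nlinarith
      have h4 := Real.log_le_log (Real.rpow_pos_of_pos hM _) h3
      rw [hlog] at h4
      linarith
    · rw [le_div_iff_of_neg (by linarith)]
      have h3 : (1 - x) ^ a + x ^ a ≤ (1 - x) ^ (a - 1) := by
        have := Real.rpow_le_rpow hx0 (by linarith : x ≤ 1 - x) (by linarith : 0 ≤ a - 1)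
        rw [hpow, hxpow]
        nlinarith
      have h4 := Real.log_le_log (by linarith) h3
      rw [hlog] at h4
      linarith

theorem bitEntropy_le_of_one_lt {α : ℝ≥0∞} (h1 : 1 < α) (h2 : α ≠ ⊤) {x : ℝ} (hx0 : 0 ≤ x)
    (hx : x ≤ 1 / 2) :
    bitEntropy α x ≤ α.toReal / (α.toReal - 1) * -Real.log (1 - x) := by
  have ha : 1 < α.toReal := by
    have := ENNReal.toReal_strict_mono h2 h1
    simpa using this
  have hM : 0 < 1 - x := by linarith
  rw [bitEntropy, if_neg h1.ne', if_neg h2]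
  have h3 := Real.log_le_log (Real.rpow_pos_of_pos hM α.toReal)
    (le_add_of_nonneg_right (Real.rpow_nonneg hx0 α.toReal))
  rw [Real.log_rpow hM] at h3
  rw [div_le_iff_of_neg (by linarith)]
  have : α.toReal / (α.toReal - 1) * -Real.log (1 - x) * (1 - α.toReal) =
      α.toReal * Real.log (1 - x) := by
    have : α.toReal - 1 ≠ 0 := by linarith
    field_simp
    ring
  linarith

theorem bitEntropy_le_of_two_le {α : ℝ≥0∞} (hα : 2 ≤ α) {x : ℝ} (hx0 : 0 ≤ x) (hx : x ≤ 1 / 2) :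
    bitEntropy α x ≤ 2 * -Real.log (1 - x) := by
  have hl : 0 ≤ -Real.log (1 - x) := hx0.trans (le_neg_log_one_sub (by linarith))
  have h1 : 1 < α := lt_of_lt_of_le (by norm_num) hα
  by_cases h2 : α = ⊤
  · rw [bitEntropy, if_neg h1.ne', if_pos h2, max_eq_left (by linarith)]
    linarith
  · refine (bitEntropy_le_of_one_lt h1 h2 hx0 hx).trans (mul_le_mul_of_nonneg_right ?_ hl)
    have ha : 2 ≤ α.toReal := by
      have := ENNReal.toReal_mono h2 hα
      simpa using this
    rw [div_le_iff₀ (by linarith)]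
    linarith

/-- The bound `-x * ln x ≤ 2 * √x` comes from `ln y ≥ 1 - 1 / y` at `y = √x`. -/
theorem bitEntropy_one_le {x : ℝ} (hx0 : 0 ≤ x) (hx : x ≤ 1 / 2) :
    bitEntropy 1 x ≤ 2 * x + 2 * Real.sqrt x := by
  rw [bitEntropy, if_pos rfl]
  have h1 := neg_log_one_sub_le (x := x) (by linarith)
  have hM : 0 < 1 - x := by linarith
  rw [le_div_iff₀ hM] at h1
  have h2 : -(x * Real.log x) ≤ 2 * Real.sqrt x := by
    rcases hx0.eq_or_lt with rfl | hx1
    · simp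
    · have hs : 0 < Real.sqrt x := Real.sqrt_pos.2 hx1
      have h3 := Real.one_sub_inv_le_log_of_pos hs
      have h4 : Real.sqrt x ^ 2 = x := Real.sq_sqrt hx0
      have h5 : Real.log x = 2 * Real.log (Real.sqrt x) := by
        rw [← Real.log_rpow hs, Real.rpow_two, h4]
      have h6 : x * (Real.sqrt x)⁻¹ = Real.sqrt x := by
        rw [← div_eq_mul_inv, Real.div_sqrt]
      rw [h5]
      nlinarith
  nlinarith

theorem bitEntropy_le_of_lt_one {α : ℝ≥0∞} (h0 : 0 < α) (h1 : α < 1) {x : ℝ} (hx0 : 0 ≤ x)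
    (hx : x ≤ 1 / 2) : bitEntropy α x ≤ x ^ α.toReal / (1 - α.toReal) := by
  have h2 : α ≠ ⊤ := (h1.trans ENNReal.one_lt_top).ne
  have ha0 : 0 < α.toReal := ENNReal.toReal_pos h0.ne' h2
  have ha : α.toReal < 1 := by
    have := ENNReal.toReal_strict_mono ENNReal.one_ne_top h1
    simpa using this
  rw [bitEntropy, if_neg h1.ne, if_neg h2]
  refine div_le_div_of_nonneg_right ?_ (by linarith)
  have hM : 0 < (1 - x) ^ α.toReal := Real.rpow_pos_of_pos (by linarith) _
  have hM1 : (1 - x) ^ α.toReal ≤ 1 := Real.rpow_le_one (by linarith) (by linarith) ha0.le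
  have hxa : 0 ≤ x ^ α.toReal := Real.rpow_nonneg hx0 _
  have := Real.log_le_sub_one_of_pos (by linarith : 0 < (1 - x) ^ α.toReal + x ^ α.toReal)
  linarith

theorem sixteenth_pow (n : ℕ) : ((1 : ℝ) / 16) ^ n = ((1 / 2) ^ n) ^ 4 := by
  rw [← pow_mul, mul_comm, pow_mul]
  norm_num

/-- By `ln y ≤ y - 1` at `y = 2 * (1 - x)`, the min-entropy is at least `ln 2 - (1 - 2 * x) ≥ ln 2 -
q ^ 4`, and `q ^ 4 ≤ 2 * q - q ^ 2`. -/
theorem threshold_add_gap_le_bitEntropy {α : ℝ≥0∞} (h0 : 0 < α) {n : ℕ} (hn : 2 ≤ n) {x : ℝ}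
    (hx0 : (1 - (1 / 16) ^ n) / 2 ≤ x) (hx : x ≤ 1 / 2) :
    threshold α n + gap α n ≤ bitEntropy α x := by
  have hq := half_pow_le hn
  have hq0 : (0 : ℝ) < (1 / 2) ^ n := by positivity
  rw [sixteenth_pow] at hx0
  refine (threshold_add_gap_le α hn).trans ?_
  set q : ℝ := (1 / 2) ^ n
  have hq2 : q ^ 2 ≤ q / 4 := by nlinarith
  have hq4 : q ^ 4 ≤ q / 4 := by nlinarith [sq_nonneg q]
  have hx1 : 0 ≤ x := by nlinarith
  refine le_trans ?_ (neg_log_le_bitEntropy h0 hx1 hx)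
  have h1 : Real.log (1 - x) = Real.log (2 * (1 - x)) - Real.log 2 := by
    rw [Real.log_mul (by norm_num) (by linarith)]; ring
  have h2 := Real.log_le_sub_one_of_pos (by linarith : 0 < 2 * (1 - x))
  nlinarith

/-- For `α < 2` the difference `t - g` is at least of order `q ^ α`, whereas the entropy at `x ≤ q ^
4 / 2` is bounded by a multiple of `q ^ (4 * α)` for `α < 1`, of `q ^ 2` for `α = 1` and of `q ^ 4`
for `α > 1`. The constants blow up as `α → 1`, hence "eventually". For `α ≥ 2` they are uniform and
`n ≥ 2` suffices. -/
theorem eventually_bitEntropy_le {α : ℝ≥0∞} (h0 : 0 < α) : ∀ᶠ n : ℕ in atTop, ∀ x : ℝ, 0 ≤ x →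
    x ≤ (1 / 16) ^ n / 2 → bitEntropy α x ≤ threshold α n - gap α n := by
  have hlim : Tendsto (fun n : ℕ => ((1 : ℝ) / 2) ^ n) atTop (𝓝 0) :=
    tendsto_pow_atTop_nhds_zero_of_lt_one (by norm_num) (by norm_num)
  have hlog := Real.log_two_gt_d9
  have hsmall : ∀ {q x : ℝ}, 0 < q → q ≤ 1 / 4 → x ≤ q ^ 4 / 2 → x ≤ q ^ 2 / 32 ∧ x ≤ 1 / 2 := by
    intro q x hq0 hq hx
    have h1 : q ^ 2 ≤ 1 / 16 := by nlinarith
    have h2 : q ^ 4 = q ^ 2 * q ^ 2 := by ring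
    have h3 : q ^ 4 ≤ 1 / 16 * q ^ 2 := by rw [h2]; gcongr
    constructor <;> linarith
  rcases lt_or_ge α 2 with hα | hα
  · have hne : α ≠ ⊤ := (hα.trans (by simp)).ne
    have ha0 : 0 < α.toReal := ENNReal.toReal_pos h0.ne' hne
    have ha2 : α.toReal < 2 := by
      have := ENNReal.toReal_strict_mono (by simp) hα
      simpa using this
    have hbase : ∀ n : ℕ, 2 ≤ n → 1 / 2 * (((1 / 2 : ℝ) ^ n) ^ 2 / 2) ^ (α.toReal / 2) ≤
        threshold α n - gap α n := by
      intro n hn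
      rw [threshold_sub_gap_of_lt hα]
      exact mul_le_mul (by linarith) (Real.rpow_le_rpow (by positivity) (logb_bounds hn).1
        (by linarith)) (by positivity) (by linarith)
    rcases lt_trichotomy α 1 with h1 | rfl | h1
    · have ha1 : α.toReal < 1 := by
        have := ENNReal.toReal_strict_mono ENNReal.one_ne_top h1
        simpa using this
      have hlim2 : Tendsto (fun n : ℕ => (((1 : ℝ) / 2) ^ n) ^ (2 * α.toReal)) atTop (𝓝 0) := by
        have := hlim.rpow_const (p := 2 * α.toReal) (Or.inr (by linarith))
        rwa [Real.zero_rpow (by linarith)] at this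
      have hev := hlim2.eventually_le_const (by linarith : 0 < (1 - α.toReal) / 2)
      filter_upwards [hev, eventually_ge_atTop 2] with n hn hn2 x hx0 hx
      have hq := half_pow_le hn2
      have hq0 : (0 : ℝ) < (1 / 2) ^ n := by positivity
      rw [sixteenth_pow] at hx
      refine le_trans ?_ (hbase n hn2)
      set q : ℝ := (1 / 2) ^ n
      norm_num at hq
      refine (bitEntropy_le_of_lt_one h0 h1 hx0 (hsmall hq0 hq hx).2).trans ?_
      rw [div_le_iff₀ (by linarith)]
      -- The factor `q / 2` matches the size of `t - g`; the factor `q ^ (2 * α)` left over tends to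
      -- `0` and absorbs the denominator `1 - α`.
      have hxq : x ≤ q / 2 * q ^ 2 := by nlinarith [(hsmall hq0 hq hx).1, pow_pos hq0 3]
      calc x ^ α.toReal ≤ (q / 2 * q ^ 2) ^ α.toReal := Real.rpow_le_rpow hx0 hxq ha0.le
        _ = (q / 2) ^ α.toReal * q ^ (2 * α.toReal) := by
            rw [Real.mul_rpow (by positivity) (by positivity), Real.rpow_mul hq0.le, Real.rpow_two]
        _ ≤ (q ^ 2 / 2) ^ (α.toReal / 2) * ((1 - α.toReal) / 2) := by
            refine mul_le_mul ?_ hn (by positivity) (by positivity)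
            calc (q / 2) ^ α.toReal = ((q / 2) ^ (2 : ℝ)) ^ (α.toReal / 2) := by
                  rw [← Real.rpow_mul (by positivity)]; congr 1; ring
              _ ≤ (q ^ 2 / 2) ^ (α.toReal / 2) := by
                  refine Real.rpow_le_rpow (by positivity) ?_ (by linarith)
                  rw [Real.rpow_two]
                  nlinarith [sq_nonneg q]
        _ = _ := by ring
    · have hev := hlim.eventually_le_const (by norm_num : (0 : ℝ) < 1 / 16)
      filter_upwards [hev, eventually_ge_atTop 2] with n hn hn2 x hx0 hx
      have hq0 : (0 : ℝ) < (1 / 2) ^ n := by positivity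
      rw [sixteenth_pow] at hx
      have h2 := hbase n hn2
      refine le_trans ?_ h2
      set q : ℝ := (1 / 2) ^ n
      obtain ⟨hx1, hx2⟩ := hsmall hq0 (by linarith) hx
      refine (bitEntropy_one_le hx0 hx2).trans ?_
      have hs : Real.sqrt x ≤ q ^ 2 := Real.sqrt_le_iff.2 ⟨by positivity, by nlinarith [pow_pos hq0 4]⟩
      have hr : q / 2 ≤ (q ^ 2 / 2) ^ ((1 : ℝ≥0∞).toReal / 2) := by
        rw [ENNReal.toReal_one, ← Real.sqrt_eq_rpow]
        exact Real.le_sqrt_of_sq_le (by nlinarith [sq_nonneg q])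
      nlinarith
    · have ha1 : 1 < α.toReal := by
        have := ENNReal.toReal_strict_mono hne h1
        simpa using this
      have hC : 0 < α.toReal / (α.toReal - 1) := div_pos ha0 (by linarith)
      have hev := hlim.eventually_le_const (div_pos (by norm_num : (0 : ℝ) < 1 / 16) hC)
      filter_upwards [hev, eventually_ge_atTop 2] with n hn hn2 x hx0 hx
      have hq := half_pow_le hn2
      have hq0 : (0 : ℝ) < (1 / 2) ^ n := by positivity
      rw [sixteenth_pow] at hx
      refine le_trans ?_ (hbase n hn2)
      set q : ℝ := (1 / 2) ^ n
      norm_num at hq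
      obtain ⟨hx1, hx2⟩ := hsmall hq0 hq hx
      rw [le_div_iff₀ hC] at hn
      have hl := neg_log_one_sub_le (x := x) (by linarith)
      have hl2 : x / (1 - x) ≤ 2 * x := by
        rw [div_le_iff₀ (by linarith)]; nlinarith
      have hr : q ^ 2 / 2 ≤ (q ^ 2 / 2) ^ (α.toReal / 2) := by
        have := Real.rpow_le_rpow_of_exponent_ge (x := q ^ 2 / 2) (by positivity) (by nlinarith)
          (by linarith : α.toReal / 2 ≤ 1)
        rwa [Real.rpow_one] at this
      have hx3 : 2 * x ≤ q * q ^ 2 := by nlinarith [pow_pos hq0 3]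
      calc bitEntropy α x ≤ α.toReal / (α.toReal - 1) * -Real.log (1 - x) :=
            bitEntropy_le_of_one_lt h1 hne hx0 hx2
        _ ≤ α.toReal / (α.toReal - 1) * (q * q ^ 2) :=
            mul_le_mul_of_nonneg_left (by linarith) hC.le
        _ = q * (α.toReal / (α.toReal - 1)) * q ^ 2 := by ring
        _ ≤ 1 / 16 * q ^ 2 := by gcongr
        _ ≤ _ := by nlinarith [sq_nonneg q]
  · filter_upwards [eventually_ge_atTop 2] with n hn2 x hx0 hx
    have hq := half_pow_le hn2
    have hq0 : (0 : ℝ) < (1 / 2) ^ n := by positivity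
    rw [sixteenth_pow] at hx
    rw [threshold_sub_gap_of_ge hα hn2]
    set q : ℝ := (1 / 2) ^ n
    norm_num at hq
    obtain ⟨hx1, hx2⟩ := hsmall hq0 hq hx
    refine (bitEntropy_le_of_two_le hα hx0 hx2).trans ?_
    have hl := neg_log_one_sub_le (x := x) (by linarith)
    have hl2 : x / (1 - x) ≤ 2 * x := by
      rw [div_le_iff₀ (by linarith)]; nlinarith
    have := le_neg_log_one_sub (x := q ^ 2 / 2) (by nlinarith)
    nlinarith [sq_nonneg q]

end QEA

namespace QEA

open Function StackProg Filter

/-! ### Descriptions determine circuits -/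

theorem encodeNat_append_inj {a b : ℕ} {s t : List Bool}
    (h : encodeNat a ++ s = encodeNat b ++ t) : a = b ∧ s = t := by
  induction a generalizing b with
  | zero =>
    cases b with
    | zero => simpa [encodeNat] using h
    | succ b => simp [encodeNat, List.replicate_succ] at h
  | succ a ih =>
    cases b with
    | zero => simp [encodeNat, List.replicate_succ] at h
    | succ b =>
      have := @ih b (by simpa [encodeNat, List.replicate_succ] using h)
      exact ⟨by rw [this.1], this.2⟩

theorem flatMap_encodeNat_append_inj {l l' : List ℕ} {s t : List Bool} (hl : l.length = l'.length)
    (h : l.flatMap encodeNat ++ s = l'.flatMap encodeNat ++ t) : l = l' ∧ s = t := by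
  induction l generalizing l' with
  | nil =>
    obtain rfl := List.length_eq_zero_iff.1 hl.symm
    exact ⟨rfl, by simpa using h⟩
  | cons a l ih =>
    cases l' with
    | nil => simp at hl
    | cons b l' =>
      simp only [List.flatMap_cons, List.append_assoc] at h
      obtain ⟨rfl, h1⟩ := encodeNat_append_inj h
      obtain ⟨rfl, h2⟩ := ih (by simpa using hl) h1
      exact ⟨rfl, h2⟩

theorem Gate.raw_injective {m : ℕ} : Injective (Gate.raw : Gate m → ℕ × List ℕ) := by
  intro g g' h
  cases g <;> cases g' <;> simp [Gate.raw, Fin.ext_iff] at h ⊢ <;> exact h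

theorem Gate.encode_append_inj {m : ℕ} {g g' : Gate m} {s t : List Bool}
    (h : g.encode ++ s = g'.encode ++ t) : g = g' ∧ s = t := by
  rw [Gate.encode_eq, Gate.encode_eq, encodeRaw, encodeRaw, List.append_assoc,
    List.append_assoc] at h
  obtain ⟨h1, h⟩ := encodeNat_append_inj h
  obtain ⟨h2, h⟩ := flatMap_encodeNat_append_inj (by
    rw [g.validRaw.2.1, g'.validRaw.2.1, h1]) h
  exact ⟨Gate.raw_injective (Prod.ext h1 h2), h⟩

theorem flatMap_encode_injective {m : ℕ} :
    Injective fun gs : List (Gate m) => gs.flatMap Gate.encode := by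
  have hne : ∀ g : Gate m, g.encode ≠ [] := fun g => by
    rw [Gate.encode_eq]; exact encodeRaw_ne_nil _
  intro gs
  induction gs with
  | nil =>
    intro gs' h
    cases gs' with
    | nil => rfl
    | cons g' gs' =>
      have : g'.encode = [] ∧ gs'.flatMap Gate.encode = [] := by simpa using h.symm
      exact absurd this.1 (hne g')
  | cons g gs ih =>
    intro gs' h
    cases gs' with
    | nil =>
      have : g.encode = [] ∧ gs.flatMap Gate.encode = [] := by simpa using h
      exact absurd this.1 (hne g)
    | cons g' gs' =>
      simp only [List.flatMap_cons] at h
      obtain ⟨rfl, h1⟩ := Gate.encode_append_inj h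
      rw [ih h1]

theorem encode_injective {m n : ℕ} : Injective (Circuit.encode : Circuit m n → List Bool) := by
  intro C C' h
  have hout : ∀ D : Circuit m n, (List.ofFn fun i => encodeNat (D.out i)).flatten =
      (List.ofFn fun i => (D.out i : ℕ)).flatMap encodeNat := by
    intro D
    rw [List.flatMap, List.map_ofFn]
    rfl
  rw [Circuit.encode, Circuit.encode, hout, hout] at h
  simp only [List.append_assoc] at h
  obtain ⟨h1, h2⟩ := flatMap_encodeNat_append_inj (by simp)
    (encodeNat_append_inj (encodeNat_append_inj h).2).2
  obtain ⟨gs, out⟩ := C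
  obtain ⟨gs', out'⟩ := C'
  have h3 : out = out' := by
    ext i
    exact congrFun (List.ofFn_injective h1) i
  have h4 : gs = gs' := flatMap_encode_injective h2
  rw [h3, h4]

theorem encode_sizes {m n m' n' : ℕ} {C : Circuit m n} {C' : Circuit m' n'}
    (h : C.encode = C'.encode) : n = n' := by
  rw [Circuit.encode, Circuit.encode] at h
  simp only [List.append_assoc] at h
  exact (encodeNat_append_inj (encodeNat_append_inj h).2).1

/-- A string describes at most one circuit, so a *yes* and *no* instance would give one entropy on
both sides of a positive gap. -/
theorem rank2RenyiQEA_consistent (m : ℕ → ℕ) (α : ℝ≥0∞) (t g : ℕ → ℝ) (N : ℕ)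
    (hg : ∀ n, N ≤ n → 0 < g n) : (rank2RenyiQEA m α t g N).Consistent := by
  rw [PromiseProblem.Consistent, Set.disjoint_left]
  rintro s ⟨n, hn, C, rfl, _, h1⟩ ⟨n', _, C', h, _, h2⟩
  obtain rfl := encode_sizes h
  obtain rfl := encode_injective h
  linarith [hg n hn]

/-! ### Hardness -/

theorem rank2RenyiQEA_hard {α : ℝ≥0∞} (h0 : 0 < α) {m : ℕ → ℕ}
    (hm : ∀ n, m n = n * n ^ 4 + 2 * n ^ 4 + n) (N : ℕ) :
    BQPHard (rank2RenyiQEA m α (threshold α) (gap α) N) := by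
  rintro L ⟨k, C, hpoly, hyes, hno⟩
  obtain ⟨n₁, hn₁⟩ := eventually_atTop.1 (eventually_bitEntropy_le h0)
  let l₀ := max N (max n₁ 8)
  -- `n = 2 ^ l x` must exceed `N`, the bound `n₁` from the *no* case, and `k x`; `l ≥ 8` is needed
  -- for the amplification. Adding `(k x).size` to the constant `l₀` makes `n` the product `2 ^ l₀ *
  -- 2 ^ (k x).size` that the generator computes.
  let l : List Bool → ℕ := fun x => l₀ + (k x).size
  have hl : ∀ x, l₀ ≤ l x := fun x => Nat.le_add_right _ _
  have hln : ∀ x, l x ≤ 2 ^ l x := fun x => Nat.lt_two_pow_self.le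
  have hN : ∀ x, N ≤ 2 ^ l x := fun x => (le_max_left _ _).trans ((hl x).trans (hln x))
  have h8 : ∀ x, 8 ≤ l x := fun x =>
    (le_max_right _ _).trans ((le_max_right _ _).trans (hl x))
  have h1 : ∀ x, n₁ ≤ 2 ^ l x := fun x =>
    (le_max_left _ _).trans ((le_max_right _ _).trans ((hl x).trans (hln x)))
  have hk : ∀ x, k x ≤ 2 ^ l x := fun x =>
    (Nat.lt_size_self (k x)).le.trans (Nat.pow_le_pow_right (by norm_num) (Nat.le_add_left _ _))
  have hpos : ∀ x, 0 < 2 ^ l x := fun x => by positivity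
  choose Q hQenc hQgates hQout using fun x =>
    exists_generated_circuit (C x) (hk x) (hpos x) (hm (2 ^ l x))
  have hstate := fun x => outputState_generated (C x) (hk x) (hpos x) (L := 4 * l x)
    (by rw [← pow_mul, mul_comm]) (hm (2 ^ l x)) (Q x) (hQgates x) (hQout x)
  have hp := fun x => acceptProb_mem_Icc (C x)
  have hprob := fun x => nandProb_mem_Icc (4 * l x) (hp x)
  have hent := fun x => entropy_eq_bitEntropy (hpos x) (Q x)
    (div_nonneg (hprob x).1 (by norm_num)) (hstate x) h0
  refine ⟨fun x => (Q x).encode, ?_, ?_, ?_⟩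
  · refine polyTime_generate (2 ^ l₀) hpoly fun x =>
      ⟨k x, (C x).out 0, (C x).gates.map Gate.raw, ?_, ?_, ?_⟩
    · have h2 : (C x).gates.flatMap Gate.encode =
          ((C x).gates.map Gate.raw).flatMap encodeRaw := by
        rw [List.flatMap_map]
        exact congrArg (fun f => (C x).gates.flatMap f) (funext Gate.encode_eq)
      rw [Circuit.encode, h2]
      simp
    · intro r hr
      obtain ⟨g, _, rfl⟩ := List.mem_map.1 hr
      exact g.validRaw
    · rw [← pow_add]
      exact hQenc x
  · intro x hx
    refine ⟨2 ^ l x, hN x, Q x, rfl, rank_le_two (Q x) (hstate x), ?_⟩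
    rw [hent]
    have := le_nandProb (h8 x) (hyes x hx) (hp x).2
    exact threshold_add_gap_le_bitEntropy h0
      (le_trans (by norm_num : 2 ≤ 8) ((h8 x).trans (hln x))) (by linarith)
      (by linarith [(hprob x).2])
  · intro x hx
    refine ⟨2 ^ l x, hN x, Q x, rfl, rank_le_two (Q x) (hstate x), ?_⟩
    rw [hent]
    have := nandProb_le (h8 x) (hp x).1 (hno x hx)
    exact hn₁ _ (h1 x) _ (div_nonneg (hprob x).1 (by norm_num)) (by linarith)

end QEA

theorem mainTheorem1 :
    (∃ c : ℝ, 0 < c ∧ ∀ α : ℝ≥0∞, 0 < α → ∀ n : ℕ, QEA.minOutputs α ≤ n →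
      0 < QEA.threshold α n ∧ c ≤ QEA.gap α n) ∧
    ∃ m : Polynomial ℕ, ∀ α : ℝ≥0∞, 0 < α → ∀ N : ℕ, QEA.minOutputs α ≤ N →
      (QEA.rank2RenyiQEA (fun n => m.eval n) α (QEA.threshold α) (QEA.gap α) N).Consistent ∧
      QEA.BQPHard
        (QEA.rank2RenyiQEA (fun n => m.eval n) α (QEA.threshold α) (QEA.gap α) N) := by
  have hgap : ∀ α : ℝ≥0∞, 0 < α → ∀ n : ℕ, QEA.minOutputs α ≤ n → 0.003 ≤ QEA.gap α n :=
    fun α h0 n hn => QEA.gap_ge h0 hn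
  refine ⟨⟨0.003, by norm_num, fun α h0 n hn => ⟨?_, hgap α h0 n hn⟩⟩,
    -- The wires are `n ^ 4` blocks of `n`, then `n ^ 4` leaves, `n ^ 4 - 1` inner nodes, one coin
    -- and `n` outputs.
    .X ^ 5 + 2 * .X ^ 4 + .X, fun α h0 N hN =>
      ⟨QEA.rank2RenyiQEA_consistent _ α _ _ N fun n hn => ?_, ?_⟩⟩
  · have h1 := hgap α h0 n hn
    have h2 := QEA.gap_le_threshold (α := α) (QEA.two_le_of_minOutputs_le h0 hn)
    norm_num at h1
    linarith
  · have h1 := hgap α h0 n (hN.trans hn)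
    norm_num at h1
    linarith
  · refine QEA.rank2RenyiQEA_hard h0 (fun n => ?_) N
    simp
    ring
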